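/- **Setting.** Let $n\ge 2$ agents be connected by an undirected connected graph, and let $W=(w_{ij})\in\mathbb R^{n\times n}$ be nonnegative, symmetric and stochastic ($W\mathbf 1=\mathbf 1$) with, for $i\ne j$, $w_{ij}>0$ exactly when $i,j$ are linked; $\lambda_1\ge\lambda_2\ge\dots\ge\lambda_n$ are its eigenvalues. Let $f=\frac1n\sum_{i=1}^n f_i$, where each $f_i:\mathbb R^p\to\mathbb R$ is differentiable, has $L$-Lipschitz gradient and satisfies $f_i\ge\underline f_i$; put $f^{\inf}=\frac1n\sum_i\underline f_i$. Let $\mathcal C_1$ be a randomized compressor with $\mathbb E\|\mathcal C_1(x)-x\|^2\le(1-\delta)\|x\|^2$ for all $x\in\mathbb R^p$, $\delta\in(0,1]$ (that is, $\mathcal C_1\in\mathbb B(\delta)$), let $\mathcal C_2$ be an unbiased one, $\mathbb E\,\mathcal C_2(x)=x$, with $\mathbb E\|\mathcal C_2(x)-x\|^2\le C\|x\|^2$ for all $x$, $C>0$, and let $\mathcal C(x)=\mathcal C_1(x)+\mathcal C_2(x-\mathcal C_1(x))$ with independent draws of $\mathcal C_1$ and $\mathcal C_2$. **Algorithm (CEDAS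 with constant stepsize $\eta$).** Given deterministic $x_{i,-1},h_{i,0}\in\mathbb R^p$, put $x_{i,0}=x_{i,-1}-\eta g_{i,-1}$, $d_{i,0}=0$, $(h_w)_{i,0}=\sum_j w_{ij}h_{j,0}$, and for $k\ge 0$ $$y_{i,k}=x_{i,k}-\eta g_{i,k}-d_{i,k},\quad q_{i,k}=\mathcal C(y_{i,k}-h_{i,k}),\quad \hat y_{i,k}=h_{i,k}+q_{i,k},\quad (\hat y_w)_{i,k}=(h_w)_{i,k}+\sum_j w_{ij}q_{j,k},$$ $$h_{i,k+1}=(1-\alpha)h_{i,k}+\alpha\hat y_{i,k},\quad (h_w)_{i,k+1}=(1-\alpha)(h_w)_{i,k}+\alpha(\hat y_w)_{i,k},$$ $$d_{i,k+1}=d_{i,k}+\tfrac{\gamma}{2}\big(\hat y_{i,k}-(\hat y_w)_{i,k}\big),\quad x_{i,k+1}=x_{i,k}-\eta g_{i,k}-d_{i,k+1}.$$ Here $g_{i,k}=\nabla f_i(x_{i,k};\xi_{i,k})$, $k\ge-1$, are stochastic gradients with $\mathbb E[g_{i,k}\mid\cdot]=\nabla f_i(x_{i,k})$ and $\mathbb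 E[\|g_{i,k}-\nabla f_i(x_{i,k})\|^2\mid\cdot]\le\sigma^2$, conditionally on all samples and compressor draws of the earlier iterations and on the samples of the other agents in iteration $k$ (as is the case when, given the past, the samples are independent across agents); each compressor draw is independent of everything drawn before it (all earlier iterations and the gradient samples of its iteration). Write $\bar x_k=\frac1n\sum_i x_{i,k}$. **Parameters.** $$\alpha=\frac1{12C(1-\delta)},\qquad \gamma=\min\Big\{\frac{\sqrt\alpha}{2\sqrt{C(1-\delta)}},\ \frac12,\ \frac{\alpha^2(1-\lambda_2)}{1728\,C(1-\delta)}\Big\},$$ where $12C(1-\delta)\ge 1$, so that $\alpha$ is defined and $\alpha\le1$. For each horizon $K$ the algorithm is run with $\eta=\sqrt{n/K}$, and horizons $$K\ \ge\ K_{\min}:=\max\Big\{\frac{12L^2n}{\alpha},\ \frac{256\,nL^2}{\gamma^2(1-\lambda_2)^2}\Big\}$$ are considered. **Initial values.** $f(\bar x_{-1})-f^{\inf}\le\Delta$, $\ \sum_i\|x_{i,-1}\|^2\le c_1n^2$, $\ \sum_i\|h_{i,0}\|^2\le c_2n^2$, $\ \sum_i\|\nabla f_i(x_{i,-1})\|^2\le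 c_3n^2$, $\ \frac1{1-\lambda_2}\le c_4n^r$ for some $r>0$. **Claim.** For the transient time with constant $a$, $$K_T^{(ncvx)}:=\inf\Big\{K\ge K_{\min}:\ \frac1k\sum_{t=0}^{k-1}\mathbb E\big[\|\nabla f(\bar x_t)\|^2\big]\le\frac{a}{\sqrt{nk}}\ \text{ for the run of every horizon } k\ge K\Big\},$$ one has $K_T^{(ncvx)}=\mathcal O\Big(\dfrac{n^3C^6(1-\delta)}{(1-\lambda_2)^4}\Big)$. That is: for all $L,\sigma,r>0$ and real $\Delta,c_1,\dots,c_4$ there are $a,b>0$, depending on these numbers only (not on $n$, $p$, the network, $W$, the $f_i$, the compressors, $C$ or $\delta$), such that always $$K_T^{(ncvx)}\ \le\ b\,\frac{n^3C^6(1-\delta)}{(1-\lambda_2)^4}.$$ -/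

import Mathlib

open MeasureTheory ProbabilityTheory
open scoped ENNReal

/-- The space `ℝ^p` with its Euclidean norm. -/
abbrev Vec (p : ℕ) : Type := EuclideanSpace ℝ (Fin p)

/-! ### Network -/

/-- The mixing matrix `W` is compliant to the undirected connected graph `G`: it is nonnegative,
symmetric and stochastic, and for `i ≠ j` the weight `w_ij` is positive exactly on the links. -/
structure IsMixingMatrix {n : ℕ} (G : SimpleGraph (Fin n)) (W : Matrix (Fin n) (Fin n) ℝ) :
    Prop where
  connected : G.Connected
  nonneg : ∀ i j, 0 ≤ W i j
  symm : W.IsSymm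
  stochastic : ∀ i, ∑ j, W i j = 1
  link : ∀ i j, i ≠ j → (G.Adj i j ↔ 0 < W i j)

theorem IsMixingMatrix.isHermitian {n : ℕ} {G : SimpleGraph (Fin n)}
    {W : Matrix (Fin n) (Fin n) ℝ} (h : IsMixingMatrix G W) : W.IsHermitian := by
  rw [Matrix.IsHermitian, Matrix.conjTranspose_eq_transpose_of_trivial]
  exact h.symm

/-- The second largest eigenvalue `λ₂` (with multiplicity) of a symmetric matrix
(`eigenvalues₀` lists the eigenvalues in decreasing order). -/
noncomputable def secondEigenvalue {n : ℕ} (W : Matrix (Fin n) (Fin n) ℝ) (hW : W.IsHermitian)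
    (hn : 2 ≤ n) : ℝ :=
  hW.eigenvalues₀ ⟨1, by rw [Fintype.card_fin]; omega⟩

/-! ### Objective functions -/

/-- The average objective `f = (1/n) ∑ f_i`. -/
noncomputable def avgFun {n p : ℕ} (f : Fin n → Vec p → ℝ) (x : Vec p) : ℝ :=
  (n : ℝ)⁻¹ * ∑ i, f i x

/-- The average of `n` vectors. -/
noncomputable def avgVec {n p : ℕ} (x : Fin n → Vec p) : Vec p :=
  (n : ℝ)⁻¹ • ∑ i, x i

/-- Every `f_i` is differentiable with `L`-Lipschitz gradient and bounded below by `fLow i`. -/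
structure IsSmoothBelow {n p : ℕ} (f : Fin n → Vec p → ℝ) (L : ℝ) (fLow : Fin n → ℝ) :
    Prop where
  differentiable : ∀ i, Differentiable ℝ (f i)
  lipschitz : ∀ i x x', ‖gradient (f i) x - gradient (f i) x'‖ ≤ L * ‖x - x'‖
  below : ∀ i x, fLow i ≤ f i x

/-! ### Compression operators -/

/-- A randomized map `ℝ^p → ℝ^p`: with `z` drawn from `law`, the input `x` is sent to
`toFun x z`. -/
structure RandomMap (p : ℕ) (Z : Type*) [MeasurableSpace Z] where
  toFun : Vec p → Z → Vec p
  law : Measure Z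
  isProb : IsProbabilityMeasure law
  measurable : Measurable (Function.uncurry toFun)

/-- `𝒞 ∈ 𝕌(C)`: the compressor is unbiased with `E‖𝒞(x) - x‖² ≤ C ‖x‖²`. -/
structure RandomMap.IsUnbiased {p : ℕ} {Z : Type*} [MeasurableSpace Z] (𝒞 : RandomMap p Z)
    (C : ℝ) : Prop where
  pos : 0 < C
  integrable : ∀ x, Integrable (𝒞.toFun x) 𝒞.law
  mean : ∀ x, ∫ z, 𝒞.toFun x z ∂𝒞.law = x
  integrable_sq : ∀ x, Integrable (fun z => ‖𝒞.toFun x z - x‖ ^ 2) 𝒞.law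
  bound : ∀ x, ∫ z, ‖𝒞.toFun x z - x‖ ^ 2 ∂𝒞.law ≤ C * ‖x‖ ^ 2

/-- `𝒞 ∈ 𝔹(δ)`: the (possibly biased) compressor satisfies `E‖𝒞(x) - x‖² ≤ (1 - δ) ‖x‖²`. -/
structure RandomMap.IsBiased {p : ℕ} {Z : Type*} [MeasurableSpace Z] (𝒞 : RandomMap p Z)
    (δ : ℝ) : Prop where
  pos : 0 < δ
  le_one : δ ≤ 1
  integrable_sq : ∀ x, Integrable (fun z => ‖𝒞.toFun x z - x‖ ^ 2) 𝒞.law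
  bound : ∀ x, ∫ z, ‖𝒞.toFun x z - x‖ ^ 2 ∂𝒞.law ≤ (1 - δ) * ‖x‖ ^ 2

/-- The compressor `x ↦ 𝒞₁(x) + 𝒞₂(x - 𝒞₁(x))`, where `𝒞₁` and `𝒞₂` draw independently. -/
noncomputable def RandomMap.corrected {p : ℕ} {Z₁ Z₂ : Type*} [MeasurableSpace Z₁]
    [MeasurableSpace Z₂] (𝒞₁ : RandomMap p Z₁) (𝒞₂ : RandomMap p Z₂) :
    RandomMap p (Z₁ × Z₂) where
  toFun x z := 𝒞₁.toFun x z.1 + 𝒞₂.toFun (x - 𝒞₁.toFun x z.1) z.2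
  law := 𝒞₁.law.prod 𝒞₂.law
  isProb := by
    have := 𝒞₁.isProb
    have := 𝒞₂.isProb
    infer_instance
  measurable := by
    have h₁ : Measurable fun q : Vec p × (Z₁ × Z₂) => 𝒞₁.toFun q.1 q.2.1 :=
      𝒞₁.measurable.comp (measurable_fst.prodMk measurable_snd.fst)
    have h₂ : Measurable fun q : Vec p × (Z₁ × Z₂) =>
        𝒞₂.toFun (q.1 - 𝒞₁.toFun q.1 q.2.1) q.2.2 :=
      𝒞₂.measurable.comp ((measurable_fst.sub h₁).prodMk measurable_snd.snd)
    exact h₁.add h₂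

/-! ### The algorithm CEDAS -/

/-- The variables `x_{i,k}, d_{i,k}, h_{i,k}, (h_w)_{i,k}` held by the agents at iteration `k`. -/
structure CedasState (n p : ℕ) where
  x : Fin n → Vec p
  d : Fin n → Vec p
  h : Fin n → Vec p
  hw : Fin n → Vec p

/-- The inputs of CEDAS other than the stepsize: mixing matrix, stochastic gradients
`grad i x s = ∇f_i(x; s)`, compressor, parameters `α, γ`, starting points `x_{i,-1}, h_{i,0}`. -/
structure Cedas (n p : ℕ) (S Z : Type*) [MeasurableSpace Z] where
  W : Matrix (Fin n) (Fin n) ℝ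
  grad : Fin n → Vec p → S → Vec p
  compressor : RandomMap p Z
  α : ℝ
  γ : ℝ
  xStart : Fin n → Vec p
  hStart : Fin n → Vec p

namespace Cedas

variable {n p : ℕ} {S Z : Type*} [MeasurableSpace Z]

/-- The variables at `k = 0`; `s i` is the sample `ξ_{i,-1}`. (Sums over `𝒩_i ∪ {i}` are written
over all `j`, since `w_ij = 0` for the other `j`.) -/
noncomputable def start (A : Cedas n p S Z) (η : ℝ) (s : Fin n → S) : CedasState n p where
  x i := A.xStart i - η • A.grad i (A.xStart i) (s i)
  d _ := 0
  h := A.hStart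
  hw i := ∑ j, A.W i j • A.hStart j

/-- One iteration; `s i` is the gradient sample and `z i` the compressor draw of agent `i`. -/
noncomputable def step (A : Cedas n p S Z) (η : ℝ) (s : Fin n → S) (z : Fin n → Z)
    (c : CedasState n p) : CedasState n p :=
  let v : Fin n → Vec p := fun i => A.grad i (c.x i) (s i)
  let y : Fin n → Vec p := fun i => c.x i - η • v i - c.d i
  let q : Fin n → Vec p := fun i => A.compressor.toFun (y i - c.h i) (z i)
  let yhat : Fin n → Vec p := fun i => c.h i + q i
  let yhatw : Fin n → Vec p := fun i => c.hw i + ∑ j, A.W i j • q j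
  let d' : Fin n → Vec p := fun i => c.d i + (A.γ / 2) • (yhat i - yhatw i)
  { x := fun i => c.x i - η • v i - d' i
    d := d'
    h := fun i => (1 - A.α) • c.h i + A.α • yhat i
    hw := fun i => (1 - A.α) • c.hw i + A.α • yhatw i }

/-- The variables at iteration `k` with constant stepsize `η`. The gradient samples are indexed
from iteration `-1` on: `ξ t i` is the sample of agent `i` at iteration `t - 1`. -/
noncomputable def state (A : Cedas n p S Z) (η : ℝ) (ξ : ℕ → Fin n → S) (ζ : ℕ → Fin n → Z) :
    ℕ → CedasState n p
  | 0 => A.start η (ξ 0)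
  | k + 1 => A.step η (ξ (k + 1)) (ζ k) (A.state η ξ ζ k)

/-- The points `x_{i,t-1}` at which the samples `ξ t i` are used. -/
noncomputable def queryPoint (A : Cedas n p S Z) (η : ℝ) (ξ : ℕ → Fin n → S)
    (ζ : ℕ → Fin n → Z) : ℕ → Fin n → Vec p
  | 0 => A.xStart
  | k + 1 => (A.state η ξ ζ k).x

end Cedas

/-! ### Randomness -/

section Randomness

variable {n p : ℕ} {Ω S Z : Type*}

/-- The sample path at the outcome `ω`. -/
def path {T : Type*} (ξ : ℕ → Fin n → Ω → T) (ω : Ω) : ℕ → Fin n → T := fun t i => ξ t i ω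

variable [MeasurableSpace S] [MeasurableSpace Z]

/-- The `σ`-algebra generated by the gradient samples `ξ t` with `t < a` and the compressor draws
`ζ k` with `k < b`. -/
@[reducible] def history (ξ : ℕ → Fin n → Ω → S) (ζ : ℕ → Fin n → Ω → Z) (a b : ℕ) : MeasurableSpace Ω :=
  (⨆ (t : ℕ) (_ : t < a) (i : Fin n), MeasurableSpace.comap (ξ t i) inferInstance) ⊔
    (⨆ (k : ℕ) (_ : k < b) (i : Fin n), MeasurableSpace.comap (ζ k i) inferInstance)

/-- What precedes the sample `ξ t i` (iteration `t - 1`): the past of that iteration together with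
the samples which the other agents take in the same iteration. -/
@[reducible] def beforeSample (ξ : ℕ → Fin n → Ω → S) (ζ : ℕ → Fin n → Ω → Z) (t : ℕ) (i : Fin n) :
    MeasurableSpace Ω :=
  history ξ ζ t (t - 1) ⊔
    ⨆ (j : Fin n) (_ : j ≠ i), MeasurableSpace.comap (ξ t j) inferInstance

variable [MeasurableSpace Ω]

/-- The stochastic gradients used in the run with stepsize `η` are unbiased with variance at most
`σ²`, conditionally on the past and on the samples of the other agents in the same iteration
(which is what conditional independence across agents gives). -/
structure IsUnbiasedSampling (P : Measure Ω) (A : Cedas n p S Z) (f : Fin n → Vec p → ℝ)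
    (σ η : ℝ) (ξ : ℕ → Fin n → Ω → S) (ζ : ℕ → Fin n → Ω → Z) : Prop where
  integrable : ∀ t i, Integrable
    (fun ω => A.grad i (A.queryPoint η (path ξ ω) (path ζ ω) t i) (ξ t i ω)) P
  mean : ∀ t i,
    P[fun ω => A.grad i (A.queryPoint η (path ξ ω) (path ζ ω) t i) (ξ t i ω) |
        beforeSample ξ ζ t i]
      =ᵐ[P] fun ω => gradient (f i) (A.queryPoint η (path ξ ω) (path ζ ω) t i)
  integrable_sq : ∀ t i, Integrable
    (fun ω => ‖A.grad i (A.queryPoint η (path ξ ω) (path ζ ω) t i) (ξ t i ω) -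
      gradient (f i) (A.queryPoint η (path ξ ω) (path ζ ω) t i)‖ ^ 2) P
  variance : ∀ t i,
    P[fun ω => ‖A.grad i (A.queryPoint η (path ξ ω) (path ζ ω) t i) (ξ t i ω) -
        gradient (f i) (A.queryPoint η (path ξ ω) (path ζ ω) t i)‖ ^ 2 | beforeSample ξ ζ t i]
      ≤ᵐ[P] fun _ => σ ^ 2

/-- Fresh compressor draws: every `ζ k i` has the law of the compressor and is independent of
everything drawn before the compression step of iteration `k`. -/
structure IsFreshCompression (P : Measure Ω) (A : Cedas n p S Z)
    (ξ : ℕ → Fin n → Ω → S) (ζ : ℕ → Fin n → Ω → Z) : Prop where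
  law : ∀ k i, P.map (ζ k i) = A.compressor.law
  indep : ∀ k i, Indep (MeasurableSpace.comap (ζ k i) inferInstance) (history ξ ζ (k + 2) k) P

/-- `(1/K) ∑_{t=0}^{K-1} E‖∇f(x̄_t)‖²` for the run of horizon `K`, with stepsize `√(n/K)`.
(A lower integral, hence `∞` if the expectation is infinite.) -/
noncomputable def avgGradSq (P : Measure Ω) (A : Cedas n p S Z) (f : Fin n → Vec p → ℝ)
    (ξ : ℕ → Fin n → Ω → S) (ζ : ℕ → Fin n → Ω → Z) (K : ℕ) : ℝ≥0∞ :=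
  (K : ℝ≥0∞)⁻¹ * ∑ t ∈ Finset.range K,
    ∫⁻ ω, ‖gradient (avgFun f)
      (avgVec (A.state (√((n : ℝ) / K)) (path ξ ω) (path ζ ω) t).x)‖ₑ ^ 2 ∂P

/-- The transient time with constant `a`: the least horizon `K ≥ Kmin` from which on the averaged
squared gradient norm is at most `a / √(nk)` (and `⊤` if there is none). -/
noncomputable def transientTime (P : Measure Ω) (A : Cedas n p S Z) (f : Fin n → Vec p → ℝ)
    (ξ : ℕ → Fin n → Ω → S) (ζ : ℕ → Fin n → Ω → Z) (Kmin a : ℝ) : ℕ∞ :=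
  sInf {T : ℕ∞ | ∃ K : ℕ, T = K ∧ Kmin ≤ K ∧
    ∀ k : ℕ, K ≤ k → avgGradSq P A f ξ ζ k ≤ ENNReal.ofReal (a / √((n : ℝ) * k))}

end Randomness

/-! In the Hilbert space of square integrable random vectors, conditional centering is
orthogonality. There the algorithm becomes a deterministic recursion (`CompressedRun`, realised by
`CedasSetting.run`) in which gradient noise `S` and compression error `e` are orthogonal to whatever
was determined before them. Index `t` of a query point stands for iteration `t - 1`. With `mix =
(γ/2)(I - W)(y + e)` the recursion reads `q (k+2) = y k - mix k`, `d (k+1) = d k + mix k`.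

Three quantities are followed. (1) Mixing preserves averages, so the mean iterate performs
stochastic gradient descent: `F_descent` pays `σ²/n` for the noise and `L²/n` times the consensus
error. (2) The nonconsensus eigenmodes of `W` decouple, with rates `β = γ(1 - μ)/2` between `b =
γg/2` and `γ`, where `g = 1 - λ₂`. In a mode, let `u` be the deviation of the dual variable from its
target, `-η` times the gradients at the mean iterate. The energy `‖x‖² + ((1-β)/β)‖u‖²` shrinks
exactly by `1 - β` in the absence of perturbations (`modeEnergy_noiseless`), and compression costs
only `β‖e‖²` (`modeEnergy_step`). (3) The compression target error `Q = ‖y - h‖²` contracts at a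
rate of order `α` up to the motion of `y` (`Q_step_le_of_motion`), and that motion is `O(γ)` times
the energy plus gradient terms (`motion_le`). With `κ = C(1-δ)` the parameters give `γκ = α²g/1728`,
small enough for `V + (αg/400) Q` to be a Lyapunov function (`lyapunov_step`).

Summing, and reinserting the consensus error into the descent inequality (`sum_norm_mean_Φ_le`),
bounds the averaged squared gradient by terms of order `1/(ηK)`, `n/(bK)`, `η/n` and `η²/b`. For `η
= √(n/K)` the first and third are of order `1/√(nK)`. The second and fourth are of order `n/(bK)`,
hence at most of that order once `n³ ≤ b²K`. Since `b = g²/(497664 κ³)`, the threshold `n³/b²` is of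
order `n³κ⁶/g⁴`, and `κ⁶ ≤ C⁶(1-δ)`. -/

set_option linter.unusedSectionVars false

/-! ### Elementary inequalities in inner product spaces -/

section InnerProduct

variable {E : Type*} [NormedAddCommGroup E] [InnerProductSpace ℝ E]

theorem norm_add_sq_of_inner_eq_zero {a b : E} (h : inner ℝ a b = 0) :
    ‖a + b‖ ^ 2 = ‖a‖ ^ 2 + ‖b‖ ^ 2 := by
  rw [norm_add_sq_real, h]; ring

theorem norm_add_sq_le_young (a b : E) {t : ℝ} (ht : 0 < t) :
    ‖a + b‖ ^ 2 ≤ (1 + t) * ‖a‖ ^ 2 + (1 + 1 / t) * ‖b‖ ^ 2 := by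
  have h1 : ‖a + b‖ ^ 2 ≤ (‖a‖ + ‖b‖) ^ 2 :=
    pow_le_pow_left₀ (norm_nonneg _) (norm_add_le a b) 2
  have h2 : 0 ≤ (t * ‖a‖ - ‖b‖) ^ 2 / t := by positivity
  have h3 : (t * ‖a‖ - ‖b‖) ^ 2 / t = t * ‖a‖ ^ 2 - 2 * ‖a‖ * ‖b‖ + 1 / t * ‖b‖ ^ 2 := by
    field_simp
    ring
  rw [h3] at h2
  nlinarith

theorem norm_add_sq_le_two (a b : E) : ‖a + b‖ ^ 2 ≤ 2 * ‖a‖ ^ 2 + 2 * ‖b‖ ^ 2 := by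
  have := norm_add_sq_le_young a b one_pos
  norm_num at this; linarith

theorem norm_sub_sq_le_two (a b : E) : ‖a - b‖ ^ 2 ≤ 2 * ‖a‖ ^ 2 + 2 * ‖b‖ ^ 2 := by
  have := norm_add_sq_le_two a (-b)
  rwa [norm_neg, ← sub_eq_add_neg] at this

theorem norm_smul_sq (c : ℝ) (a : E) : ‖c • a‖ ^ 2 = c ^ 2 * ‖a‖ ^ 2 := by
  rw [norm_smul, mul_pow, Real.norm_eq_abs, sq_abs]

/-- The energy `‖x‖² + ((1-β)/β) ‖u‖²` of one eigenmode of the network. -/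
noncomputable def modeEnergy (β : ℝ) (x u : E) : ℝ := ‖x‖ ^ 2 + (1 - β) / β * ‖u‖ ^ 2

/-- The left side is the energy after the unperturbed step `x ↦ (1-β)(x-u)`, `u ↦ u + β(x-u)`. The
weight `(1-β)/β` is the one for which the cross terms cancel. -/
theorem modeEnergy_noiseless (β : ℝ) (hβ : β ≠ 0) (x u : E) :
    (1 - β) ^ 2 * ‖x - u‖ ^ 2 + (1 - β) / β * ‖u + β • (x - u)‖ ^ 2
      = (1 - β) * modeEnergy β x u := by
  have e : u + β • (x - u) = (1 - β) • u + β • x := by module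
  rw [e, norm_add_sq_real, norm_sub_sq_real, norm_smul_sq, norm_smul_sq, inner_smul_left,
    inner_smul_right, real_inner_comm x u, modeEnergy]
  simp only [conj_trivial]
  field_simp
  ring

/-- One step of the primal-dual recursion in one eigenmode, with gradient noise `s`, gradient
deviation `ρ`, compression error `e` and drift `ψ` of the dual target. -/
theorem modeEnergy_step {β : ℝ} (hβ : 0 < β) (hβ1 : β ≤ 1 / 2) {x u ρ s e ψ y : E}
    (hy : y = x - u - ρ - s) (hsx : inner ℝ s x = 0) (hsu : inner ℝ s u = 0)
    (hsρ : inner ℝ s ρ = 0) (hey : inner ℝ e y = 0) (heu : inner ℝ e u = 0)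
    (heψ : inner ℝ e ψ = 0) :
    modeEnergy β (y - β • (y + e)) (u + β • (y + e) + ψ)
      ≤ (1 - β / 2) * modeEnergy β x u + 4 / β * ‖ρ‖ ^ 2 + ‖s‖ ^ 2 + 4 / β ^ 2 * ‖ψ‖ ^ 2
        + β * ‖e‖ ^ 2 := by
  obtain ⟨c, hc⟩ : ∃ c, c = (1 - β) / β := ⟨_, rfl⟩
  have hc0 : 0 ≤ c := by rw [hc]; exact div_nonneg (by linarith) hβ.le
  have hcβ : c * β = 1 - β := by rw [hc]; field_simp
  have h1 : ‖y - β • (y + e)‖ ^ 2 = (1 - β) ^ 2 * ‖y‖ ^ 2 + β ^ 2 * ‖e‖ ^ 2 := by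
    have e1 : y - β • (y + e) = (1 - β) • y + (-β) • e := by module
    rw [e1, norm_add_sq_of_inner_eq_zero, norm_smul_sq, norm_smul_sq]
    · ring
    · rw [inner_smul_left, inner_smul_right, real_inner_comm, hey]; simp
  have h2 : ‖u + β • (y + e) + ψ‖ ^ 2 = ‖(u + β • y) + ψ‖ ^ 2 + β ^ 2 * ‖e‖ ^ 2 := by
    have e1 : u + β • (y + e) + ψ = (u + β • y + ψ) + β • e := by module
    rw [e1, norm_add_sq_of_inner_eq_zero, norm_smul_sq]
    rw [inner_smul_right, real_inner_comm, inner_add_right, inner_add_right, inner_smul_right,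
      hey, heu, heψ]; simp
  obtain ⟨a, ha⟩ : ∃ a, a = x - u - ρ := ⟨_, rfl⟩
  have hsa : inner ℝ s a = 0 := by
    rw [ha, inner_sub_right, inner_sub_right, hsx, hsu, hsρ]; simp
  have h3 : ‖y‖ ^ 2 = ‖a‖ ^ 2 + ‖s‖ ^ 2 := by
    rw [hy, ← ha, sub_eq_add_neg, norm_add_sq_of_inner_eq_zero, norm_neg]
    rw [inner_neg_right, real_inner_comm, hsa, neg_zero]
  have h4 : ‖u + β • y‖ ^ 2 = ‖u + β • a‖ ^ 2 + β ^ 2 * ‖s‖ ^ 2 := by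
    have e1 : u + β • y = (u + β • a) + (-β) • s := by rw [hy, ← ha]; module
    rw [e1, norm_add_sq_of_inner_eq_zero, norm_smul_sq]
    · ring
    · rw [inner_smul_right, real_inner_comm, inner_add_right, inner_smul_right, hsu, hsa]; simp
  -- `ρ` and `ψ` are not orthogonal to the rest (`ψ` may be correlated with `s`), so each costs one
  -- Young inequality with parameter `β/4`. The contraction survives because `(1 + β/4)²(1 - β) ≤ 1
  -- - β/2`.
  have hβ4 : 0 < β / 4 := by linarith
  have h5 := norm_add_sq_le_young (u + β • y) ψ hβ4
  have h6 : ‖a‖ ^ 2 ≤ (1 + β / 4) * ‖x - u‖ ^ 2 + (1 + 1 / (β / 4)) * ‖ρ‖ ^ 2 := by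
    have := norm_add_sq_le_young (x - u) (-ρ) hβ4
    rwa [norm_neg, ← sub_eq_add_neg, ← ha] at this
  have h7 : ‖u + β • a‖ ^ 2 ≤ (1 + β / 4) * ‖u + β • (x - u)‖ ^ 2
      + (1 + 1 / (β / 4)) * (β ^ 2 * ‖ρ‖ ^ 2) := by
    have := norm_add_sq_le_young (u + β • (x - u)) ((-β) • ρ) hβ4
    rw [norm_smul_sq, neg_sq] at this
    have e1 : u + β • a = u + β • (x - u) + (-β) • ρ := by rw [ha]; module
    rwa [e1]
  have h8 := modeEnergy_noiseless β hβ.ne' x u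
  rw [← hc] at h8
  have hV : 0 ≤ modeEnergy β x u := by rw [modeEnergy, ← hc]; positivity
  have hT : (1 + 1 / (β / 4)) = 1 + 4 / β := by field_simp
  rw [hT] at h5 h6 h7
  obtain ⟨T, hTdef⟩ : ∃ T, T = 1 + 4 / β := ⟨_, rfl⟩
  rw [← hTdef] at h5 h6 h7
  have hTβ : T * β = β + 4 := by rw [hTdef]; field_simp
  have hT0 : 0 < T := by rw [hTdef]; positivity
  have hβ2 := sq_nonneg β
  have hβ3 := pow_pos hβ 3
  -- the noiseless part perturbed by `ρ`
  have h9 : (1 - β) ^ 2 * ‖a‖ ^ 2 + c * ‖u + β • a‖ ^ 2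
      ≤ (1 + β / 4) * ((1 - β) * modeEnergy β x u) + T * ((1 - β) * ‖ρ‖ ^ 2) := by
    have k1 := mul_le_mul_of_nonneg_left h6 (sq_nonneg (1 - β))
    have k2 := mul_le_mul_of_nonneg_left h7 hc0
    have e1 : c * (T * (β ^ 2 * ‖ρ‖ ^ 2)) = T * (β * (1 - β) * ‖ρ‖ ^ 2) := by
      rw [← hcβ]; ring
    rw [← h8]
    linarith [k1, k2, e1]
  have h10 : (1 - β) ^ 2 * ‖y‖ ^ 2 + c * ‖u + β • y‖ ^ 2
      ≤ (1 + β / 4) * ((1 - β) * modeEnergy β x u) + T * ((1 - β) * ‖ρ‖ ^ 2)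
        + (1 - β) * ‖s‖ ^ 2 := by
    have e1 : (1 - β) ^ 2 * ‖s‖ ^ 2 + c * (β ^ 2 * ‖s‖ ^ 2) = (1 - β) * ‖s‖ ^ 2 := by
      have : c * (β ^ 2 * ‖s‖ ^ 2) = (c * β) * (β * ‖s‖ ^ 2) := by ring
      rw [this, hcβ]; ring
    rw [h3, h4]; linarith [h9, e1]
  have h11 : (1 - β) ^ 2 * ‖y‖ ^ 2 + c * ‖u + β • y + ψ‖ ^ 2
      ≤ (1 + β / 4) * ((1 + β / 4) * ((1 - β) * modeEnergy β x u) + T * ((1 - β) * ‖ρ‖ ^ 2)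
        + (1 - β) * ‖s‖ ^ 2) + c * T * ‖ψ‖ ^ 2 := by
    have k1 := mul_le_mul_of_nonneg_left h5 hc0
    have k2 := mul_le_mul_of_nonneg_left h10 (by linarith : 0 ≤ 1 + β / 4)
    have k3 : 0 ≤ β / 4 * ((1 - β) ^ 2 * ‖y‖ ^ 2) := by positivity
    linarith [k1, k2, k3]
  -- The error enters both components with factor `β`, and `β² + ((1-β)/β)β² = β`.
  have e12 : modeEnergy β (y - β • (y + e)) (u + β • (y + e) + ψ)
      = (1 - β) ^ 2 * ‖y‖ ^ 2 + c * ‖u + β • y + ψ‖ ^ 2 + β * ‖e‖ ^ 2 := by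
    rw [modeEnergy, h1, h2, ← hc]
    have : c * (β ^ 2 * ‖e‖ ^ 2) = (c * β) * (β * ‖e‖ ^ 2) := by ring
    rw [mul_add, this, hcβ]; ring
  rw [e12]
  have f1 : (1 + β / 4) * ((1 + β / 4) * ((1 - β) * modeEnergy β x u))
      ≤ (1 - β / 2) * modeEnergy β x u := by
    have : (1 + β / 4) * ((1 + β / 4) * (1 - β)) ≤ 1 - β / 2 := by linarith
    calc _ = (1 + β / 4) * ((1 + β / 4) * (1 - β)) * modeEnergy β x u := by ring
      _ ≤ _ := mul_le_mul_of_nonneg_right this hV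
  have f2 : (1 + β / 4) * (T * ((1 - β) * ‖ρ‖ ^ 2)) ≤ 4 / β * ‖ρ‖ ^ 2 := by
    have : (1 + β / 4) * (T * (1 - β)) ≤ 4 / β := by
      rw [le_div_iff₀ hβ]
      have : (1 + β / 4) * (T * (1 - β)) * β = (1 + β / 4) * ((T * β) * (1 - β)) := by ring
      rw [this, hTβ]; linarith
    calc _ = (1 + β / 4) * (T * (1 - β)) * ‖ρ‖ ^ 2 := by ring
      _ ≤ _ := mul_le_mul_of_nonneg_right this (sq_nonneg _)
  have f3 : (1 + β / 4) * ((1 - β) * ‖s‖ ^ 2) ≤ ‖s‖ ^ 2 := by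
    have : (1 + β / 4) * (1 - β) ≤ 1 := by linarith
    calc _ = (1 + β / 4) * (1 - β) * ‖s‖ ^ 2 := by ring
      _ ≤ 1 * ‖s‖ ^ 2 := mul_le_mul_of_nonneg_right this (sq_nonneg _)
      _ = _ := one_mul _
  have f4 : c * T * ‖ψ‖ ^ 2 ≤ 4 / β ^ 2 * ‖ψ‖ ^ 2 := by
    have : c * T ≤ 4 / β ^ 2 := by
      rw [le_div_iff₀ (by positivity)]
      have : c * T * β ^ 2 = (c * β) * (T * β) := by ring
      rw [this, hcβ, hTβ]; linarith
    exact mul_le_mul_of_nonneg_right this (sq_nonneg _)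
  linarith [h11, f1, f2, f3, f4]

end InnerProduct

/-! ### Averages and eigenmodes -/

section Modes

variable {n : ℕ} {E : Type*} [NormedAddCommGroup E] [InnerProductSpace ℝ E]

/-- The average of a family of vectors. -/
noncomputable def mean (a : Fin n → E) : E := (n : ℝ)⁻¹ • ∑ i, a i

/-- The squared norm of a family. -/
noncomputable def normSq (a : Fin n → E) : ℝ := ∑ i, ‖a i‖ ^ 2

/-- The squared distance of a family from consensus. -/
noncomputable def spread (a : Fin n → E) : ℝ := ∑ i, ‖a i - mean a‖ ^ 2

/-- The coordinates of a family in the basis `U`. -/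
noncomputable def mode (U : Fin n → Fin n → ℝ) (a : Fin n → E) (j : Fin n) : E := ∑ i, U j i • a i

theorem normSq_nonneg (a : Fin n → E) : 0 ≤ normSq a := Finset.sum_nonneg fun _ _ => sq_nonneg _

theorem spread_nonneg (a : Fin n → E) : 0 ≤ spread a := Finset.sum_nonneg fun _ _ => sq_nonneg _

theorem mean_add (a b : Fin n → E) : mean (a + b) = mean a + mean b := by
  simp [mean, Finset.sum_add_distrib]

theorem mean_sub (a b : Fin n → E) : mean (a - b) = mean a - mean b := by
  simp [mean, smul_sub]

theorem mean_smul (c : ℝ) (a : Fin n → E) : mean (c • a) = c • mean a := by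
  simp [mean, ← Finset.smul_sum, smul_comm c]

theorem mode_add (U : Fin n → Fin n → ℝ) (a b : Fin n → E) : mode U (a + b) = mode U a + mode U b := by
  ext j; simp [mode, Finset.sum_add_distrib]

theorem mode_sub (U : Fin n → Fin n → ℝ) (a b : Fin n → E) : mode U (a - b) = mode U a - mode U b := by
  ext j; simp [mode, smul_sub]

theorem mode_smul (U : Fin n → Fin n → ℝ) (c : ℝ) (a : Fin n → E) : mode U (c • a) = c • mode U a := by
  ext j; simp [mode, Finset.smul_sum, smul_comm c]

theorem inner_mode_eq_zero (U : Fin n → Fin n → ℝ) {a b : Fin n → E}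
    (h : ∀ i i', inner ℝ (a i) (b i') = 0) (j : Fin n) :
    inner ℝ (mode U a j) (mode U b j) = 0 := by
  simp [mode, sum_inner, inner_sum, inner_smul_left, inner_smul_right, h]

theorem inner_mean_eq_zero {a b : Fin n → E}
    (h : ∀ i i', inner ℝ (a i) (b i') = 0) : inner ℝ (mean a) (mean b) = 0 := by
  simp [mean, sum_inner, inner_sum, inner_smul_left, inner_smul_right, h]

theorem norm_mean_sq_le (hn : 0 < n) (a : Fin n → E) : ‖mean a‖ ^ 2 ≤ normSq a / n := by
  have hn' : (0 : ℝ) < n := by exact_mod_cast hn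
  have h1 : ‖∑ i, a i‖ ^ 2 ≤ (∑ i, ‖a i‖) ^ 2 :=
    pow_le_pow_left₀ (norm_nonneg _) (norm_sum_le _ _) 2
  have h2 : (∑ i, ‖a i‖) ^ 2 ≤ (n : ℝ) * ∑ i, ‖a i‖ ^ 2 := by
    have := sq_sum_le_card_mul_sum_sq (s := Finset.univ) (f := fun i => ‖a i‖)
    simpa using this
  rw [mean, norm_smul_sq, normSq, le_div_iff₀ hn']
  calc (n : ℝ)⁻¹ ^ 2 * ‖∑ i, a i‖ ^ 2 * n ≤ (n : ℝ)⁻¹ ^ 2 * ((n : ℝ) * ∑ i, ‖a i‖ ^ 2) * n := by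
        gcongr; exact h1.trans h2
    _ = _ := by field_simp

/-- The average of pairwise orthogonal vectors of squared norm at most `σ²`. -/
theorem norm_mean_sq_le_of_orthogonal (hn : 0 < n) {a : Fin n → E} {σ : ℝ}
    (h : ∀ i j, i ≠ j → inner ℝ (a i) (a j) = 0) (hσ : ∀ i, ‖a i‖ ^ 2 ≤ σ ^ 2) :
    ‖mean a‖ ^ 2 ≤ σ ^ 2 / n := by
  have hn' : (0 : ℝ) < n := by exact_mod_cast hn
  have h1 : ‖∑ i, a i‖ ^ 2 = ∑ i, ‖a i‖ ^ 2 := by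
    rw [← real_inner_self_eq_norm_sq, sum_inner]
    refine Finset.sum_congr rfl fun i _ => ?_
    rw [inner_sum, Finset.sum_eq_single i, real_inner_self_eq_norm_sq]
    · intro j _ hj; exact h i j hj.symm
    · simp
  have h2 : ∑ i, ‖a i‖ ^ 2 ≤ n * σ ^ 2 := by
    calc _ ≤ ∑ _i : Fin n, σ ^ 2 := Finset.sum_le_sum fun i _ => hσ i
      _ = _ := by simp
  rw [mean, norm_smul_sq, h1, le_div_iff₀ hn']
  calc (n : ℝ)⁻¹ ^ 2 * (∑ i, ‖a i‖ ^ 2) * n ≤ (n : ℝ)⁻¹ ^ 2 * (n * σ ^ 2) * n := by gcongr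
    _ = _ := by field_simp

theorem spread_le_normSq (hn : 0 < n) (a : Fin n → E) : spread a ≤ normSq a := by
  have hn' : (0 : ℝ) < n := by exact_mod_cast hn
  have h1 : ∑ i, inner ℝ (a i) (mean a) = n * ‖mean a‖ ^ 2 := by
    rw [← sum_inner, ← real_inner_self_eq_norm_sq]
    have : ∑ i, a i = (n : ℝ) • mean a := by rw [mean, smul_inv_smul₀ hn'.ne']
    rw [this, inner_smul_left]; simp
  have h2 : spread a = normSq a - n * ‖mean a‖ ^ 2 := by
    simp only [spread, normSq, norm_sub_sq_real, Finset.sum_add_distrib, Finset.sum_sub_distrib,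
      ← Finset.mul_sum, h1]
    simp; ring
  rw [h2]; nlinarith [sq_nonneg ‖mean a‖]

/-- An orthonormal eigenbasis `U` of `W` with eigenvalues `μ`, in which `j₀` is the consensus mode
and the other eigenvalues are at distance at least `g` from `1`. -/
structure GapBasis (W : Matrix (Fin n) (Fin n) ℝ) (g : ℝ) where
  U : Fin n → Fin n → ℝ
  μ : Fin n → ℝ
  j₀ : Fin n
  orthonormal : ∀ i i', ∑ j, U j i * U j i' = if i = i' then 1 else 0
  eigen : ∀ j i', ∑ i, U j i * W i i' = μ j * U j i'
  sum_eq_zero : ∀ j, j ≠ j₀ → ∑ i, U j i = 0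
  gap : ∀ j, j ≠ j₀ → g ≤ 1 - μ j
  le_two : ∀ j, 1 - μ j ≤ 2

namespace GapBasis

variable {W : Matrix (Fin n) (Fin n) ℝ} {g : ℝ} (S : GapBasis W g)

theorem mode_mul (a : Fin n → E) (j : Fin n) :
    mode S.U (fun i => ∑ k, W i k • a k) j = S.μ j • mode S.U a j := by
  simp only [mode, Finset.smul_sum]
  rw [Finset.sum_comm]
  refine Finset.sum_congr rfl fun k _ => ?_
  simp only [smul_smul, ← Finset.sum_smul, S.eigen]

theorem sum_norm_mode (a : Fin n → E) : ∑ j, ‖mode S.U a j‖ ^ 2 = normSq a := by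
  have h : ∀ j, ‖mode S.U a j‖ ^ 2 = ∑ i, ∑ i', (S.U j i * S.U j i') * inner ℝ (a i) (a i') := by
    intro j
    rw [← real_inner_self_eq_norm_sq, mode, sum_inner]
    refine Finset.sum_congr rfl fun i _ => ?_
    rw [inner_sum]
    refine Finset.sum_congr rfl fun i' _ => ?_
    rw [inner_smul_left, inner_smul_right]; simp; ring
  simp only [h]
  rw [Finset.sum_comm]
  refine Finset.sum_congr rfl fun i _ => ?_
  rw [Finset.sum_comm]
  simp only [← Finset.sum_mul, S.orthonormal]
  simp

theorem sum_norm_mode_le (a : Fin n → E) :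
    ∑ j ∈ Finset.univ.erase S.j₀, ‖mode S.U a j‖ ^ 2 ≤ normSq a := by
  rw [← S.sum_norm_mode]
  exact Finset.sum_le_sum_of_subset_of_nonneg (Finset.erase_subset _ _) fun _ _ _ => sq_nonneg _

/-- The all-ones vector is orthogonal to every mode but `j₀`, so completeness expresses it through
mode `j₀` alone. -/
theorem exists_const : ∃ c : ℝ, ∀ i, S.U S.j₀ i = c := by
  have h : ∀ i', (∑ i, S.U S.j₀ i) * S.U S.j₀ i' = 1 := by
    intro i'
    have h1 : ∑ j, (∑ i, S.U j i) * S.U j i' = 1 := by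
      simp only [Finset.sum_mul]
      rw [Finset.sum_comm]
      simp [S.orthonormal]
    rw [Finset.sum_eq_single S.j₀] at h1
    · exact h1
    · intro j _ hj; rw [S.sum_eq_zero j hj, zero_mul]
    · simp
  refine ⟨(∑ i, S.U S.j₀ i)⁻¹, fun i => ?_⟩
  exact eq_inv_of_mul_eq_one_right (h i)

theorem mode_const (v : E) {j : Fin n} (hj : j ≠ S.j₀) : mode S.U (fun _ => v) j = 0 := by
  rw [mode, ← Finset.sum_smul, S.sum_eq_zero j hj, zero_smul]

/-- Parseval for the centered family: its `j₀` component vanishes, and the other modes do not see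
the subtracted constant. -/
theorem sum_norm_mode_eq_spread (hn : 0 < n) (a : Fin n → E) :
    ∑ j ∈ Finset.univ.erase S.j₀, ‖mode S.U a j‖ ^ 2 = spread a := by
  have hn' : (n : ℝ) ≠ 0 := by exact_mod_cast hn.ne'
  obtain ⟨c, hc⟩ := S.exists_const
  have h0 : mode S.U (a - fun _ => mean a) S.j₀ = 0 := by
    simp only [mode, hc, ← Finset.smul_sum, Pi.sub_apply, Finset.sum_sub_distrib]
    rw [Finset.sum_const, Finset.card_univ, Fintype.card_fin, mean, ← Nat.cast_smul_eq_nsmul ℝ,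
      smul_inv_smul₀ hn', sub_self, smul_zero]
  have h1 : spread a = ∑ j, ‖mode S.U (a - fun _ => mean a) j‖ ^ 2 := by
    rw [S.sum_norm_mode]; rfl
  rw [h1, ← Finset.sum_erase_add _ _ (Finset.mem_univ S.j₀), h0]
  simp only [norm_zero, ne_eq, OfNat.ofNat_ne_zero, not_false_eq_true, zero_pow, add_zero]
  refine Finset.sum_congr rfl fun j hj => ?_
  rw [mode_sub, Pi.sub_apply, S.mode_const _ (Finset.ne_of_mem_erase hj), sub_zero]

end GapBasis

end Modes

/-! ### The compressed primal-dual recursion in a Hilbert space -/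

section Families

variable {n : ℕ} {E : Type*} [NormedAddCommGroup E] [InnerProductSpace ℝ E]

theorem normSq_add_le (a b : Fin n → E) : normSq (a + b) ≤ 2 * normSq a + 2 * normSq b := by
  simp only [normSq, Finset.mul_sum, ← Finset.sum_add_distrib]
  exact Finset.sum_le_sum fun i _ => norm_add_sq_le_two _ _

theorem normSq_sub_le (a b : Fin n → E) : normSq (a - b) ≤ 2 * normSq a + 2 * normSq b := by
  simp only [normSq, Finset.mul_sum, ← Finset.sum_add_distrib]
  exact Finset.sum_le_sum fun i _ => norm_sub_sq_le_two _ _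

theorem normSq_smul (c : ℝ) (a : Fin n → E) : normSq (c • a) = c ^ 2 * normSq a := by
  simp only [normSq, Finset.mul_sum, Pi.smul_apply, norm_smul_sq]

theorem normSq_const (v : E) : normSq (fun _ : Fin n => v) = n * ‖v‖ ^ 2 := by
  simp [normSq]

theorem normSq_le_const_mul {a : Fin n → E} {c : ℝ} (h : ∀ i, ‖a i‖ ^ 2 ≤ c) :
    normSq a ≤ n * c := by
  calc normSq a ≤ ∑ _i : Fin n, c := Finset.sum_le_sum fun i _ => h i
    _ = n * c := by simp

theorem spread_eq_normSq_of_mean_eq_zero {a : Fin n → E} (h : mean a = 0) :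
    spread a = normSq a := by
  simp [spread, normSq, h]

theorem mean_sub_mul_eq_zero {W : Matrix (Fin n) (Fin n) ℝ} (hW : ∀ j, ∑ i, W i j = 1)
    (a : Fin n → E) : mean (a - fun i => ∑ j, W i j • a j) = 0 := by
  have : ∑ i, ∑ j, W i j • a j = ∑ j, a j := by
    rw [Finset.sum_comm]
    exact Finset.sum_congr rfl fun j _ => by rw [← Finset.sum_smul, hW, one_smul]
  simp [mean, this]

end Families

/-- A run of the compressed primal-dual recursion, seen in a Hilbert space of random vectors:
`q t` are the query points, `M t` the true gradients there, `S t` the gradient noise, `Φ t` the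
gradients at the average query point, `e k` the compression error, `F t` the objective at the
average query point. Conditional centering appears as orthogonality. -/
structure CompressedRun {n : ℕ} (E : Type*) [NormedAddCommGroup E] [InnerProductSpace ℝ E]
    (W : Matrix (Fin n) (Fin n) ℝ) (L σ κ α γ η : ℝ) where
  (q M Φ S d h y e : ℕ → Fin n → E)
  F : ℕ → ℝ
  d_zero : d 0 = 0
  q_one : q 1 = q 0 - η • (M 0 + S 0)
  y_eq : ∀ k, y k = q (k + 1) - η • (M (k + 1) + S (k + 1)) - d k
  d_succ : ∀ k, d (k + 1) =
    d k + (γ / 2) • ((y k + e k) - fun i => ∑ j, W i j • (y k + e k) j)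
  q_succ : ∀ k, q (k + 2) = q (k + 1) - η • (M (k + 1) + S (k + 1)) - d (k + 1)
  h_succ : ∀ k, h (k + 1) = h k + α • (y k - h k + e k)
  M_lip : ∀ t i, ‖M t i - Φ t i‖ ≤ L * ‖q t i - mean (q t)‖
  Φ_lip : ∀ t i, ‖Φ (t + 1) i - Φ t i‖ ≤ L * ‖mean (q (t + 1)) - mean (q t)‖
  S_q : ∀ t i j, inner ℝ (S t i) (q t j) = 0
  S_M : ∀ t i j, inner ℝ (S t i) (M t j) = 0
  S_Φ : ∀ t i j, inner ℝ (S t i) (Φ t j) = 0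
  S_d : ∀ k i j, inner ℝ (S (k + 1) i) (d k j) = 0
  S_S : ∀ t i j, i ≠ j → inner ℝ (S t i) (S t j) = 0
  norm_S : ∀ t i, ‖S t i‖ ^ 2 ≤ σ ^ 2
  e_y : ∀ k i j, inner ℝ (e k i) (y k j) = 0
  e_h : ∀ k i j, inner ℝ (e k i) (h k j) = 0
  e_d : ∀ k i j, inner ℝ (e k i) (d k j) = 0
  e_Φ : ∀ k i j, inner ℝ (e k i) (Φ (k + 1) j) = 0
  e_Φ_succ : ∀ k i j, inner ℝ (e k i) (Φ (k + 2) j) = 0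
  norm_e : ∀ k i, ‖e k i‖ ^ 2 ≤ κ * ‖y k i - h k i‖ ^ 2
  F_step : ∀ t, F (t + 1) ≤ F t + inner ℝ (mean (Φ t)) (mean (q (t + 1)) - mean (q t))
    + L * ‖mean (q (t + 1)) - mean (q t)‖ ^ 2

namespace CompressedRun

variable {n : ℕ} {E : Type*} [NormedAddCommGroup E] [InnerProductSpace ℝ E]
  {W : Matrix (Fin n) (Fin n) ℝ} {L σ κ α γ η : ℝ} (R : CompressedRun E W L σ κ α γ η)

/-- The mixing term `(γ/2) (I - W) ŷ`. -/
noncomputable def mix (k : ℕ) : Fin n → E :=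
  (γ / 2) • ((R.y k + R.e k) - fun i => ∑ j, W i j • (R.y k + R.e k) j)

/-- The deviation of the dual variable from its target. -/
noncomputable def u (k : ℕ) : Fin n → E := R.d k + η • R.Φ (k + 1)

/-- The compression target error. -/
noncomputable def Q (k : ℕ) : ℝ := normSq (R.y k - R.h k)

theorem Q_nonneg (k : ℕ) : 0 ≤ R.Q k := normSq_nonneg _

theorem q_eq (k : ℕ) : R.q (k + 2) = R.y k - R.mix k := by
  rw [R.q_succ, R.y_eq, R.d_succ, mix]; abel

/-! ### The mean iterate. -/

section Mean

variable (hW : ∀ j, ∑ i, W i j = 1)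
include hW

theorem mean_mix (k : ℕ) : mean (R.mix k) = 0 := by
  rw [mix, mean_smul, mean_sub_mul_eq_zero hW, smul_zero]

theorem mean_d (k : ℕ) : mean (R.d k) = 0 := by
  induction k with
  | zero => rw [R.d_zero]; simp [mean]
  | succ k ih =>
    have := R.mean_mix hW k
    rw [mix] at this
    rw [R.d_succ, mean_add, ih, this, add_zero]

/-- Dual variables have mean zero, so neither mixing nor compression reaches the average: it
performs plain stochastic gradient descent. -/
theorem mean_q_succ (t : ℕ) :
    mean (R.q (t + 1)) - mean (R.q t) = -(η • (mean (R.M t) + mean (R.S t))) := by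
  cases t with
  | zero => rw [R.q_one, mean_sub, mean_smul, mean_add]; abel
  | succ k =>
    rw [R.q_succ, mean_sub, mean_sub, mean_smul, mean_add, R.mean_d hW]; abel

theorem norm_mean_q_step (t : ℕ) : ‖mean (R.q (t + 1)) - mean (R.q t)‖ ^ 2
    = η ^ 2 * (‖mean (R.M t)‖ ^ 2 + ‖mean (R.S t)‖ ^ 2) := by
  rw [R.mean_q_succ hW, norm_neg, norm_smul_sq, norm_add_sq_of_inner_eq_zero]
  rw [real_inner_comm]
  exact inner_mean_eq_zero (R.S_M t)

end Mean

theorem normSq_M_sub_le (t : ℕ) :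
    normSq (R.M t - R.Φ t) ≤ L ^ 2 * spread (R.q t) := by
  rw [normSq, spread, Finset.mul_sum]
  refine Finset.sum_le_sum fun i _ => ?_
  rw [← mul_pow]
  exact pow_le_pow_left₀ (norm_nonneg _) (R.M_lip t i) 2

theorem norm_mean_M_sub_le (hn : 0 < n) (t : ℕ) :
    ‖mean (R.M t) - mean (R.Φ t)‖ ^ 2 ≤ L ^ 2 / n * spread (R.q t) := by
  rw [← mean_sub]
  refine (norm_mean_sq_le hn _).trans ?_
  rw [div_mul_eq_mul_div]
  gcongr
  exact R.normSq_M_sub_le t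

/-- The noises of different agents are orthogonal. This division by `n` is the source of the speedup
in `1/√(nK)`. -/
theorem norm_mean_S_le (hn : 0 < n) (t : ℕ) : ‖mean (R.S t)‖ ^ 2 ≤ σ ^ 2 / n :=
  norm_mean_sq_le_of_orthogonal hn (R.S_S t) (R.norm_S t)

theorem norm_mean_q_step_le (hW : ∀ j, ∑ i, W i j = 1) (hn : 0 < n) (t : ℕ) :
    ‖mean (R.q (t + 1)) - mean (R.q t)‖ ^ 2
      ≤ η ^ 2 * (2 * ‖mean (R.Φ t)‖ ^ 2 + 2 * (L ^ 2 / n * spread (R.q t)) + σ ^ 2 / n) := by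
  rw [R.norm_mean_q_step hW]
  have h1 := R.norm_mean_M_sub_le hn t
  have h2 := R.norm_mean_S_le hn t
  have h3 := norm_add_sq_le_two (mean (R.Φ t)) (mean (R.M t) - mean (R.Φ t))
  rw [add_sub_cancel] at h3
  gcongr
  linarith

/-- Descent of the objective along the average iterate. -/
theorem F_descent (hW : ∀ j, ∑ i, W i j = 1) (hn : 0 < n) (hL : 0 ≤ L) (hη : 0 ≤ η)
    (hηL : η * L ≤ 1 / 2) (t : ℕ) :
    R.F (t + 1) ≤ R.F t - η / 2 * ‖mean (R.Φ t)‖ ^ 2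
      + η * (L ^ 2 / n * spread (R.q t)) / 2 + L * η ^ 2 * (σ ^ 2 / n) := by
  have h0 := R.F_step t
  rw [R.norm_mean_q_step hW, R.mean_q_succ hW, inner_neg_right, inner_smul_right,
    inner_add_right] at h0
  have h1 : inner ℝ (mean (R.Φ t)) (mean (R.S t)) = 0 := by
    rw [real_inner_comm]; exact inner_mean_eq_zero (R.S_Φ t)
  have h2 := R.norm_mean_M_sub_le hn t
  have h3 := R.norm_mean_S_le hn t
  -- Polarization of the inner product of `mean M` and `mean Φ` leaves a term `-(η/2)‖mean M‖²`,
  -- which absorbs `Lη²‖mean M‖²` because `ηL ≤ 1/2`.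
  have h4 := norm_sub_sq_real (mean (R.M t)) (mean (R.Φ t))
  rw [real_inner_comm] at h4
  rw [h1, add_zero] at h0
  have h5 : L * (η ^ 2 * (‖mean (R.M t)‖ ^ 2 + ‖mean (R.S t)‖ ^ 2))
      ≤ η / 2 * ‖mean (R.M t)‖ ^ 2 + L * η ^ 2 * (σ ^ 2 / n) := by
    have k1 : L * η ^ 2 * ‖mean (R.S t)‖ ^ 2 ≤ L * η ^ 2 * (σ ^ 2 / n) := by gcongr
    have k2 : η * (η * L) * ‖mean (R.M t)‖ ^ 2 ≤ η * (1 / 2) * ‖mean (R.M t)‖ ^ 2 := by gcongr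
    linarith
  have h6 := mul_le_mul_of_nonneg_left h2 (by linarith : 0 ≤ η / 2)
  rw [h4] at h6
  linarith

/-! ### The modes orthogonal to consensus. -/

section Modes

variable {g : ℝ} (G : GapBasis W g)

/-- The eigenvalues of `(γ/2) (I - W)`. -/
noncomputable def rate (_R : CompressedRun E W L σ κ α γ η) (G : GapBasis W g) (j : Fin n) : ℝ :=
  γ / 2 * (1 - G.μ j)

/-- The energy of all modes but the consensus mode. -/
noncomputable def V (k : ℕ) : ℝ := ∑ j ∈ Finset.univ.erase G.j₀,
  modeEnergy (R.rate G j) (mode G.U (R.q (k + 1)) j) (mode G.U (R.u k) j)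

theorem mode_mix (k : ℕ) (j : Fin n) :
    mode G.U (R.mix k) j = R.rate G j • (mode G.U (R.y k) j + mode G.U (R.e k) j) := by
  rw [mix, mode_smul, mode_sub, Pi.smul_apply, Pi.sub_apply, G.mode_mul, mode_add, Pi.add_apply,
    rate]
  module

variable (hγ : 0 < γ) (hγ1 : γ ≤ 1 / 72) (hg : 0 < g)

include hγ hg in
theorem rate_ge {j : Fin n} (hj : j ≠ G.j₀) : γ * g / 2 ≤ R.rate G j := by
  have := G.gap j hj
  rw [rate]; nlinarith

include hγ in
theorem rate_le (j : Fin n) : R.rate G j ≤ γ := by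
  have := G.le_two j
  rw [rate]; nlinarith

include hγ hg in
theorem rate_pos {j : Fin n} (hj : j ≠ G.j₀) : 0 < R.rate G j :=
  lt_of_lt_of_le (by positivity) (R.rate_ge G hγ hg hj)

include hγ hγ1 hg in
theorem modeEnergy_nonneg {j : Fin n} (hj : j ≠ G.j₀) (x u : E) :
    0 ≤ modeEnergy (R.rate G j) x u := by
  have h1 := R.rate_pos G hγ hg hj
  have h2 := R.rate_le G hγ j
  have h3 : 0 ≤ (1 - R.rate G j) / R.rate G j := div_nonneg (by linarith) h1.le
  rw [modeEnergy]; positivity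

include hγ hγ1 hg in
theorem V_nonneg (k : ℕ) : 0 ≤ R.V G k :=
  Finset.sum_nonneg fun _ hj => R.modeEnergy_nonneg G hγ hγ1 hg (Finset.ne_of_mem_erase hj) _ _

include hγ hγ1 hg in
theorem spread_q_le_V (hn : 0 < n) (k : ℕ) : spread (R.q (k + 1)) ≤ R.V G k := by
  rw [← G.sum_norm_mode_eq_spread hn]
  refine Finset.sum_le_sum fun j hj => ?_
  have h1 := R.rate_pos G hγ hg (Finset.ne_of_mem_erase hj)
  have h2 := R.rate_le G hγ j
  have h3 : 0 ≤ (1 - R.rate G j) / R.rate G j := div_nonneg (by linarith) h1.le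
  rw [modeEnergy]
  exact le_add_of_nonneg_right (by positivity)

include hγ hγ1 hg in
-- The energy weights the dual part by `(1-β)/β ≥ 35/(36γ)`, since `β ≤ γ ≤ 1/72`. The gained factor
-- `γ` keeps the motion of the compression target small in `motion_le`.
theorem spread_u_le_V (hn : 0 < n) (k : ℕ) : spread (R.u k) ≤ 36 / 35 * γ * R.V G k := by
  rw [← G.sum_norm_mode_eq_spread hn, V, Finset.mul_sum]
  refine Finset.sum_le_sum fun j hj => ?_
  have h1 := R.rate_pos G hγ hg (Finset.ne_of_mem_erase hj)
  have h2 := R.rate_le G hγ j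
  obtain ⟨β, hβ⟩ : ∃ β, β = R.rate G j := ⟨_, rfl⟩
  rw [← hβ] at h1 h2 ⊢
  rw [modeEnergy]
  have h4 : 1 ≤ 36 / 35 * γ * ((1 - β) / β) := by
    rw [mul_div_assoc', le_div_iff₀ h1]
    nlinarith
  have h5 : 1 * ‖mode G.U (R.u k) j‖ ^ 2
      ≤ 36 / 35 * γ * ((1 - β) / β) * ‖mode G.U (R.u k) j‖ ^ 2 :=
    mul_le_mul_of_nonneg_right h4 (sq_nonneg _)
  have h6 : 0 ≤ 36 / 35 * γ * ‖mode G.U (R.q (k + 1)) j‖ ^ 2 := by positivity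
  linarith

theorem inner_mode_e_u (k : ℕ) (j : Fin n) :
    inner ℝ (mode G.U (R.e k) j) (mode G.U (R.u k) j) = 0 := by
  refine inner_mode_eq_zero _ (fun i i' => ?_) j
  rw [u, Pi.add_apply, Pi.smul_apply, inner_add_right, inner_smul_right, R.e_d, R.e_Φ]; simp

include hγ hγ1 hg in
-- `modeEnergy_step` summed over the nonconsensus modes, with each rate replaced by the worse of its
-- bounds `γ * g / 2` and `γ`. The drift of the dual target is governed by the motion of the mean
-- iterate.
theorem V_step (k : ℕ) :
    R.V G (k + 1) ≤ (1 - γ * g / 4) * R.V G k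
      + 4 / (γ * g / 2) * (η ^ 2 * L ^ 2 * spread (R.q (k + 1))) + n * (η ^ 2 * σ ^ 2)
      + 4 / (γ * g / 2) ^ 2 *
        (η ^ 2 * L ^ 2 * (n * ‖mean (R.q (k + 2)) - mean (R.q (k + 1))‖ ^ 2))
      + γ * normSq (R.e k) := by
  obtain ⟨b, hb⟩ : ∃ b, b = γ * g / 2 := ⟨_, rfl⟩
  have hb0 : 0 < b := by rw [hb]; positivity
  have key : ∀ j ∈ Finset.univ.erase G.j₀,
      modeEnergy (R.rate G j) (mode G.U (R.q (k + 2)) j) (mode G.U (R.u (k + 1)) j)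
      ≤ (1 - b / 2) * modeEnergy (R.rate G j) (mode G.U (R.q (k + 1)) j) (mode G.U (R.u k) j)
        + 4 / b * ‖mode G.U (η • (R.M (k + 1) - R.Φ (k + 1))) j‖ ^ 2
        + ‖mode G.U (η • R.S (k + 1)) j‖ ^ 2
        + 4 / b ^ 2 * ‖mode G.U (η • (R.Φ (k + 2) - R.Φ (k + 1))) j‖ ^ 2
        + γ * ‖mode G.U (R.e k) j‖ ^ 2 := by
    intro j hj
    have hj' := Finset.ne_of_mem_erase hj
    have h1 := R.rate_ge G hγ hg hj'
    have h2 := R.rate_le G hγ j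
    have h3 := R.modeEnergy_nonneg G hγ hγ1 hg hj' (mode G.U (R.q (k + 1)) j) (mode G.U (R.u k) j)
    have hq : mode G.U (R.q (k + 2)) j = mode G.U (R.y k) j
        - R.rate G j • (mode G.U (R.y k) j + mode G.U (R.e k) j) := by
      rw [R.q_eq, mode_sub, Pi.sub_apply, R.mode_mix]
    have hu : mode G.U (R.u (k + 1)) j = mode G.U (R.u k) j
        + R.rate G j • (mode G.U (R.y k) j + mode G.U (R.e k) j)
        + mode G.U (η • (R.Φ (k + 2) - R.Φ (k + 1))) j := by
      rw [← R.mode_mix, ← Pi.add_apply, ← mode_add, ← Pi.add_apply, ← mode_add]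
      congr 2
      rw [u, u, R.d_succ, mix, show k + 1 + 1 = k + 2 from rfl]; module
    rw [← hb] at h1
    obtain ⟨β, hβ⟩ : ∃ β, β = R.rate G j := ⟨_, rfl⟩
    rw [← hβ] at h1 h2 h3 hq hu
    rw [← hβ, hq, hu]
    have hβ0 : 0 < β := hb0.trans_le h1
    have := modeEnergy_step (β := β) hβ0 (by linarith) (x := mode G.U (R.q (k + 1)) j)
      (u := mode G.U (R.u k) j) (ρ := mode G.U (η • (R.M (k + 1) - R.Φ (k + 1))) j)
      (s := mode G.U (η • R.S (k + 1)) j) (e := mode G.U (R.e k) j)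
      (ψ := mode G.U (η • (R.Φ (k + 2) - R.Φ (k + 1))) j) (y := mode G.U (R.y k) j)
      (by
        have : R.y k = R.q (k + 1) - R.u k - η • (R.M (k + 1) - R.Φ (k + 1)) - η • R.S (k + 1) := by
          rw [R.y_eq, u]; module
        rw [this, mode_sub, mode_sub, mode_sub]; rfl)
      (inner_mode_eq_zero _ (fun i i' => by simp [inner_smul_left, R.S_q]) j)
      (inner_mode_eq_zero _ (fun i i' => by
        simp [u, inner_smul_left, inner_smul_right, inner_add_right, R.S_d, R.S_Φ]) j)
      (inner_mode_eq_zero _ (fun i i' => by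
        simp [inner_smul_left, inner_smul_right, inner_sub_right, R.S_M, R.S_Φ]) j)
      (inner_mode_eq_zero _ (R.e_y k) j) (R.inner_mode_e_u G k j)
      -- The drift contains `Φ (k + 2)`, formed after the draws of iteration `k`. Orthogonality to
      -- `e k` persists because compression does not move the mean iterate.
      (inner_mode_eq_zero _ (fun i i' => by
        simp [inner_smul_right, inner_sub_right, R.e_Φ, R.e_Φ_succ]) j)
    refine this.trans ?_
    gcongr
  have hsum := Finset.sum_le_sum key
  simp only [Finset.sum_add_distrib, ← Finset.mul_sum] at hsum
  have hΦ : normSq (η • (R.Φ (k + 2) - R.Φ (k + 1)))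
      ≤ η ^ 2 * L ^ 2 * (n * ‖mean (R.q (k + 2)) - mean (R.q (k + 1))‖ ^ 2) := by
    rw [normSq_smul, mul_assoc]
    refine mul_le_mul_of_nonneg_left ?_ (sq_nonneg _)
    have := normSq_le_const_mul (a := R.Φ (k + 2) - R.Φ (k + 1))
      (c := L ^ 2 * ‖mean (R.q (k + 2)) - mean (R.q (k + 1))‖ ^ 2) fun i => by
        rw [← mul_pow]
        exact pow_le_pow_left₀ (norm_nonneg _) (R.Φ_lip (k + 1) i) 2
    linarith
  have hM : normSq (η • (R.M (k + 1) - R.Φ (k + 1))) ≤ η ^ 2 * L ^ 2 * spread (R.q (k + 1)) := by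
    rw [normSq_smul, mul_assoc]
    exact mul_le_mul_of_nonneg_left (R.normSq_M_sub_le _) (sq_nonneg _)
  have hS : normSq (η • R.S (k + 1)) ≤ n * (η ^ 2 * σ ^ 2) := by
    refine normSq_le_const_mul fun i => ?_
    rw [Pi.smul_apply, norm_smul_sq]
    exact mul_le_mul_of_nonneg_left (R.norm_S _ i) (sq_nonneg _)
  have k1 := mul_le_mul_of_nonneg_left ((G.sum_norm_mode_le _).trans hM)
    (by positivity : 0 ≤ 4 / b)
  have k2 := (G.sum_norm_mode_le _).trans hS
  have k3 := mul_le_mul_of_nonneg_left ((G.sum_norm_mode_le _).trans hΦ)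
    (by positivity : 0 ≤ 4 / b ^ 2)
  have k4 := mul_le_mul_of_nonneg_left (G.sum_norm_mode_le (R.e k)) hγ.le
  have e1 : γ * g / 4 = b / 2 := by rw [hb]; ring
  rw [e1, ← hb]
  have e2 : R.V G (k + 1) = ∑ j ∈ Finset.univ.erase G.j₀,
    modeEnergy (R.rate G j) (mode G.U (R.q (k + 2)) j) (mode G.U (R.u (k + 1)) j) := rfl
  rw [← e2, ← V] at hsum
  linarith

include hγ hγ1 hg in
-- In a mode, `q (k+2) = (1-β) y - β e` with `e` orthogonal to `y`, so `‖y‖ ≤ ‖q (k+2)‖/(1-β)` and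
-- `1 - β ≥ 1/2`. This is why the energy appears at `k + 1`.
theorem normSq_mix_le (hW : ∀ j, ∑ i, W i j = 1) (hn : 0 < n) (k : ℕ) :
    normSq (R.mix k) ≤ 4 * γ ^ 2 * R.V G (k + 1) + γ ^ 2 * normSq (R.e k) := by
  rw [← spread_eq_normSq_of_mean_eq_zero (R.mean_mix hW k), ← G.sum_norm_mode_eq_spread hn]
  have key : ∀ j ∈ Finset.univ.erase G.j₀, ‖mode G.U (R.mix k) j‖ ^ 2
      ≤ 4 * γ ^ 2 * ‖mode G.U (R.q (k + 2)) j‖ ^ 2 + γ ^ 2 * ‖mode G.U (R.e k) j‖ ^ 2 := by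
    intro j hj
    have hj' := Finset.ne_of_mem_erase hj
    have h1 := R.rate_pos G hγ hg hj'
    have h2 := R.rate_le G hγ j
    have hey := inner_mode_eq_zero G.U (R.e_y k) j
    have hq : mode G.U (R.q (k + 2)) j = (1 - R.rate G j) • mode G.U (R.y k) j
        + (-R.rate G j) • mode G.U (R.e k) j := by
      rw [R.q_eq, mode_sub, Pi.sub_apply, R.mode_mix]; module
    rw [R.mode_mix, norm_smul_sq, norm_add_sq_of_inner_eq_zero (by rw [real_inner_comm]; exact hey),
      hq, norm_add_sq_of_inner_eq_zero, norm_smul_sq, norm_smul_sq]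
    · obtain ⟨β, hβ⟩ : ∃ β, β = R.rate G j := ⟨_, rfl⟩
      rw [← hβ] at h1 h2 ⊢
      have k1 : β ^ 2 ≤ γ ^ 2 := pow_le_pow_left₀ h1.le h2 2
      have k2 : 1 ≤ 4 * (1 - β) ^ 2 := by nlinarith
      have k3 : β ^ 2 * ‖mode G.U (R.e k) j‖ ^ 2 ≤ γ ^ 2 * ‖mode G.U (R.e k) j‖ ^ 2 := by gcongr
      have k4 : β ^ 2 * ‖mode G.U (R.y k) j‖ ^ 2
          ≤ γ ^ 2 * (4 * (1 - β) ^ 2 * ‖mode G.U (R.y k) j‖ ^ 2) := by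
        refine mul_le_mul k1 ?_ (sq_nonneg _) (sq_nonneg _)
        exact le_mul_of_one_le_left (sq_nonneg _) k2
      have k5 : 0 ≤ 4 * γ ^ 2 * ((-β) ^ 2 * ‖mode G.U (R.e k) j‖ ^ 2) := by positivity
      linarith
    · rw [inner_smul_left, inner_smul_right, real_inner_comm, hey]; simp
  refine (Finset.sum_le_sum key).trans ?_
  rw [Finset.sum_add_distrib, ← Finset.mul_sum, ← Finset.mul_sum]
  have h1 := R.spread_q_le_V G hγ hγ1 hg hn (k + 1)
  rw [← G.sum_norm_mode_eq_spread hn] at h1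
  have h2 := G.sum_norm_mode_le (R.e k)
  gcongr

end Modes

end CompressedRun

/-- The parameters of the recursion: compression error level `κ`, spectral gap `g`. -/
structure TunedParameters (L κ α γ g η : ℝ) : Prop where
  L_nonneg : 0 ≤ L
  α_pos : 0 < α
  α_le : α ≤ 1
  κ_eq : κ = 1 / (12 * α)
  g_pos : 0 < g
  g_le : g ≤ 2
  γ_eq : γ = α ^ 3 * g / 144
  η_pos : 0 < η
  η_le : η * L ≤ γ * g / 2 / 16

namespace TunedParameters

variable {L κ α γ g η : ℝ} (h : TunedParameters L κ α γ g η)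
include h

theorem γ_pos : 0 < γ := by
  have := h.α_pos; have := h.g_pos; rw [h.γ_eq]; positivity

theorem γ_le : γ ≤ 1 / 72 := by
  have h1 : α ^ 3 ≤ 1 := pow_le_one₀ h.α_pos.le h.α_le
  have h2 : α ^ 3 * g ≤ 1 * 2 := mul_le_mul h1 h.g_le h.g_pos.le zero_le_one
  rw [h.γ_eq]; linarith

theorem κα : κ * α = 1 / 12 := by
  have := h.α_pos.ne'
  rw [h.κ_eq]; field_simp

/-- The compression error enters the energy through `γκ Q`. This value is below the decrease
`α²g/800` that the weight `αg/400` and the rate `α/2` of `Q` provide. -/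
theorem γκ : γ * κ = α ^ 2 * g / 1728 := by
  have e : γ * κ = α ^ 2 * g / 144 * (κ * α) := by rw [h.γ_eq]; ring
  rw [e, h.κα]; ring

theorem rate_pos : 0 < γ * g / 2 := by
  have := h.γ_pos; have := h.g_pos; positivity

theorem rate_le : γ * g / 2 ≤ γ := by
  have := h.γ_pos; have := h.g_le; nlinarith

theorem ηL_sq_le : η ^ 2 * L ^ 2 ≤ (γ * g / 2) ^ 2 / 256 := by
  have h1 := pow_le_pow_left₀ (mul_nonneg h.η_pos.le h.L_nonneg) h.η_le 2
  rw [mul_pow] at h1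
  linarith

end TunedParameters

/-! ### The Lyapunov argument and the summed gradient bound. -/

namespace CompressedRun

variable {n : ℕ} {E : Type*} [NormedAddCommGroup E] [InnerProductSpace ℝ E]
  {W : Matrix (Fin n) (Fin n) ℝ} {L σ κ α γ η : ℝ} (R : CompressedRun E W L σ κ α γ η)
  {g : ℝ} (G : GapBasis W g)

theorem normSq_e_le (k : ℕ) : normSq (R.e k) ≤ κ * R.Q k := by
  rw [normSq, Q, normSq, Finset.mul_sum]
  exact Finset.sum_le_sum fun i _ => R.norm_e k i

/-- The compression target error contracts up to the motion of the target. -/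
theorem Q_step_le_of_motion (hα : 0 < α) (hα1 : α ≤ 1) (hκα : κ * α = 1 / 12) (k : ℕ) :
    R.Q (k + 1) ≤ (1 - 2 * α / 3) * R.Q k + 5 / α * normSq (R.y (k + 1) - R.y k) := by
  have key : ∀ i, ‖R.y (k + 1) i - R.h (k + 1) i‖ ^ 2
      ≤ (1 - 2 * α / 3) * ‖R.y k i - R.h k i‖ ^ 2 + 5 / α * ‖R.y (k + 1) i - R.y k i‖ ^ 2 := by
    intro i
    have e1 : R.y (k + 1) i - R.h (k + 1) i
        = ((1 - α) • (R.y k i - R.h k i) + (-α) • R.e k i) + (R.y (k + 1) i - R.y k i) := by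
      rw [R.h_succ]
      simp only [Pi.add_apply, Pi.smul_apply, Pi.sub_apply]
      module
    -- The error contributes `α²κ = α/12`, and Young's parameter `α/4` still leaves `(1 +
    -- α/4)((1-α)² + α/12) ≤ 1 - 2α/3`.
    have h1 := norm_add_sq_le_young ((1 - α) • (R.y k i - R.h k i) + (-α) • R.e k i)
      (R.y (k + 1) i - R.y k i) (by linarith : 0 < α / 4)
    rw [← e1, norm_add_sq_of_inner_eq_zero, norm_smul_sq, norm_smul_sq] at h1
    · have h2 := R.norm_e k i
      have h3 : (-α) ^ 2 * ‖R.e k i‖ ^ 2 ≤ α / 12 * ‖R.y k i - R.h k i‖ ^ 2 := by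
        have : α / 12 = α ^ 2 * κ := by
          have : α ^ 2 * κ = α * (κ * α) := by ring
          rw [this, hκα]; ring
        rw [this, neg_sq, mul_assoc]
        exact mul_le_mul_of_nonneg_left h2 (sq_nonneg _)
      have h4 : 1 + 1 / (α / 4) ≤ 5 / α := by
        rw [le_div_iff₀ hα]
        have : (1 + 1 / (α / 4)) * α = α + 4 := by field_simp
        linarith
      have h5 : (1 + α / 4) * ((1 - α) ^ 2 + α / 12) ≤ 1 - 2 * α / 3 := by
        have : 0 < α ^ 2 := by positivity
        nlinarith [mul_nonneg hα.le (sub_nonneg.2 hα1), mul_nonneg this.le (sub_nonneg.2 hα1)]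
      calc _ ≤ _ := h1
        _ ≤ (1 + α / 4) * ((1 - α) ^ 2 * ‖R.y k i - R.h k i‖ ^ 2
              + α / 12 * ‖R.y k i - R.h k i‖ ^ 2)
            + 5 / α * ‖R.y (k + 1) i - R.y k i‖ ^ 2 := by gcongr
        _ = (1 + α / 4) * ((1 - α) ^ 2 + α / 12) * ‖R.y k i - R.h k i‖ ^ 2
            + 5 / α * ‖R.y (k + 1) i - R.y k i‖ ^ 2 := by ring
        _ ≤ _ := by gcongr
    · rw [inner_smul_left, inner_smul_right, inner_sub_left, real_inner_comm, R.e_y,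
        real_inner_comm, R.e_h]; simp
  have := Finset.sum_le_sum fun i (_ : i ∈ Finset.univ) => key i
  rw [Finset.sum_add_distrib, ← Finset.mul_sum, ← Finset.mul_sum] at this
  exact this

/-- Writing `y k = q (k+2) + mix k` cancels `q (k+2)` from the difference. What remains is the dual
deviation, the mixing term, the gradient deviation and the noise. The mean of `u (k+1)`, which is
`η` times the mean gradient, is split off because only the spread of `u` is controlled by the
energy. -/
theorem motion_le (hp : TunedParameters L κ α γ g η) (hW : ∀ j, ∑ i, W i j = 1) (hn : 0 < n)
    (k : ℕ) : normSq (R.y (k + 1) - R.y k)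
      ≤ 13 / 5 * γ * R.V G (k + 1) + 8 * γ ^ 2 * κ * R.Q k
        + 8 * (n * η ^ 2 * (σ ^ 2 + ‖mean (R.Φ (k + 2))‖ ^ 2)) := by
  have hγ := hp.γ_pos
  have hγ1 := hp.γ_le
  have e1 : R.y (k + 1) - R.y k = -(R.u (k + 1) - fun _ => mean (R.u (k + 1)))
      - ((R.mix k + η • (R.M (k + 2) - R.Φ (k + 2)))
        + (η • R.S (k + 2) + η • fun _ => mean (R.Φ (k + 2)))) := by
    have hm : mean (R.u (k + 1)) = η • mean (R.Φ (k + 2)) := by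
      rw [u, mean_add, R.mean_d hW, mean_smul, zero_add]
    have h1 := R.q_eq k
    have h2 : R.y k = R.q (k + 2) + R.mix k := by rw [h1]; abel
    have h3 : (fun _ : Fin n => mean (R.u (k + 1))) = η • fun _ => mean (R.Φ (k + 2)) := by
      rw [hm]; rfl
    rw [h3, h2, R.y_eq (k + 1), u, show k + 1 + 1 = k + 2 from rfl]
    module
  have h1 := normSq_sub_le (-(R.u (k + 1) - fun _ => mean (R.u (k + 1))))
    ((R.mix k + η • (R.M (k + 2) - R.Φ (k + 2)))
      + (η • R.S (k + 2) + η • fun _ => mean (R.Φ (k + 2))))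
  have h2 := normSq_add_le (R.mix k + η • (R.M (k + 2) - R.Φ (k + 2)))
    (η • R.S (k + 2) + η • fun _ => mean (R.Φ (k + 2)))
  have h3 := normSq_add_le (R.mix k) (η • (R.M (k + 2) - R.Φ (k + 2)))
  have h4 := normSq_add_le (η • R.S (k + 2)) (η • fun _ => mean (R.Φ (k + 2)))
  rw [← e1] at h1
  have h5 : normSq (-(R.u (k + 1) - fun _ => mean (R.u (k + 1)))) = spread (R.u (k + 1)) := by
    simp [normSq, spread, norm_sub_rev]
  have h6 := R.spread_u_le_V G hγ hγ1 hp.g_pos hn (k + 1)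
  have h7 := R.normSq_mix_le G hγ hγ1 hp.g_pos hW hn k
  have h8 := R.spread_q_le_V G hγ hγ1 hp.g_pos hn (k + 1)
  have h9 := R.normSq_M_sub_le (k + 2)
  have h10 := normSq_le_const_mul (R.norm_S (k + 2))
  have h11 := R.normSq_e_le k
  have hV := R.V_nonneg G hγ hγ1 hp.g_pos (k + 1)
  rw [h5] at h1
  rw [normSq_smul] at h3
  rw [normSq_smul, normSq_smul, normSq_const] at h4
  have k1 : η ^ 2 * normSq (R.M (k + 2) - R.Φ (k + 2)) ≤ γ / 18432 * R.V G (k + 1) := by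
    calc _ ≤ η ^ 2 * (L ^ 2 * R.V G (k + 1)) := by gcongr; exact h9.trans (by gcongr)
      _ = (η ^ 2 * L ^ 2) * R.V G (k + 1) := by ring
      _ ≤ γ / 18432 * R.V G (k + 1) := by
          gcongr
          have k2 := hp.ηL_sq_le
          have k3 := pow_le_pow_left₀ hp.rate_pos.le hp.rate_le 2
          nlinarith
  have k2 : γ ^ 2 * normSq (R.e k) ≤ γ ^ 2 * (κ * R.Q k) := by gcongr
  have k3 : η ^ 2 * normSq (R.S (k + 2)) ≤ η ^ 2 * (n * σ ^ 2) := by gcongr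
  have k4 : γ ^ 2 * R.V G (k + 1) ≤ γ / 72 * R.V G (k + 1) := by
    gcongr; nlinarith
  have k5 : 0 ≤ γ * R.V G (k + 1) := by positivity
  linarith

theorem Q_step (hp : TunedParameters L κ α γ g η) (hW : ∀ j, ∑ i, W i j = 1) (hn : 0 < n)
    (k : ℕ) : R.Q (k + 1) ≤ (1 - α / 2) * R.Q k + 13 / α * γ * R.V G (k + 1)
        + 40 / α * (n * η ^ 2 * (σ ^ 2 + ‖mean (R.Φ (k + 2))‖ ^ 2)) := by
  have hα := hp.α_pos
  have h1 := R.Q_step_le_of_motion hα hp.α_le hp.κα k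
  have h2 := mul_le_mul_of_nonneg_left (R.motion_le G hp hW hn k) (by positivity : 0 ≤ 5 / α)
  -- The compression error inside the mixing term feeds back into the motion. It consumes `α/6` of
  -- the rate `2α/3` and leaves `α/2`.
  have h3 : 5 / α * (8 * γ ^ 2 * κ * R.Q k) ≤ α / 6 * R.Q k := by
    have e : 5 / α * (8 * γ ^ 2 * κ * R.Q k) = 40 * γ * (γ * κ) / α * R.Q k := by ring
    rw [e]
    refine mul_le_mul_of_nonneg_right ?_ (R.Q_nonneg k)
    rw [hp.γκ, div_le_iff₀ hα]
    have k1 := hp.γ_le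
    have k2 := hp.g_le
    have k3 := hp.γ_pos
    have k4 : γ * g ≤ 1 / 72 * 2 := mul_le_mul k1 k2 hp.g_pos.le (by norm_num)
    have k5 : α ^ 2 * (γ * g) ≤ α ^ 2 * (1 / 72 * 2) := by gcongr
    nlinarith [sq_nonneg α]
  have e2 : 5 / α * (13 / 5 * γ * R.V G (k + 1) + 8 * γ ^ 2 * κ * R.Q k
        + 8 * (n * η ^ 2 * (σ ^ 2 + ‖mean (R.Φ (k + 2))‖ ^ 2)))
      = 13 / α * γ * R.V G (k + 1) + 5 / α * (8 * γ ^ 2 * κ * R.Q k)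
        + 40 / α * (n * η ^ 2 * (σ ^ 2 + ‖mean (R.Φ (k + 2))‖ ^ 2)) := by ring
  rw [e2] at h2
  linarith

/-- The Lyapunov function of the recursion. -/
noncomputable def lyapunov (k : ℕ) : ℝ := R.V G k + α * g / 400 * R.Q k

/-- The weight `αg/400` serves both couplings. It turns the motion term `(13γ/α) V (k+1)` into
`(13b/200) V (k+1)`, below `(b/4) V (k+1)`. It also makes the decrease `α²g/800` of the `Q` part
exceed the compression cost `(5/4) α²g/1728`. The contraction of `V` that is left pays for the
gradient deviation and for the `spread` kept on the left. -/
theorem lyapunov_step (hp : TunedParameters L κ α γ g η) (hW : ∀ j, ∑ i, W i j = 1) (hn : 0 < n)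
    (k : ℕ) : R.lyapunov G (k + 1) + γ * g / 2 / 8 * spread (R.q (k + 1)) ≤ R.lyapunov G k
      + n * η ^ 2 * (3 * σ ^ 2 + ‖mean (R.Φ (k + 1))‖ ^ 2 + ‖mean (R.Φ (k + 2))‖ ^ 2) := by
  have hγ := hp.γ_pos
  have hα := hp.α_pos
  have hg := hp.g_pos
  have hn1 : (1 : ℝ) ≤ n := by exact_mod_cast hn
  have hV := R.V_step G hγ hp.γ_le hp.g_pos k
  have hQ := R.Q_step G hp hW hn k
  have hX := R.spread_q_le_V G hγ hp.γ_le hp.g_pos hn k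
  have hD := R.norm_mean_q_step_le hW hn (k + 1)
  have he := R.normSq_e_le k
  have hηL := hp.ηL_sq_le
  have hV0 := R.V_nonneg G hγ hp.γ_le hp.g_pos k
  have hQ0 := R.Q_nonneg k
  have hX0 := spread_nonneg (R.q (k + 1))
  have hb1 := hp.rate_le
  have hb0 := hp.rate_pos
  have hγ1 := hp.γ_le
  have hγκ := hp.γκ
  rw [show γ * g / 4 = γ * g / 2 / 2 by ring] at hV
  obtain ⟨b, hb⟩ : ∃ b, b = γ * g / 2 := ⟨_, rfl⟩
  rw [← hb] at hV hηL hb1 hb0 ⊢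
  obtain ⟨N, hN⟩ : ∃ N, N = n * η ^ 2 := ⟨_, rfl⟩
  have hN0 : 0 ≤ N := by rw [hN]; positivity
  obtain ⟨D, hDd⟩ : ∃ D, D = ‖mean (R.q (k + 2)) - mean (R.q (k + 1))‖ ^ 2 := ⟨_, rfl⟩
  rw [← hDd] at hV
  change ‖mean (R.q (k + 2)) - mean (R.q (k + 1))‖ ^ 2 ≤ _ at hD
  rw [← hDd] at hD
  -- the gradient deviation and the drift
  have t1 : 4 / b * (η ^ 2 * L ^ 2 * spread (R.q (k + 1))) ≤ b / 64 * spread (R.q (k + 1)) := by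
    calc _ = 4 / b * (η ^ 2 * L ^ 2) * spread (R.q (k + 1)) := by ring
      _ ≤ 4 / b * (b ^ 2 / 256) * spread (R.q (k + 1)) := by gcongr
      _ = _ := by field_simp; ring
  have t2 : n * D ≤ N * (2 * ‖mean (R.Φ (k + 1))‖ ^ 2) + 2 * (η ^ 2 * L ^ 2) * spread (R.q (k + 1))
      + N * σ ^ 2 := by
    calc n * D ≤ n * (η ^ 2 * (2 * ‖mean (R.Φ (k + 1))‖ ^ 2
          + 2 * (L ^ 2 / n * spread (R.q (k + 1))) + σ ^ 2 / n)) := by gcongr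
      _ = N * (2 * ‖mean (R.Φ (k + 1))‖ ^ 2) + 2 * (η ^ 2 * L ^ 2) * spread (R.q (k + 1))
          + η ^ 2 * σ ^ 2 := by rw [hN]; field_simp
      _ ≤ _ := by
        gcongr
        rw [hN]
        exact le_mul_of_one_le_left (sq_nonneg _) hn1
  have hD0 : 0 ≤ n * D := by rw [hDd]; positivity
  have t3 : 4 / b ^ 2 * (η ^ 2 * L ^ 2 * (n * D)) ≤ 1 / 64 * (n * D) := by
    calc _ = 4 / b ^ 2 * (η ^ 2 * L ^ 2) * (n * D) := by ring
      _ ≤ 4 / b ^ 2 * (b ^ 2 / 256) * (n * D) := by gcongr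
      _ = _ := by field_simp; ring
  have t4 : η ^ 2 * L ^ 2 * spread (R.q (k + 1)) ≤ b / 256 * spread (R.q (k + 1)) := by
    gcongr
    nlinarith
  have t5 : γ * normSq (R.e k) ≤ α ^ 2 * g / 1728 * R.Q k := by
    rw [← hγκ, mul_assoc]; gcongr
  have hV' : R.V G (k + 1) ≤ (1 - b / 2) * R.V G k + b / 32 * spread (R.q (k + 1))
      + N * (17 / 16 * σ ^ 2 + 1 / 32 * ‖mean (R.Φ (k + 1))‖ ^ 2)
      + α ^ 2 * g / 1728 * R.Q k := by
    have e : n * (η ^ 2 * σ ^ 2) = N * σ ^ 2 := by rw [hN]; ring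
    rw [e] at hV
    have : 0 ≤ N * σ ^ 2 := by positivity
    have := mul_nonneg hb0.le hX0
    linarith
  have hV1 := R.V_nonneg G hγ hp.γ_le hp.g_pos (k + 1)
  have s1 : α * g / 400 * (13 / α * γ * R.V G (k + 1)) ≤ b / 4 * R.V G (k + 1) := by
    have e : α * g / 400 * (13 / α * γ * R.V G (k + 1)) = 13 / 200 * b * R.V G (k + 1) := by
      rw [hb]; field_simp; ring
    rw [e]; gcongr; linarith
  have s2 : α * g / 400 * (40 / α * (n * η ^ 2 * (σ ^ 2 + ‖mean (R.Φ (k + 2))‖ ^ 2)))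
      ≤ 1 / 5 * (N * (σ ^ 2 + ‖mean (R.Φ (k + 2))‖ ^ 2)) := by
    have e : α * g / 400 * (40 / α * (n * η ^ 2 * (σ ^ 2 + ‖mean (R.Φ (k + 2))‖ ^ 2)))
        = g / 10 * (N * (σ ^ 2 + ‖mean (R.Φ (k + 2))‖ ^ 2)) := by
      rw [hN]; field_simp; ring
    rw [e]
    have := hp.g_le
    exact mul_le_mul_of_nonneg_right (by linarith) (by positivity)
  have hQ' := mul_le_mul_of_nonneg_left hQ (by positivity : 0 ≤ α * g / 400)
  have hb4 : b / 4 ≤ 1 / 4 := by linarith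
  -- `V (k+1)` also stands on the right of `Q_step`, so its bound is used `1 + b/4` times, and `(1 +
  -- b/4)(1 - b/2) ≤ 1 - b/4`.
  have hV'' := mul_le_mul_of_nonneg_left hV' (by linarith : 0 ≤ 1 + b / 4)
  have r1 : b / 4 * (b / 32 * spread (R.q (k + 1))) ≤ 1 / 4 * (b / 32 * spread (R.q (k + 1))) := by
    gcongr
  have r2 : b / 4 * (N * (17 / 16 * σ ^ 2 + 1 / 32 * ‖mean (R.Φ (k + 1))‖ ^ 2))
      ≤ 1 / 4 * (N * (17 / 16 * σ ^ 2 + 1 / 32 * ‖mean (R.Φ (k + 1))‖ ^ 2)) := by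
    gcongr
  have r3 : b / 4 * (α ^ 2 * g / 1728 * R.Q k) ≤ 1 / 4 * (α ^ 2 * g / 1728 * R.Q k) := by
    gcongr
  have r4 : 0 ≤ b ^ 2 * R.V G k := by positivity
  have r5 : 0 ≤ α ^ 2 * g * R.Q k := by positivity
  have r6 : b * spread (R.q (k + 1)) ≤ b * R.V G k := by gcongr
  have r7 : 0 ≤ N * σ ^ 2 := by positivity
  have r8 : 0 ≤ N * ‖mean (R.Φ (k + 1))‖ ^ 2 := by positivity
  have r9 : 0 ≤ N * ‖mean (R.Φ (k + 2))‖ ^ 2 := by positivity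
  have r10 : 0 ≤ b * spread (R.q (k + 1)) := by positivity
  rw [lyapunov, lyapunov, ← hN]
  linarith

/-- Only `T` steps are telescoped; the last spread is covered by the Lyapunov value that remains.
Thus no gradient beyond index `T + 1` occurs, and the sum on the right is the one that the descent
inequality controls. -/
theorem sum_spread_le (hp : TunedParameters L κ α γ g η) (hW : ∀ j, ∑ i, W i j = 1) (hn : 0 < n)
    (T : ℕ) : γ * g / 2 / 8 * ∑ t ∈ Finset.range (T + 1), spread (R.q (t + 1))
      ≤ R.lyapunov G 0 + n * η ^ 2 * (3 * σ ^ 2 * (T + 1)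
        + 2 * ∑ t ∈ Finset.range (T + 1), ‖mean (R.Φ (t + 1))‖ ^ 2) := by
  have hb0 := hp.rate_pos
  have hb1 := hp.rate_le
  have hγ1 := hp.γ_le
  have hα := hp.α_pos
  have hg := hp.g_pos
  have key : ∀ T : ℕ, R.lyapunov G T + γ * g / 2 / 8 * ∑ t ∈ Finset.range T, spread (R.q (t + 1))
      ≤ R.lyapunov G 0 + n * η ^ 2 * (3 * σ ^ 2 * T
        + (∑ t ∈ Finset.range T, ‖mean (R.Φ (t + 1))‖ ^ 2
          + ∑ t ∈ Finset.range T, ‖mean (R.Φ (t + 2))‖ ^ 2)) := by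
    intro T
    induction T with
    | zero => simp
    | succ T ih =>
      have := R.lyapunov_step G hp hW hn T
      simp only [Finset.sum_range_succ]
      push_cast
      linarith
  have h1 := key T
  have h2 := R.spread_q_le_V G hp.γ_pos hγ1 hg hn T
  have h3 : 0 ≤ α * g / 400 * R.Q T := mul_nonneg (by positivity) (R.Q_nonneg T)
  have h4 : γ * g / 2 / 8 * spread (R.q (T + 1)) ≤ R.lyapunov G T := by
    have := spread_nonneg (R.q (T + 1))
    rw [lyapunov]
    nlinarith
  have h5 : ∑ t ∈ Finset.range T, ‖mean (R.Φ (t + 1))‖ ^ 2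
      ≤ ∑ t ∈ Finset.range (T + 1), ‖mean (R.Φ (t + 1))‖ ^ 2 := by
    rw [Finset.sum_range_succ]; linarith [sq_nonneg ‖mean (R.Φ (T + 1))‖]
  have h6 : ∑ t ∈ Finset.range T, ‖mean (R.Φ (t + 2))‖ ^ 2
      ≤ ∑ t ∈ Finset.range (T + 1), ‖mean (R.Φ (t + 1))‖ ^ 2 := by
    rw [Finset.sum_range_succ']; linarith [sq_nonneg ‖mean (R.Φ (0 + 1))‖]
  have h7 : n * η ^ 2 * (3 * σ ^ 2 * T
        + (∑ t ∈ Finset.range T, ‖mean (R.Φ (t + 1))‖ ^ 2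
          + ∑ t ∈ Finset.range T, ‖mean (R.Φ (t + 2))‖ ^ 2))
      ≤ n * η ^ 2 * (3 * σ ^ 2 * (T + 1)
        + 2 * ∑ t ∈ Finset.range (T + 1), ‖mean (R.Φ (t + 1))‖ ^ 2) := by
    refine mul_le_mul_of_nonneg_left ?_ (by positivity)
    nlinarith [sq_nonneg σ]
  rw [Finset.sum_range_succ, mul_add]
  linarith

/-- The bound on the summed squared gradients in terms of the initial energy. -/
theorem sum_norm_mean_Φ_le (hp : TunedParameters L κ α γ g η) (hW : ∀ j, ∑ i, W i j = 1)
    (hn : 0 < n) {Flow : ℝ} (hF : ∀ t, Flow ≤ R.F t) (T : ℕ) :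
    ∑ t ∈ Finset.range (T + 1), ‖mean (R.Φ (t + 1))‖ ^ 2
      ≤ 4 / η * (R.F 1 - Flow) + 16 * L ^ 2 / (n * (γ * g / 2)) * R.lyapunov G 0
        + 48 * (L ^ 2 * η ^ 2 * σ ^ 2 * (T + 1)) / (γ * g / 2)
        + 4 * (T + 1) * L * η * (σ ^ 2 / n) := by
  have hb0 := hp.rate_pos
  have hb1 := hp.rate_le
  have hγ1 := hp.γ_le
  have hη := hp.η_pos
  have hL := hp.L_nonneg
  have hn0 : (0 : ℝ) < n := by exact_mod_cast hn
  have hηL := hp.ηL_sq_le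
  have hηL2 : η * L ≤ 1 / 2 := by have := hp.η_le; linarith
  have hX := R.sum_spread_le G hp hW hn T
  obtain ⟨b, hb⟩ : ∃ b, b = γ * g / 2 := ⟨_, rfl⟩
  rw [← hb] at hX hηL hb1 hb0 ⊢
  have key : ∀ T : ℕ, R.F (T + 1) + η / 2 * ∑ t ∈ Finset.range T, ‖mean (R.Φ (t + 1))‖ ^ 2
      ≤ R.F 1 + η * L ^ 2 / n / 2 * ∑ t ∈ Finset.range T, spread (R.q (t + 1))
        + T * (L * η ^ 2 * (σ ^ 2 / n)) := by
    intro T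
    induction T with
    | zero => simp
    | succ T ih =>
      have := R.F_descent hW hn hL hη.le hηL2 (T + 1)
      simp only [Finset.sum_range_succ]
      have e : η * L ^ 2 / n / 2 * (∑ t ∈ Finset.range T, spread (R.q (t + 1))
          + spread (R.q (T + 1))) = η * L ^ 2 / n / 2 * ∑ t ∈ Finset.range T, spread (R.q (t + 1))
          + η * (L ^ 2 / n * spread (R.q (T + 1))) / 2 := by ring
      rw [e]
      push_cast
      linarith
  have h1 := key (T + 1)
  have h2 := hF (T + 1 + 1)
  push_cast at h1
  obtain ⟨A, hA⟩ : ∃ A, A = ∑ t ∈ Finset.range (T + 1), ‖mean (R.Φ (t + 1))‖ ^ 2 := ⟨_, rfl⟩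
  obtain ⟨X, hXd⟩ : ∃ X, X = ∑ t ∈ Finset.range (T + 1), spread (R.q (t + 1)) := ⟨_, rfl⟩
  rw [← hA, ← hXd] at h1 hX
  rw [← hA]
  have hA0 : 0 ≤ A := by rw [hA]; exact Finset.sum_nonneg fun _ _ => sq_nonneg _
  have h3 : A ≤ 2 / η * (R.F 1 - Flow) + L ^ 2 / n * X + 2 * (T + 1) * L * η * (σ ^ 2 / n) := by
    have h4 : η / 2 * A ≤ (R.F 1 - Flow) + η * L ^ 2 / n / 2 * X
      + (T + 1) * (L * η ^ 2 * (σ ^ 2 / n)) := by linarith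
    have h5 := mul_le_mul_of_nonneg_left h4 (by positivity : 0 ≤ 2 / η)
    have e1 : 2 / η * (η / 2 * A) = A := by field_simp
    have e2 : 2 / η * ((R.F 1 - Flow) + η * L ^ 2 / n / 2 * X
      + (T + 1) * (L * η ^ 2 * (σ ^ 2 / n))) = 2 / η * (R.F 1 - Flow) + L ^ 2 / n * X
        + 2 * (T + 1) * L * η * (σ ^ 2 / n) := by field_simp
    rwa [e1, e2] at h5
  have h4 : L ^ 2 / n * X ≤ 8 * L ^ 2 / (n * b) * R.lyapunov G 0
      + 24 * (L ^ 2 * η ^ 2 * σ ^ 2 * (T + 1)) / b + 16 * (η ^ 2 * L ^ 2) / b * A := by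
    have h5 := mul_le_mul_of_nonneg_left hX (by positivity : 0 ≤ 8 * L ^ 2 / (n * b))
    have e1 : 8 * L ^ 2 / (n * b) * (b / 8 * X) = L ^ 2 / n * X := by field_simp
    have e2 : 8 * L ^ 2 / (n * b) * (R.lyapunov G 0 + n * η ^ 2 * (3 * σ ^ 2 * (T + 1) + 2 * A))
        = 8 * L ^ 2 / (n * b) * R.lyapunov G 0
      + 24 * (L ^ 2 * η ^ 2 * σ ^ 2 * (T + 1)) / b + 16 * (η ^ 2 * L ^ 2) / b * A := by
      field_simp; ring
    rwa [e1, e2] at h5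
  -- The gradients return through the consensus error. Since `ηL ≤ b/16`, at most half of `A`
  -- returns and is absorbed on the left, which doubles all other constants.
  have h5 : 16 * (η ^ 2 * L ^ 2) / b * A ≤ 1 / 2 * A := by
    refine mul_le_mul_of_nonneg_right ?_ hA0
    rw [div_le_iff₀ hb0]
    nlinarith
  have e1 : 4 / η * (R.F 1 - Flow) = 2 * (2 / η * (R.F 1 - Flow)) := by ring
  have e2 : 16 * L ^ 2 / (n * b) * R.lyapunov G 0
    = 2 * (8 * L ^ 2 / (n * b) * R.lyapunov G 0) := by ring
  have e3 : 48 * (L ^ 2 * η ^ 2 * σ ^ 2 * (T + 1)) / b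
    = 2 * (24 * (L ^ 2 * η ^ 2 * σ ^ 2 * (T + 1)) / b) := by ring
  rw [e1, e2, e3]
  linarith

/-- The initial energy in terms of the initial data. -/
theorem lyapunov_zero_le (hp : TunedParameters L κ α γ g η) (hW : ∀ j, ∑ i, W i j = 1)
    (hn : 0 < n) (hη : η ^ 2 ≤ γ * g / 2) :
    R.lyapunov G 0 ≤ 20 * (1 + L ^ 2) *
      (normSq (R.q 0) + normSq (R.M 0) + normSq (R.h 0) + n * σ ^ 2) := by
  have hb0 := hp.rate_pos
  have hb1 := hp.rate_le
  have hγ1 := hp.γ_le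
  have hα := hp.α_pos
  have hg := hp.g_pos
  have hn0 : (0 : ℝ) < n := by exact_mod_cast hn
  have hη1 : η ^ 2 ≤ 1 := by linarith
  obtain ⟨I, hI⟩ : ∃ I, I = normSq (R.q 0) + normSq (R.M 0) + normSq (R.h 0) + n * σ ^ 2 :=
    ⟨_, rfl⟩
  rw [← hI]
  have q0 := normSq_nonneg (R.q 0)
  have m0 := normSq_nonneg (R.M 0)
  have h0 := normSq_nonneg (R.h 0)
  have s0 : 0 ≤ n * σ ^ 2 := by positivity
  have hI0 : 0 ≤ I := by linarith
  have hMS : normSq (R.M 0 + R.S 0) ≤ 2 * I := by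
    have h1 := normSq_add_le (R.M 0) (R.S 0)
    have h2 := normSq_le_const_mul (R.norm_S 0)
    linarith
  have hq1 : normSq (R.q 1) ≤ 4 * I + 2 * I := by
    have h1 := normSq_sub_le (R.q 0) (η • (R.M 0 + R.S 0))
    rw [← R.q_one, normSq_smul] at h1
    have h2 : η ^ 2 * normSq (R.M 0 + R.S 0) ≤ 1 * (2 * I) :=
      mul_le_mul hη1 hMS (normSq_nonneg _) zero_le_one
    linarith
  have hD : n * ‖mean (R.q 1) - mean (R.q 0)‖ ^ 2 ≤ 2 * I := by
    have h1 := R.mean_q_succ hW 0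
    rw [← mean_add] at h1
    rw [h1, norm_neg, norm_smul_sq]
    have h2 := norm_mean_sq_le hn (R.M 0 + R.S 0)
    calc n * (η ^ 2 * ‖mean (R.M 0 + R.S 0)‖ ^ 2) ≤ n * (1 * (normSq (R.M 0 + R.S 0) / n)) := by
          gcongr
      _ = normSq (R.M 0 + R.S 0) := by field_simp
      _ ≤ _ := hMS
  have hΦ : normSq (R.Φ 1) ≤ 12 * (1 + L ^ 2) * I := by
    have e : R.Φ 1 = (R.Φ 1 - R.Φ 0) + (R.M 0 - (R.M 0 - R.Φ 0)) := by abel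
    have h1 := normSq_add_le (R.Φ 1 - R.Φ 0) (R.M 0 - (R.M 0 - R.Φ 0))
    rw [← e] at h1
    have h2 := normSq_sub_le (R.M 0) (R.M 0 - R.Φ 0)
    have h3 := R.normSq_M_sub_le 0
    have h4 := spread_le_normSq hn (R.q 0)
    have h5 := normSq_le_const_mul (a := R.Φ 1 - R.Φ 0)
      (c := L ^ 2 * ‖mean (R.q 1) - mean (R.q 0)‖ ^ 2) fun i => by
        rw [← mul_pow]
        exact pow_le_pow_left₀ (norm_nonneg _) (R.Φ_lip 0 i) 2
    have h6 := mul_le_mul_of_nonneg_left hD (sq_nonneg L)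
    have h7 : L ^ 2 * spread (R.q 0) ≤ L ^ 2 * I := by gcongr; linarith
    have h8 : 0 ≤ L ^ 2 * I := by positivity
    linarith
  have hM1 : normSq (R.M 1) ≤ 36 * (1 + L ^ 2) * I := by
    have h1 := normSq_add_le (R.M 1 - R.Φ 1) (R.Φ 1)
    rw [sub_add_cancel] at h1
    have h2 := R.normSq_M_sub_le 1
    have h4 := spread_le_normSq hn (R.q 1)
    have h7 : L ^ 2 * spread (R.q 1) ≤ L ^ 2 * (4 * I + 2 * I) := by gcongr; linarith
    linarith
  have hQ : R.Q 0 ≤ 4 * (7 + 37 * (1 + L ^ 2)) * I := by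
    have e : R.y 0 - R.h 0 = (R.q 1 - R.h 0) - ((η • R.M 1) + (η • R.S 1)) := by
      rw [R.y_eq, R.d_zero]; module
    have h1 := normSq_sub_le (R.q 1 - R.h 0) ((η • R.M 1) + (η • R.S 1))
    have h2 := normSq_sub_le (R.q 1) (R.h 0)
    have h3 := normSq_add_le (η • R.M 1) (η • R.S 1)
    have h4 := normSq_le_const_mul (R.norm_S 1)
    rw [← e] at h1
    rw [normSq_smul, normSq_smul] at h3
    have h5 : η ^ 2 * normSq (R.M 1) ≤ 1 * (36 * (1 + L ^ 2) * I) :=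
      mul_le_mul hη1 hM1 (normSq_nonneg _) zero_le_one
    have h6 : η ^ 2 * normSq (R.S 1) ≤ 1 * (n * σ ^ 2) := by
      refine mul_le_mul hη1 h4 (normSq_nonneg _) zero_le_one
    have h7 : 0 ≤ L ^ 2 * I := by positivity
    rw [Q]
    linarith
  have hV : R.V G 0 ≤ 6 * I + 12 * (1 + L ^ 2) * I := by
    have key : ∀ j ∈ Finset.univ.erase G.j₀,
        modeEnergy (R.rate G j) (mode G.U (R.q 1) j) (mode G.U (R.u 0) j)
        ≤ ‖mode G.U (R.q 1) j‖ ^ 2 + ‖mode G.U (R.Φ 1) j‖ ^ 2 := by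
      intro j hj
      have h1 := R.rate_ge G hp.γ_pos hg (Finset.ne_of_mem_erase hj)
      obtain ⟨β, hβ⟩ : ∃ β, β = R.rate G j := ⟨_, rfl⟩
      rw [← hβ] at h1 ⊢
      have hβ0 : 0 < β := hb0.trans_le h1
      have hu : R.u 0 = η • R.Φ 1 := by rw [u, R.d_zero, zero_add]
      rw [modeEnergy, hu, mode_smul, Pi.smul_apply, norm_smul_sq]
      -- The dual weight may be as large as `1/b`, but `u 0 = η Φ 1` brings a factor `η² ≤ b`.
      have h2 : (1 - β) / β * η ^ 2 ≤ 1 := by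
        rw [div_mul_eq_mul_div, div_le_one hβ0]
        nlinarith [sq_nonneg η]
      have h3 := mul_le_mul_of_nonneg_right h2 (sq_nonneg ‖mode G.U (R.Φ 1) j‖)
      linarith
    have h1 := Finset.sum_le_sum key
    rw [Finset.sum_add_distrib] at h1
    have h2 := G.sum_norm_mode_le (R.q 1)
    have h3 := G.sum_norm_mode_le (R.Φ 1)
    rw [V]
    linarith
  have hw : α * g / 400 * R.Q 0 ≤ 1 / 200 * (4 * (7 + 37 * (1 + L ^ 2)) * I) := by
    have : α * g ≤ 1 * 2 := mul_le_mul hp.α_le hp.g_le hg.le zero_le_one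
    refine mul_le_mul (by linarith) hQ (R.Q_nonneg 0) (by norm_num)
  have h7 : 0 ≤ L ^ 2 * I := by positivity
  rw [lyapunov]
  linarith

end CompressedRun

/-! ### The spectral gap of a mixing matrix -/

namespace IsMixingMatrix

variable {n : ℕ} {G : SimpleGraph (Fin n)} {W : Matrix (Fin n) (Fin n) ℝ}
  (h : IsMixingMatrix G W)
include h

theorem comm (i j : Fin n) : W i j = W j i := (h.symm.apply i j).symm

theorem sum_col (j : Fin n) : ∑ i, W i j = 1 := by
  rw [← h.stochastic j]; exact Finset.sum_congr rfl fun i _ => h.comm i j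

/-- The Dirichlet form of the network. For `s = -1` it gives `μ ≤ 1` and the constancy of fixed
vectors, for `s = 1` it gives `μ ≥ -1`. -/
theorem sum_mul_sq_add (s : ℝ) {v : Fin n → ℝ} {μ : ℝ} (hv : ∀ i, ∑ j, W i j * v j = μ * v i) :
    ∑ i, ∑ j, W i j * (v i + s * v j) ^ 2 = (1 + s ^ 2 + 2 * s * μ) * ∑ i, v i ^ 2 := by
  have e : ∀ i j, W i j * (v i + s * v j) ^ 2
      = W i j * v i ^ 2 + s ^ 2 * (W i j * v j ^ 2) + 2 * s * (v i * (W i j * v j)) := by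
    intros; ring
  have h1 : ∑ i, ∑ j, W i j * v i ^ 2 = ∑ i, v i ^ 2 := by
    simp only [← Finset.sum_mul, h.stochastic, one_mul]
  have h2 : ∑ i, ∑ j, W i j * v j ^ 2 = ∑ i, v i ^ 2 := by
    rw [Finset.sum_comm]
    simp only [← Finset.sum_mul, h.sum_col, one_mul]
  have h3 : ∑ i, ∑ j, v i * (W i j * v j) = μ * ∑ i, v i ^ 2 := by
    simp only [← Finset.mul_sum, hv]
    rw [Finset.mul_sum]
    exact Finset.sum_congr rfl fun i _ => by ring
  simp only [e, Finset.sum_add_distrib, ← Finset.mul_sum]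
  simp only [← Finset.mul_sum] at h1 h2 h3
  rw [h1, h2, h3]; ring

theorem sum_mul_sq_nonneg (s : ℝ) (v : Fin n → ℝ) :
    0 ≤ ∑ i, ∑ j, W i j * (v i + s * v j) ^ 2 :=
  Finset.sum_nonneg fun i _ => Finset.sum_nonneg fun j _ => mul_nonneg (h.nonneg i j) (sq_nonneg _)

theorem eigenvalue_le_one {v : Fin n → ℝ} {μ : ℝ} (hv : ∀ i, ∑ j, W i j * v j = μ * v i)
    (h0 : 0 < ∑ i, v i ^ 2) : μ ≤ 1 := by
  have h1 := h.sum_mul_sq_add (-1) hv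
  have h2 := h.sum_mul_sq_nonneg (-1) v
  rw [h1] at h2
  have := nonneg_of_mul_nonneg_left h2 h0
  linarith

theorem neg_one_le_eigenvalue {v : Fin n → ℝ} {μ : ℝ} (hv : ∀ i, ∑ j, W i j * v j = μ * v i)
    (h0 : 0 < ∑ i, v i ^ 2) : -1 ≤ μ := by
  have h1 := h.sum_mul_sq_add 1 hv
  have h2 := h.sum_mul_sq_nonneg 1 v
  rw [h1] at h2
  have := nonneg_of_mul_nonneg_left h2 h0
  linarith

/-- A fixed vector of a mixing matrix is constant. -/
theorem eq_of_fixed {v : Fin n → ℝ} (hv : ∀ i, ∑ j, W i j * v j = 1 * v i) (i j : Fin n) :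
    v i = v j := by
  have h1 := h.sum_mul_sq_add (-1) hv
  norm_num at h1
  have h2 : ∀ i j, W i j * (v i + -v j) ^ 2 = 0 := by
    intro i j
    have hnn : ∀ i j, 0 ≤ W i j * (v i + -v j) ^ 2 :=
      fun i j => mul_nonneg (h.nonneg i j) (sq_nonneg _)
    have h3 := (Finset.sum_eq_zero_iff_of_nonneg
      fun i _ => Finset.sum_nonneg fun j _ => hnn i j).1 h1 i (Finset.mem_univ i)
    exact (Finset.sum_eq_zero_iff_of_nonneg fun j _ => hnn i j).1 h3 j (Finset.mem_univ j)
  have h3 : ∀ i j, G.Adj i j → v i = v j := by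
    intro i j hij
    have h4 := (h.link i j hij.ne).1 hij
    have h5 := (mul_eq_zero.1 (h2 i j)).resolve_left h4.ne'
    have := pow_eq_zero_iff (two_ne_zero) |>.1 h5
    linarith
  obtain ⟨w⟩ := h.connected.preconnected i j
  induction w with
  | nil => rfl
  | cons hadj _ ih => exact (h3 _ _ hadj).trans ih

theorem eigenvector_eq (j i : Fin n) : ∑ k, W i k * h.isHermitian.eigenvectorBasis j k
    = h.isHermitian.eigenvalues j * h.isHermitian.eigenvectorBasis j i := by
  have := congrFun (h.isHermitian.mulVec_eigenvectorBasis j) i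
  simpa [Matrix.mulVec, dotProduct] using this

theorem sum_eigenvector_mul (j j' : Fin n) : ∑ i, h.isHermitian.eigenvectorBasis j i
    * h.isHermitian.eigenvectorBasis j' i = if j = j' then 1 else 0 := by
  have := orthonormal_iff_ite.1 h.isHermitian.eigenvectorBasis.orthonormal j j'
  rw [← this, PiLp.inner_apply]
  exact Finset.sum_congr rfl fun i _ => by simp [mul_comm]

theorem sum_eigenvector_mul' (i i' : Fin n) : ∑ j, h.isHermitian.eigenvectorBasis j i
    * h.isHermitian.eigenvectorBasis j i' = if i = i' then 1 else 0 := by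
  have := h.isHermitian.eigenvectorBasis.sum_inner_mul_inner
    (EuclideanSpace.single i (1 : ℝ)) (EuclideanSpace.single i' (1 : ℝ))
  simpa [EuclideanSpace.inner_single_left, EuclideanSpace.inner_single_right, eq_comm] using this

theorem sum_eigenvector_sq_pos (j : Fin n) :
    0 < ∑ i, (h.isHermitian.eigenvectorBasis j i) ^ 2 := by
  have := h.sum_eigenvector_mul j j
  simp only [if_true, ← sq] at this
  rw [this]; exact one_pos

/-- Eigenvectors for the eigenvalue `1` are constant, and two nonzero constant vectors are not
orthogonal. -/
theorem eq_of_eigenvalues_eq_one {j j' : Fin n} (hj : h.isHermitian.eigenvalues j = 1)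
    (hj' : h.isHermitian.eigenvalues j' = 1) : j = j' := by
  by_contra hne
  have h1 := h.sum_eigenvector_mul j j'
  rw [if_neg hne] at h1
  have c1 := h.eq_of_fixed (v := h.isHermitian.eigenvectorBasis j)
    (fun i => by rw [h.eigenvector_eq, hj])
  have c2 := h.eq_of_fixed (v := h.isHermitian.eigenvectorBasis j')
    (fun i => by rw [h.eigenvector_eq, hj'])
  have s1 := h.sum_eigenvector_sq_pos j
  have s2 := h.sum_eigenvector_sq_pos j'
  simp only [c1 _ j, c2 _ j, Finset.sum_const, Finset.card_univ, Fintype.card_fin,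
    nsmul_eq_mul] at h1 s1 s2
  have hprod := mul_pos s1 s2
  have : (n : ℝ) * h.isHermitian.eigenvectorBasis j j ^ 2
      * (n * h.isHermitian.eigenvectorBasis j' j ^ 2)
      = (n * (h.isHermitian.eigenvectorBasis j j * h.isHermitian.eigenvectorBasis j' j)) ^ 2 := by
    ring
  rw [this, h1] at hprod
  norm_num at hprod

theorem eigenvalues_le_one (j : Fin n) : h.isHermitian.eigenvalues j ≤ 1 :=
  h.eigenvalue_le_one (h.eigenvector_eq j) (h.sum_eigenvector_sq_pos j)

theorem neg_one_le_eigenvalues (j : Fin n) : -1 ≤ h.isHermitian.eigenvalues j :=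
  h.neg_one_le_eigenvalue (h.eigenvector_eq j) (h.sum_eigenvector_sq_pos j)

omit h in
/-- The position of an index in the decreasing list of the eigenvalues. -/
noncomputable def position : Fin n ≃ Fin (Fintype.card (Fin n)) :=
  (Fintype.equivOfCardEq (Fintype.card_fin _)).symm

theorem eigenvalues_eq (j : Fin n) :
    h.isHermitian.eigenvalues j = h.isHermitian.eigenvalues₀ (position j) := rfl

/-- Locates the top two entries of the sorted list at distinct indices, so that simplicity of the
eigenvalue `1` yields `λ₂ < 1`. -/
theorem exists_eigenvalues_eq_second (hn : 2 ≤ n) : ∃ j₀ j₁ : Fin n, j₁ ≠ j₀ ∧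
    h.isHermitian.eigenvalues j₁ = secondEigenvalue W h.isHermitian hn ∧
    h.isHermitian.eigenvalues j₁ ≤ h.isHermitian.eigenvalues j₀ ∧
    ∀ j, j ≠ j₀ → h.isHermitian.eigenvalues j ≤ secondEigenvalue W h.isHermitian hn := by
  have hc : 2 ≤ Fintype.card (Fin n) := by rwa [Fintype.card_fin]
  refine ⟨position.symm ⟨0, by omega⟩, position.symm ⟨1, by omega⟩, ?_, ?_, ?_, ?_⟩
  · rw [Ne, Equiv.apply_eq_iff_eq]; simp
  · rw [h.eigenvalues_eq, Equiv.apply_symm_apply]; rfl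
  · rw [h.eigenvalues_eq, h.eigenvalues_eq, Equiv.apply_symm_apply, Equiv.apply_symm_apply]
    exact h.isHermitian.eigenvalues₀_antitone (by simp)
  · intro j hj
    rw [h.eigenvalues_eq]
    refine h.isHermitian.eigenvalues₀_antitone ?_
    rw [Fin.le_def]
    have : position j ≠ ⟨0, by omega⟩ := fun he => hj (by rw [← he, Equiv.symm_apply_apply])
    have h2 : (position j : ℕ) ≠ 0 := fun he => this (Fin.ext he)
    exact Nat.one_le_iff_ne_zero.2 h2

theorem secondEigenvalue_lt_one (hn : 2 ≤ n) : secondEigenvalue W h.isHermitian hn < 1 := by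
  obtain ⟨j₀, j₁, hne, h1, h2, -⟩ := h.exists_eigenvalues_eq_second hn
  rw [← h1]
  refine lt_of_le_of_ne (h.eigenvalues_le_one _) fun he => hne ?_
  exact h.eq_of_eigenvalues_eq_one he (le_antisymm (h.eigenvalues_le_one _) (by rwa [he] at h2))

theorem neg_one_le_secondEigenvalue (hn : 2 ≤ n) :
    -1 ≤ secondEigenvalue W h.isHermitian hn := by
  obtain ⟨j₀, j₁, hne, h1, -⟩ := h.exists_eigenvalues_eq_second hn
  rw [← h1]; exact h.neg_one_le_eigenvalues _

theorem nonempty_gapBasis (hn : 2 ≤ n) :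
    Nonempty (GapBasis W (1 - secondEigenvalue W h.isHermitian hn)) := by
  obtain ⟨j₀, j₁, hne, h1, h2, h3⟩ := h.exists_eigenvalues_eq_second hn
  have eig : ∀ j i', ∑ i, h.isHermitian.eigenvectorBasis j i * W i i'
      = h.isHermitian.eigenvalues j * h.isHermitian.eigenvectorBasis j i' := by
    intro j i'
    rw [← h.eigenvector_eq]
    exact Finset.sum_congr rfl fun k _ => by rw [h.comm k i', mul_comm]
  refine ⟨⟨fun j i => h.isHermitian.eigenvectorBasis j i, h.isHermitian.eigenvalues, j₀,
    h.sum_eigenvector_mul', eig, fun j hj => ?_, fun j hj => ?_, fun j => ?_⟩⟩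
  -- Summing the eigenvector equation over the coordinates gives `(1 - μ) ∑ v = 0`, and `μ ≤ λ₂ <
  -- 1`.
  · have k1 : ∑ i', ∑ i, h.isHermitian.eigenvectorBasis j i * W i i'
        = h.isHermitian.eigenvalues j * ∑ i', h.isHermitian.eigenvectorBasis j i' := by
      rw [Finset.mul_sum]; exact Finset.sum_congr rfl fun i' _ => eig j i'
    rw [Finset.sum_comm] at k1
    simp only [← Finset.mul_sum, h.stochastic, mul_one] at k1
    have k2 := (h3 j hj).trans_lt (h.secondEigenvalue_lt_one hn)
    have k3 : (1 - h.isHermitian.eigenvalues j)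
        * ∑ i, h.isHermitian.eigenvectorBasis j i = 0 := by linarith
    exact (mul_eq_zero.1 k3).resolve_left (by linarith)
  · linarith [h3 j hj]
  · linarith [h.neg_one_le_eigenvalues j]

end IsMixingMatrix

/-! ### The iterates of CEDAS along a sample path -/

namespace Cedas

variable {n p : ℕ} {S Z : Type*} [MeasurableSpace Z] (A : Cedas n p S Z) (η : ℝ)
  (s : ℕ → Fin n → S) (z : ℕ → Fin n → Z)

/-- The stochastic gradients along a sample path. -/
noncomputable def gradAt (t : ℕ) (i : Fin n) : Vec p := A.grad i (A.queryPoint η s z t i) (s t i)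

/-- The vectors `y_{i,k}` along a sample path. -/
noncomputable def yAt (k : ℕ) (i : Fin n) : Vec p :=
  A.queryPoint η s z (k + 1) i - η • A.gradAt η s z (k + 1) i - (A.state η s z k).d i

/-- The compression errors along a sample path. -/
noncomputable def errAt (k : ℕ) (i : Fin n) : Vec p :=
  A.compressor.toFun (A.yAt η s z k i - (A.state η s z k).h i) (z k i)
    - (A.yAt η s z k i - (A.state η s z k).h i)

/-- This invariant shows that the locally updated `ŷ_w` is `W ŷ`, so the dual step really applies `I
- W`. -/
theorem hw_eq (k : ℕ) (i : Fin n) :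
    (A.state η s z k).hw i = ∑ j, A.W i j • (A.state η s z k).h j := by
  induction k generalizing i with
  | zero => rfl
  | succ k ih =>
    simp only [state, step, ih, smul_add, Finset.sum_add_distrib, Finset.smul_sum, smul_smul]
    simp only [← Finset.sum_add_distrib, mul_comm]

theorem d_zero (i : Fin n) : (A.state η s z 0).d i = 0 := rfl

theorem d_succ (k : ℕ) (i : Fin n) : (A.state η s z (k + 1)).d i = (A.state η s z k).d i
    + (A.γ / 2) • ((A.yAt η s z k i + A.errAt η s z k i)
      - ∑ j, A.W i j • (A.yAt η s z k j + A.errAt η s z k j)) := by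
  have h : ∀ j, A.yAt η s z k j + A.errAt η s z k j = (A.state η s z k).h j
      + A.compressor.toFun (A.yAt η s z k j - (A.state η s z k).h j) (z k j) := by
    intro j; rw [errAt]; abel
  simp only [h, smul_add, Finset.sum_add_distrib, ← A.hw_eq η s z k i]
  simp only [state, step, yAt, gradAt, queryPoint, smul_sub, smul_add]

theorem queryPoint_succ (k : ℕ) (i : Fin n) : A.queryPoint η s z (k + 2) i
    = A.queryPoint η s z (k + 1) i - η • A.gradAt η s z (k + 1) i
      - (A.state η s z (k + 1)).d i := rfl

theorem h_succ (k : ℕ) (i : Fin n) : (A.state η s z (k + 1)).h i = (A.state η s z k).h i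
    + A.α • (A.yAt η s z k i - (A.state η s z k).h i + A.errAt η s z k i) := by
  have h : A.yAt η s z k i - (A.state η s z k).h i + A.errAt η s z k i
      = A.compressor.toFun (A.yAt η s z k i - (A.state η s z k).h i) (z k i) := by
    rw [errAt]; abel
  have e : (A.state η s z (k + 1)).h i = (1 - A.α) • (A.state η s z k).h i
    + A.α • ((A.state η s z k).h i
      + A.compressor.toFun (A.yAt η s z k i - (A.state η s z k).h i) (z k i)) := rfl
  rw [h, e]; module

theorem mean_d (hW : ∀ j, ∑ i, A.W i j = 1) (k : ℕ) : mean (A.state η s z k).d = 0 := by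
  induction k with
  | zero => simp [mean, d_zero]
  | succ k ih =>
    have e : (A.state η s z (k + 1)).d = (A.state η s z k).d
        + (A.γ / 2) • ((A.yAt η s z k + A.errAt η s z k)
          - fun i => ∑ j, A.W i j • (A.yAt η s z k + A.errAt η s z k) j) :=
      funext fun i => A.d_succ η s z k i
    rw [e, mean_add, ih, mean_smul, mean_sub_mul_eq_zero hW, smul_zero, add_zero]

/-- A pathwise identity: the mean of the next iterate involves the gradient samples of iteration `k`
but none of its compressor draws. -/
theorem mean_queryPoint_succ (hW : ∀ j, ∑ i, A.W i j = 1) (k : ℕ) :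
    mean (A.queryPoint η s z (k + 2))
      = mean (A.queryPoint η s z (k + 1)) - η • mean (A.gradAt η s z (k + 1)) := by
  have e : A.queryPoint η s z (k + 2) = A.queryPoint η s z (k + 1)
      - η • A.gradAt η s z (k + 1) - (A.state η s z (k + 1)).d :=
    funext fun i => A.queryPoint_succ η s z k i
  rw [e, mean_sub, mean_sub, mean_smul, A.mean_d η s z hW, sub_zero]

end Cedas

/-! ### Measurability of the iterates -/

section Measurability

variable {n p : ℕ} {Ω S Z : Type*} [MeasurableSpace S] [MeasurableSpace Z]
  (A : Cedas n p S Z) (η : ℝ) (ξ : ℕ → Fin n → Ω → S) (ζ : ℕ → Fin n → Ω → Z)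

theorem measurable_mean [MeasurableSpace Ω] {a : Fin n → Ω → Vec p} (h : ∀ i, Measurable (a i)) :
    Measurable fun ω => mean fun i => a i ω :=
  by unfold mean; fun_prop

section Adapted

variable [MeasurableSpace Ω]

theorem measurable_yAt {k : ℕ} (hgrad : ∀ i, Measurable (Function.uncurry (A.grad i)))
    (hq : ∀ i, Measurable fun ω => A.queryPoint η (path ξ ω) (path ζ ω) (k + 1) i)
    (hd : ∀ i, Measurable fun ω => (A.state η (path ξ ω) (path ζ ω) k).d i)
    (hξ : ∀ i, Measurable (ξ (k + 1) i)) (i : Fin n) :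
    Measurable fun ω => A.yAt η (path ξ ω) (path ζ ω) k i :=
  ((hq i).sub (((hgrad i).comp ((hq i).prodMk (hξ i))).const_smul η)).sub (hd i)

theorem measurable_errAt {k : ℕ}
    (hy : ∀ i, Measurable fun ω => A.yAt η (path ξ ω) (path ζ ω) k i)
    (hh : ∀ i, Measurable fun ω => (A.state η (path ξ ω) (path ζ ω) k).h i)
    (hζ : ∀ i, Measurable (ζ k i)) (i : Fin n) :
    Measurable fun ω => A.errAt η (path ξ ω) (path ζ ω) k i :=
  (A.compressor.measurable.comp (((hy i).sub (hh i)).prodMk (hζ i))).sub ((hy i).sub (hh i))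

/-- The variables at iteration `k` depend measurably on the samples before iteration `k` and the
compressor draws before it. -/
theorem measurable_state (hgrad : ∀ i, Measurable (Function.uncurry (A.grad i))) (k : ℕ)
    (hξ : ∀ t < k + 1, ∀ i, Measurable (ξ t i)) (hζ : ∀ l < k, ∀ i, Measurable (ζ l i)) :
    (∀ i, Measurable fun ω => A.queryPoint η (path ξ ω) (path ζ ω) (k + 1) i) ∧
    (∀ i, Measurable fun ω => (A.state η (path ξ ω) (path ζ ω) k).d i) ∧
    (∀ i, Measurable fun ω => (A.state η (path ξ ω) (path ζ ω) k).h i) := by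
  induction k with
  | zero =>
    refine ⟨fun i => ?_, fun i => measurable_const, fun i => measurable_const⟩
    exact measurable_const.sub
      (((hgrad i).comp (measurable_const.prodMk (hξ 0 (by omega) i))).const_smul η)
  | succ k ih =>
    obtain ⟨hq, hd, hh⟩ := ih (fun t ht => hξ t (by omega)) (fun l hl => hζ l (by omega))
    have hy := measurable_yAt A η ξ ζ hgrad hq hd (hξ (k + 1) (by omega))
    have he := measurable_errAt A η ξ ζ hy hh (hζ k (by omega))
    have hd' : ∀ i, Measurable fun ω => (A.state η (path ξ ω) (path ζ ω) (k + 1)).d i := by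
      intro i
      simp only [A.d_succ]
      fun_prop
    refine ⟨fun i => ?_, hd', fun i => ?_⟩
    · simp only [A.queryPoint_succ]
      exact ((hq i).sub (((hgrad i).comp ((hq i).prodMk
        (hξ (k + 1) (by omega) i))).const_smul η)).sub (hd' i)
    · simp only [A.h_succ]
      fun_prop

end Adapted

section History

theorem measurable_sample_history {a b t : ℕ} (h : t < a) (i : Fin n) :
    Measurable[history ξ ζ a b] (ξ t i) := by
  refine Measurable.mono (comap_measurable (ξ t i)) ?_ le_rfl
  exact le_sup_of_le_left (le_iSup_of_le t (le_iSup_of_le h (le_iSup_of_le i le_rfl)))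

theorem measurable_draw_history {a b k : ℕ} (h : k < b) (i : Fin n) :
    Measurable[history ξ ζ a b] (ζ k i) := by
  refine Measurable.mono (comap_measurable (ζ k i)) ?_ le_rfl
  exact le_sup_of_le_right (le_iSup_of_le k (le_iSup_of_le h (le_iSup_of_le i le_rfl)))

theorem history_le [m : MeasurableSpace Ω] (hξ : ∀ t i, Measurable (ξ t i))
    (hζ : ∀ k i, Measurable (ζ k i)) (a b : ℕ) : history ξ ζ a b ≤ m :=
  sup_le (iSup_le fun t => iSup_le fun _ => iSup_le fun i => (hξ t i).comap_le)
    (iSup_le fun k => iSup_le fun _ => iSup_le fun i => (hζ k i).comap_le)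

theorem beforeSample_le [m : MeasurableSpace Ω] (hξ : ∀ t i, Measurable (ξ t i))
    (hζ : ∀ k i, Measurable (ζ k i)) (t : ℕ) (i : Fin n) : beforeSample ξ ζ t i ≤ m :=
  sup_le (history_le ξ ζ hξ hζ _ _) (iSup_le fun j => iSup_le fun _ => (hξ t j).comap_le)

variable (hgrad : ∀ i, Measurable (Function.uncurry (A.grad i)))
include hgrad

/-- `measurable_state` leaves the `σ`-algebra on `Ω` free. Instantiating it at a history turns
measurability into adaptedness. -/
theorem measurable_state_history (k : ℕ) {a b : ℕ} (ha : k < a) (hb : k ≤ b) :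
    (∀ i, Measurable[history ξ ζ a b] fun ω =>
      A.queryPoint η (path ξ ω) (path ζ ω) (k + 1) i) ∧
    (∀ i, Measurable[history ξ ζ a b] fun ω => (A.state η (path ξ ω) (path ζ ω) k).d i) ∧
    (∀ i, Measurable[history ξ ζ a b] fun ω => (A.state η (path ξ ω) (path ζ ω) k).h i) :=
  @measurable_state n p Ω S Z _ _ A η ξ ζ (history ξ ζ a b) hgrad k
    (fun t ht i => measurable_sample_history ξ ζ (by omega) i)
    (fun l hl i => measurable_draw_history ξ ζ (by omega) i)

theorem measurable_yAt_history (k : ℕ) (i : Fin n) : Measurable[history ξ ζ (k + 2) k]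
    fun ω => A.yAt η (path ξ ω) (path ζ ω) k i := by
  obtain ⟨hq, hd, -⟩ := measurable_state_history A η ξ ζ hgrad k (a := k + 2) (b := k) (by omega) le_rfl
  exact @measurable_yAt n p Ω S Z _ _ A η ξ ζ (history ξ ζ (k + 2) k) k hgrad hq hd
    (fun i => measurable_sample_history ξ ζ (by omega) i) i

theorem measurable_queryPoint_beforeSample (t : ℕ) (i j : Fin n) :
    Measurable[beforeSample ξ ζ t i] fun ω => A.queryPoint η (path ξ ω) (path ζ ω) t j := by
  cases t with
  | zero => exact measurable_const
  | succ k =>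
    refine Measurable.mono ?_ (le_sup_left : history ξ ζ (k + 1) k ≤ _) le_rfl
    exact (measurable_state_history A η ξ ζ hgrad k (by omega) le_rfl).1 j

/-- Here the other agents' samples in `beforeSample` matter: they make the noises of distinct agents
orthogonal. -/
theorem measurable_gradAt_beforeSample (t : ℕ) {i j : Fin n} (hij : j ≠ i) :
    Measurable[beforeSample ξ ζ t i] fun ω => A.gradAt η (path ξ ω) (path ζ ω) t j := by
  have h1 : Measurable[beforeSample ξ ζ t i] (ξ t j) := by
    refine Measurable.mono (comap_measurable (ξ t j)) ?_ le_rfl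
    exact le_sup_of_le_right (le_iSup_of_le j (le_iSup_of_le hij le_rfl))
  exact (hgrad j).comp ((measurable_queryPoint_beforeSample A η ξ ζ hgrad t i j).prodMk h1)

end History

end Measurability

/-! ### Square integrable random vectors -/

section SquareIntegrable

variable {p : ℕ} {Ω : Type*} [MeasurableSpace Ω]

/-- The space of square integrable random vectors (as functions). -/
def squareIntegrable (p : ℕ) (P : Measure Ω) : Submodule ℝ (Ω → Vec p) where
  carrier := {f | MemLp f 2 P}
  add_mem' := fun ha hb => MemLp.add ha hb
  zero_mem' := MemLp.zero
  smul_mem' := fun c _ hf => MemLp.const_smul hf c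

/-- The class of a square integrable random vector. -/
noncomputable def toL2 (p : ℕ) (P : Measure Ω) : squareIntegrable p P →ₗ[ℝ] Lp (Vec p) 2 P where
  toFun f := MemLp.toLp f.1 f.2
  map_add' f g := MemLp.toLp_add f.2 g.2
  map_smul' c f := MemLp.toLp_const_smul c f.2

variable {P : Measure Ω}

theorem inner_toL2 (f g : squareIntegrable p P) :
    inner ℝ (toL2 p P f) (toL2 p P g) = ∫ ω, inner ℝ (f.1 ω) (g.1 ω) ∂P := by
  rw [L2.inner_def]
  refine integral_congr_ae ?_
  filter_upwards [MemLp.coeFn_toLp f.2, MemLp.coeFn_toLp g.2] with ω h1 h2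
  simp only [toL2, LinearMap.coe_mk, AddHom.coe_mk]
  rw [h1, h2]

theorem norm_toL2_sq (f : squareIntegrable p P) :
    ‖toL2 p P f‖ ^ 2 = ∫ ω, ‖f.1 ω‖ ^ 2 ∂P := by
  rw [← real_inner_self_eq_norm_sq, inner_toL2]
  simp only [real_inner_self_eq_norm_sq]

theorem integrable_inner_of_memLp {f g : Ω → Vec p} (hf : MemLp f 2 P) (hg : MemLp g 2 P) :
    Integrable (fun ω => inner ℝ (f ω) (g ω)) P := by
  have h := L2.integrable_inner (𝕜 := ℝ) (hf.toLp f) (hg.toLp g)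
  refine h.congr ?_
  filter_upwards [hf.coeFn_toLp, hg.coeFn_toLp] with ω h1 h2
  rw [h1, h2]

theorem integrable_norm_sq_of_memLp {f : Ω → Vec p} (hf : MemLp f 2 P) :
    Integrable (fun ω => ‖f ω‖ ^ 2) P :=
  (memLp_two_iff_integrable_sq_norm hf.1).1 hf

theorem norm_toL2_le_of_le {f g : squareIntegrable p P} {c : ℝ} (hc : 0 ≤ c)
    (h : ∀ ω, ‖f.1 ω‖ ≤ c * ‖g.1 ω‖) : ‖toL2 p P f‖ ≤ c * ‖toL2 p P g‖ := by
  refine le_of_sq_le_sq ?_ (by positivity)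
  rw [mul_pow, norm_toL2_sq, norm_toL2_sq, ← integral_const_mul]
  refine integral_mono (integrable_norm_sq_of_memLp f.2)
    ((integrable_norm_sq_of_memLp g.2).const_mul _) fun ω => ?_
  simp only
  rw [← mul_pow]
  exact pow_le_pow_left₀ (norm_nonneg _) (h ω) 2

theorem lintegral_enorm_sq_eq (f : squareIntegrable p P) :
    ∫⁻ ω, ‖f.1 ω‖ₑ ^ 2 ∂P = ENNReal.ofReal (‖toL2 p P f‖ ^ 2) := by
  rw [norm_toL2_sq, ofReal_integral_eq_lintegral_ofReal (integrable_norm_sq_of_memLp f.2)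
    (ae_of_all _ fun _ => sq_nonneg _)]
  refine lintegral_congr fun ω => ?_
  rw [ENNReal.ofReal_pow (norm_nonneg _), ofReal_norm]

end SquareIntegrable

/-! ### The corrected compressor is unbiased -/

section Compressor

variable {p : ℕ} {Z₁ Z₂ : Type*} [MeasurableSpace Z₁] [MeasurableSpace Z₂]

/-- The error of the corrected compressor is the error of `𝒞₂` on the residual `x - 𝒞₁(x)`.
Integrating over the draw of `𝒞₂` first gives mean zero and variance at most `C‖x - 𝒞₁(x)‖²`; the
draw of `𝒞₁` then contributes the factor `1 - δ`. -/
theorem RandomMap.corrected_isUnbiased {𝒞₁ : RandomMap p Z₁} {𝒞₂ : RandomMap p Z₂} {C δ : ℝ}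
    (h₁ : 𝒞₁.IsBiased δ) (h₂ : 𝒞₂.IsUnbiased C) (hδ : 0 < C * (1 - δ)) :
    (𝒞₁.corrected 𝒞₂).IsUnbiased (C * (1 - δ)) := by
  have := 𝒞₁.isProb
  have := 𝒞₂.isProb
  have hm := (𝒞₁.corrected 𝒞₂).measurable
  have hx : ∀ x, Measurable ((𝒞₁.corrected 𝒞₂).toFun x) := fun x =>
    hm.comp (measurable_const.prodMk measurable_id)
  have e : ∀ x z₁ z₂, (𝒞₁.corrected 𝒞₂).toFun x (z₁, z₂) - x
      = 𝒞₂.toFun (x - 𝒞₁.toFun x z₁) z₂ - (x - 𝒞₁.toFun x z₁) := by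
    intro x z₁ z₂
    simp only [RandomMap.corrected]; abel
  have hms : ∀ x, Measurable fun z => ‖(𝒞₁.corrected 𝒞₂).toFun x z - x‖ ^ 2 := fun x =>
    ((hx x).sub measurable_const).norm.pow_const 2
  have hsq : ∀ x, Integrable (fun z => ‖(𝒞₁.corrected 𝒞₂).toFun x z - x‖ ^ 2)
      (𝒞₁.law.prod 𝒞₂.law) := by
    intro x
    rw [integrable_prod_iff (hms x).aestronglyMeasurable]
    refine ⟨ae_of_all _ fun z₁ => ?_, ?_⟩
    · simp only [e]; exact h₂.integrable_sq _
    · refine ((h₁.integrable_sq x).const_mul C).mono'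
        ((hms x).norm.aestronglyMeasurable.integral_prod_right' (μ := 𝒞₁.law) (ν := 𝒞₂.law))
        (ae_of_all _ fun z₁ => ?_)
      have h3 := h₂.bound (x - 𝒞₁.toFun x z₁)
      simp only [e, norm_pow, norm_norm]
      rw [Real.norm_of_nonneg (integral_nonneg fun _ => sq_nonneg _), norm_sub_rev _ x]
      exact h3
  have hL2 : ∀ x, Integrable (fun z => (𝒞₁.corrected 𝒞₂).toFun x z - x)
      (𝒞₁.law.prod 𝒞₂.law) := fun x =>
    ((memLp_two_iff_integrable_sq_norm
      ((hx x).sub measurable_const).aestronglyMeasurable).2 (hsq x)).integrable one_le_two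
  have hint : ∀ x, Integrable ((𝒞₁.corrected 𝒞₂).toFun x) (𝒞₁.law.prod 𝒞₂.law) := by
    intro x
    have := (hL2 x).add (integrable_const x)
    refine this.congr (ae_of_all _ fun z => ?_)
    simp
  refine ⟨hδ, hint, fun x => ?_, hsq, fun x => ?_⟩
  · have h0 : ∫ z, ((𝒞₁.corrected 𝒞₂).toFun x z - x) ∂(𝒞₁.law.prod 𝒞₂.law) = 0 := by
      rw [integral_prod _ (hL2 x)]
      refine integral_eq_zero_of_ae (ae_of_all _ fun z₁ => ?_)
      simp only [e]
      rw [integral_sub (h₂.integrable _) (integrable_const _), h₂.mean]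
      simp
    rw [integral_sub (hint x) (integrable_const _)] at h0
    simp only [integral_const, probReal_univ, one_smul] at h0
    exact sub_eq_zero.1 h0
  · change ∫ z, _ ∂(𝒞₁.law.prod 𝒞₂.law) ≤ _
    rw [integral_prod _ (hsq x)]
    calc _ ≤ ∫ z₁, C * ‖𝒞₁.toFun x z₁ - x‖ ^ 2 ∂𝒞₁.law := by
          refine integral_mono (hsq x).integral_prod_left ((h₁.integrable_sq x).const_mul C)
            fun z₁ => ?_
          simp only [e]
          rw [norm_sub_rev _ x]
          exact h₂.bound _
      _ ≤ _ := by
          rw [integral_const_mul, mul_assoc]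
          exact mul_le_mul_of_nonneg_left (h₁.bound x) h₂.pos.le

end Compressor

/-! ### Fresh compressor draws -/

section Fresh

variable {p : ℕ} {Ω Z : Type*} {m : MeasurableSpace Ω} [m₀ : MeasurableSpace Ω]
  [MeasurableSpace Z] {P : Measure Ω} [IsProbabilityMeasure P] {𝒞 : RandomMap p Z} {κ : ℝ}
  {ζ : Ω → Z} {v : Ω → Vec p}

/-- Freshness in the form of a product law: by Fubini, expectations over the draw may be taken with
the past frozen. -/
theorem map_prodMk_eq_of_indep {β : Type*} [MeasurableSpace β] (hm : m ≤ m₀) (hζ : Measurable ζ)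
    (hlaw : P.map ζ = 𝒞.law) (hind : Indep (MeasurableSpace.comap ζ inferInstance) m P)
    {u : Ω → β} (hu : Measurable[m] u) :
    P.map (fun ω => (u ω, ζ ω)) = (P.map u).prod 𝒞.law := by
  have h : IndepFun u ζ P := by
    rw [IndepFun_iff_Indep]
    exact (indep_of_indep_of_le_right hind hu.comap_le).symm
  rw [← hlaw]
  exact (indepFun_iff_map_prod_eq_prod_map_map (hu.mono hm le_rfl).aemeasurable
    hζ.aemeasurable).1 h

/-- A lower integral is used because square integrability of the error is not yet available;
`memLp_compression_error` deduces it from this bound. -/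
theorem lintegral_compression_error_le (h𝒞 : 𝒞.IsUnbiased κ) (hm : m ≤ m₀) (hζ : Measurable ζ)
    (hlaw : P.map ζ = 𝒞.law) (hind : Indep (MeasurableSpace.comap ζ inferInstance) m P)
    (hv : Measurable[m] v) :
    ∫⁻ ω, ‖𝒞.toFun (v ω) (ζ ω) - v ω‖ₑ ^ 2 ∂P
      ≤ ∫⁻ ω, ENNReal.ofReal (κ * ‖v ω‖ ^ 2) ∂P := by
  have := 𝒞.isProb
  have hv' : Measurable v := hv.mono hm le_rfl
  have hF : Measurable fun q : Vec p × Z => ‖𝒞.toFun q.1 q.2 - q.1‖ₑ ^ 2 :=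
    ((𝒞.measurable.sub measurable_fst).enorm).pow_const 2
  have e1 : ∫⁻ ω, ‖𝒞.toFun (v ω) (ζ ω) - v ω‖ₑ ^ 2 ∂P
      = ∫⁻ q, ‖𝒞.toFun q.1 q.2 - q.1‖ₑ ^ 2 ∂(P.map fun ω => (v ω, ζ ω)) := by
    rw [lintegral_map hF (hv'.prodMk hζ)]
  rw [e1, map_prodMk_eq_of_indep hm hζ hlaw hind hv, lintegral_prod _ hF.aemeasurable]
  have hG : Measurable fun x : Vec p => ENNReal.ofReal (κ * ‖x‖ ^ 2) := by fun_prop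
  rw [← lintegral_map hG hv']
  refine lintegral_mono fun x => ?_
  have h2 : ∫⁻ z, ‖𝒞.toFun x z - x‖ₑ ^ 2 ∂𝒞.law
      = ENNReal.ofReal (∫ z, ‖𝒞.toFun x z - x‖ ^ 2 ∂𝒞.law) := by
    rw [ofReal_integral_eq_lintegral_ofReal (h𝒞.integrable_sq x)
      (ae_of_all _ fun _ => sq_nonneg _)]
    refine lintegral_congr fun z => ?_
    rw [ENNReal.ofReal_pow (norm_nonneg _), ofReal_norm]
  simp only
  rw [h2]
  exact ENNReal.ofReal_le_ofReal (h𝒞.bound x)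

theorem memLp_compression_error (h𝒞 : 𝒞.IsUnbiased κ) (hm : m ≤ m₀) (hζ : Measurable ζ)
    (hlaw : P.map ζ = 𝒞.law) (hind : Indep (MeasurableSpace.comap ζ inferInstance) m P)
    (hv : Measurable[m] v) (hv2 : MemLp v 2 P) :
    MemLp (fun ω => 𝒞.toFun (v ω) (ζ ω) - v ω) 2 P := by
  have hv' : Measurable v := hv.mono hm le_rfl
  have hme : Measurable fun ω => 𝒞.toFun (v ω) (ζ ω) - v ω :=
    (𝒞.measurable.comp (hv'.prodMk hζ)).sub hv'
  rw [memLp_two_iff_integrable_sq_norm hme.aestronglyMeasurable]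
  refine ⟨(hme.norm.pow_const 2).aestronglyMeasurable, ?_⟩
  have h1 := lintegral_compression_error_le h𝒞 hm hζ hlaw hind hv
  have h2 : ∫⁻ ω, ENNReal.ofReal (κ * ‖v ω‖ ^ 2) ∂P < ∞ :=
    ((integrable_norm_sq_of_memLp hv2).const_mul κ).lintegral_lt_top
  refine lt_of_le_of_lt (le_of_eq (lintegral_congr fun ω => ?_)) (h1.trans_lt h2)
  rw [enorm_pow, enorm_norm]

theorem integral_compression_error_le (h𝒞 : 𝒞.IsUnbiased κ) (hm : m ≤ m₀) (hζ : Measurable ζ)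
    (hlaw : P.map ζ = 𝒞.law) (hind : Indep (MeasurableSpace.comap ζ inferInstance) m P)
    (hv : Measurable[m] v) (hv2 : MemLp v 2 P) :
    ∫ ω, ‖𝒞.toFun (v ω) (ζ ω) - v ω‖ ^ 2 ∂P ≤ κ * ∫ ω, ‖v ω‖ ^ 2 ∂P := by
  have h0 := memLp_compression_error h𝒞 hm hζ hlaw hind hv hv2
  have h1 := lintegral_compression_error_le h𝒞 hm hζ hlaw hind hv
  have hκ := h𝒞.pos.le
  rw [← integral_const_mul]
  rw [← ENNReal.ofReal_le_ofReal_iff (integral_nonneg fun ω => by positivity),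
    ofReal_integral_eq_lintegral_ofReal (integrable_norm_sq_of_memLp h0)
      (ae_of_all _ fun _ => sq_nonneg _),
    ofReal_integral_eq_lintegral_ofReal ((integrable_norm_sq_of_memLp hv2).const_mul κ)
      (ae_of_all _ fun _ => by positivity)]
  refine le_trans (le_of_eq (lintegral_congr fun ω => ?_)) h1
  rw [ENNReal.ofReal_pow (norm_nonneg _), ofReal_norm]

/-- With the pair `(v, w)` frozen, the integral over the draw pairs a mean-zero error with a fixed
vector. -/
theorem integral_inner_compression_error (h𝒞 : 𝒞.IsUnbiased κ) (hm : m ≤ m₀) (hζ : Measurable ζ)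
    (hlaw : P.map ζ = 𝒞.law) (hind : Indep (MeasurableSpace.comap ζ inferInstance) m P)
    (hv : Measurable[m] v) (hv2 : MemLp v 2 P) {w : Ω → Vec p} (hw : Measurable[m] w)
    (hw2 : MemLp w 2 P) :
    ∫ ω, inner ℝ (𝒞.toFun (v ω) (ζ ω) - v ω) (w ω) ∂P = 0 := by
  have := 𝒞.isProb
  have h0 := integrable_inner_of_memLp (memLp_compression_error h𝒞 hm hζ hlaw hind hv hv2) hw2
  have hu : Measurable[m] fun ω => (v ω, w ω) := Measurable.prodMk hv hw
  have hu' : Measurable fun ω => (v ω, w ω) := hu.mono hm le_rfl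
  obtain ⟨F, hFd⟩ : ∃ F : (Vec p × Vec p) × Z → ℝ,
      F = fun q => inner ℝ (𝒞.toFun q.1.1 q.2 - q.1.1) q.1.2 := ⟨_, rfl⟩
  have hF : Measurable F := by
    rw [hFd]
    exact ((𝒞.measurable.comp (measurable_fst.fst.prodMk measurable_snd)).sub
      measurable_fst.fst).inner measurable_fst.snd
  have hmap := map_prodMk_eq_of_indep hm hζ hlaw hind hu
  have e1 : ∫ ω, inner ℝ (𝒞.toFun (v ω) (ζ ω) - v ω) (w ω) ∂P
      = ∫ q, F q ∂(P.map fun ω => ((v ω, w ω), ζ ω)) := by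
    rw [integral_map (hu'.prodMk hζ).aemeasurable hF.aestronglyMeasurable, hFd]
  have hFi : Integrable F (P.map fun ω => ((v ω, w ω), ζ ω)) := by
    rw [integrable_map_measure hF.aestronglyMeasurable (hu'.prodMk hζ).aemeasurable, hFd]
    exact h0
  rw [hmap] at e1 hFi
  rw [e1, integral_prod _ hFi]
  refine integral_eq_zero_of_ae (ae_of_all _ fun x => ?_)
  simp only [hFd, Pi.zero_apply]
  have h3 : Integrable (fun z => 𝒞.toFun x.1 z - x.1) 𝒞.law :=
    (h𝒞.integrable x.1).sub (integrable_const _)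
  simp only [real_inner_comm x.2]
  rw [integral_inner h3, integral_sub (h𝒞.integrable x.1) (integrable_const _), h𝒞.mean]
  simp

end Fresh

/-! ### Conditionally centered noise -/

section Noise

variable {p : ℕ} {Ω : Type*} {m : MeasurableSpace Ω} [m₀ : MeasurableSpace Ω] {P : Measure Ω}
  [IsProbabilityMeasure P]

/-- The `m`-measurable factor `w` is pulled out of the conditional expectation, which vanishes on `X
- M`. -/
theorem integral_inner_noise_eq_zero (hm : m ≤ m₀) {X M w : Ω → Vec p} (hX : Integrable X P)
    (hM : Integrable M P) (hMm : Measurable[m] M) (hmean : P[X | m] =ᵐ[P] M)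
    (hS : MemLp (fun ω => X ω - M ω) 2 P) (hw : Measurable[m] w) (hw2 : MemLp w 2 P) :
    ∫ ω, inner ℝ (X ω - M ω) (w ω) ∂P = 0 := by
  have h1 : P[fun ω => X ω - M ω | m] =ᵐ[P] 0 := by
    have h2 : P[X - M | m] =ᵐ[P] P[X | m] - P[M | m] := condExp_sub hX hM m
    have h3 : P[M | m] = M := condExp_of_stronglyMeasurable hm hMm.stronglyMeasurable hM
    rw [h3] at h2
    change P[X - M | m] =ᵐ[P] 0
    filter_upwards [h2, hmean] with ω k1 k2
    rw [k1, Pi.sub_apply, k2, sub_self]; rfl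
  have h2 := condExp_bilin_of_stronglyMeasurable_right (innerSL ℝ) (m := m)
    (f := fun ω => X ω - M ω) (g := w) (μ := P) hw.stronglyMeasurable
    (integrable_inner_of_memLp hS hw2) (hX.sub hM)
  have h3 : ∫ ω, inner ℝ (X ω - M ω) (w ω) ∂P
      = ∫ ω, (P[fun ω => innerSL ℝ (X ω - M ω) (w ω) | m]) ω ∂P :=
    (integral_condExp hm).symm
  rw [h3, integral_congr_ae h2]
  refine integral_eq_zero_of_ae ?_
  filter_upwards [h1] with ω k1
  rw [k1]; simp

theorem integral_sq_le_of_condExp_le (hm : m ≤ m₀) {X : Ω → ℝ} {c : ℝ}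
    (h : P[X | m] ≤ᵐ[P] fun _ => c) : ∫ ω, X ω ∂P ≤ c := by
  rw [← integral_condExp hm]
  refine (integral_mono_ae integrable_condExp (integrable_const c) h).trans ?_
  simp

end Noise

/-! ### Smooth functions -/

section Smooth

variable {p : ℕ} {f : Vec p → ℝ} {L : ℝ}

/-- First-order expansion of a function with Lipschitz gradient. -/
theorem abs_sub_sub_inner_gradient_le (hL : 0 ≤ L) (hd : Differentiable ℝ f)
    (hlip : ∀ x y, ‖gradient f x - gradient f y‖ ≤ L * ‖x - y‖) (x y : Vec p) :
    |f y - f x - inner ℝ (gradient f x) (y - x)| ≤ L * ‖y - x‖ ^ 2 := by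
  -- The mean value inequality on the segment yields the constant `L` instead of the sharp `L/2`;
  -- the field `F_step` asks for no more.
  have h := Convex.norm_image_sub_le_of_norm_hasFDerivWithin_le' (𝕜 := ℝ) (f := f)
    (f' := fun z => fderiv ℝ f z) (φ := fderiv ℝ f x) (C := L * ‖y - x‖) (s := segment ℝ x y)
    (x := x) (y := y) (fun z _ => (hd z).hasFDerivAt.hasFDerivWithinAt)
    (fun z hz => by
      rw [← toDual_gradient, ← toDual_gradient, ← map_sub, LinearIsometryEquiv.norm_map]
      refine (hlip z x).trans (mul_le_mul_of_nonneg_left ?_ hL)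
      obtain ⟨a, b, ha, hb, hab, rfl⟩ := hz
      have e : a • x + b • y - x = b • (y - x) := by
        have : a = 1 - b := by linarith
        rw [this]; module
      rw [e, norm_smul, Real.norm_of_nonneg hb]
      exact mul_le_of_le_one_left (norm_nonneg _) (by linarith))
    (convex_segment x y) (left_mem_segment ℝ x y) (right_mem_segment ℝ x y)
  rw [Real.norm_eq_abs, ← inner_gradient_left] at h
  rw [sq, ← mul_assoc]; exact h

theorem continuous_gradient (hlip : ∀ x y, ‖gradient f x - gradient f y‖ ≤ L * ‖x - y‖) :
    Continuous (gradient f) := by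
  have : LipschitzWith L.toNNReal (gradient f) := by
    refine LipschitzWith.of_dist_le_mul fun x y => ?_
    rw [dist_eq_norm, dist_eq_norm]
    exact (hlip x y).trans (mul_le_mul_of_nonneg_right (Real.le_coe_toNNReal L) (norm_nonneg _))
  exact this.continuous

variable {Ω : Type*} [MeasurableSpace Ω] {P : Measure Ω} [IsProbabilityMeasure P]
  {x : Ω → Vec p}

theorem memLp_gradient (hlip : ∀ x y, ‖gradient f x - gradient f y‖ ≤ L * ‖x - y‖)
    (hx : MemLp x 2 P) : MemLp (fun ω => gradient f (x ω)) 2 P := by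
  have h0 : MemLp (fun _ : Ω => ‖gradient f 0‖) 2 P := memLp_const _
  have h0' : MemLp (fun ω => L * ‖x ω‖) 2 P := hx.norm.const_mul L
  have h1 : MemLp (fun ω => ‖gradient f 0‖ + L * ‖x ω‖) 2 P := h0.add h0'
  refine h1.mono' ((continuous_gradient hlip).comp_aestronglyMeasurable hx.1)
    (ae_of_all _ fun ω => ?_)
  have h2 := hlip (x ω) 0
  rw [sub_zero] at h2
  have h3 := norm_add_le (gradient f (x ω) - gradient f 0) (gradient f 0)
  rw [sub_add_cancel] at h3
  linarith

theorem integrable_comp_of_memLp (hL : 0 ≤ L) (hd : Differentiable ℝ f)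
    (hlip : ∀ x y, ‖gradient f x - gradient f y‖ ≤ L * ‖x - y‖)
    (hx : MemLp x 2 P) : Integrable (fun ω => f (x ω)) P := by
  have h1 : Integrable (fun ω => |f 0| + ‖gradient f 0‖ * ‖x ω‖ + L * ‖x ω‖ ^ 2) P :=
    ((integrable_const _).add ((hx.integrable one_le_two).norm.const_mul _)).add
      ((integrable_norm_sq_of_memLp hx).const_mul L)
  refine h1.mono' (hd.continuous.comp_aestronglyMeasurable hx.1) (ae_of_all _ fun ω => ?_)
  have h2 := abs_sub_sub_inner_gradient_le hL hd hlip 0 (x ω)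
  rw [sub_zero] at h2
  have h3 := abs_real_inner_le_norm (gradient f 0) (x ω)
  rw [Real.norm_eq_abs]
  have e : f (x ω) = (f (x ω) - f 0 - inner ℝ (gradient f 0) (x ω)) + f 0
    + inner ℝ (gradient f 0) (x ω) := by ring
  rw [e]
  refine (abs_add_three _ _ _).trans ?_
  linarith

/-- The descent inequality in expectation. -/
theorem integral_le_add_inner (hL : 0 ≤ L) (hd : Differentiable ℝ f)
    (hlip : ∀ x y, ‖gradient f x - gradient f y‖ ≤ L * ‖x - y‖) {y : Ω → Vec p}
    (hx : MemLp x 2 P) (hy : MemLp y 2 P) :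
    ∫ ω, f (y ω) ∂P ≤ ∫ ω, f (x ω) ∂P + ∫ ω, inner ℝ (gradient f (x ω)) (y ω - x ω) ∂P
      + L * ∫ ω, ‖y ω - x ω‖ ^ 2 ∂P := by
  have h1 := integrable_comp_of_memLp hL hd hlip hx
  have h2 := integrable_comp_of_memLp hL hd hlip hy
  have h3 : Integrable (fun ω => inner ℝ (gradient f (x ω)) (y ω - x ω)) P :=
    integrable_inner_of_memLp (memLp_gradient hlip hx) (hy.sub hx)
  have h4 : Integrable (fun ω => L * ‖y ω - x ω‖ ^ 2) P :=
    (integrable_norm_sq_of_memLp (hy.sub hx)).const_mul L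
  rw [← integral_const_mul, ← integral_add h1 h3]
  have h5 := (h1.add h3).add h4
  have := integral_mono h2 h5 fun ω => by
    have := (abs_le.1 (abs_sub_sub_inner_gradient_le hL hd hlip (x ω) (y ω))).2
    simp only [Pi.add_apply]
    linarith
  refine this.trans (le_of_eq ?_)
  exact integral_add (h1.add h3) h4

end Smooth

/-! ### The averaged objective. -/

section Average

variable {n p : ℕ} {f : Fin n → Vec p → ℝ} {L : ℝ} {fLow : Fin n → ℝ}

theorem IsSmoothBelow.gradient_avgFun (hf : IsSmoothBelow f L fLow) (x : Vec p) :
    gradient (avgFun f) x = mean fun i => gradient (f i) x := by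
  refine HasGradientAt.gradient ?_
  rw [hasGradientAt_iff_hasFDerivAt]
  have h : HasFDerivAt (fun x => (n : ℝ)⁻¹ * ∑ i, f i x)
      ((n : ℝ)⁻¹ • ∑ i, fderiv ℝ (f i) x) x :=
    (HasFDerivAt.fun_sum fun i _ => (hf.differentiable i x).hasFDerivAt).const_mul _
  have e : (InnerProductSpace.toDual ℝ (Vec p)) (mean fun i => gradient (f i) x)
      = (n : ℝ)⁻¹ • ∑ i, fderiv ℝ (f i) x := by
    simp only [mean, ← toDual_gradient]
    rw [map_smulₛₗ, map_sum]; rfl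
  rw [e]; exact h

theorem IsSmoothBelow.differentiable_avgFun (hf : IsSmoothBelow f L fLow) :
    Differentiable ℝ (avgFun f) := by
  unfold avgFun
  have := hf.differentiable
  fun_prop

theorem IsSmoothBelow.lipschitz_avgFun (hf : IsSmoothBelow f L fLow) (hn : 0 < n) (x y : Vec p) :
    ‖gradient (avgFun f) x - gradient (avgFun f) y‖ ≤ L * ‖x - y‖ := by
  have hn' : (0 : ℝ) < n := by exact_mod_cast hn
  rw [hf.gradient_avgFun, hf.gradient_avgFun, ← mean_sub, mean, norm_smul, norm_inv,
    Real.norm_of_nonneg hn'.le, inv_mul_le_iff₀ hn']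
  refine (norm_sum_le _ _).trans ?_
  calc _ ≤ ∑ _i : Fin n, L * ‖x - y‖ := Finset.sum_le_sum fun i _ => hf.lipschitz i x y
    _ = _ := by simp

theorem IsSmoothBelow.le_avgFun (hf : IsSmoothBelow f L fLow) (x : Vec p) :
    (n : ℝ)⁻¹ * ∑ i, fLow i ≤ avgFun f x :=
  mul_le_mul_of_nonneg_left (Finset.sum_le_sum fun i _ => hf.below i x) (by positivity)

end Average

/-! ### A run of CEDAS in the space of square integrable random vectors -/

section

variable {n p : ℕ} {Ω : Type*} [MeasurableSpace Ω] {P : Measure Ω}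

/-- The average of square integrable random vectors. -/
noncomputable def averageVec (a : Fin n → squareIntegrable p P) : squareIntegrable p P :=
  (n : ℝ)⁻¹ • ∑ i, a i

theorem mean_toL2 (a : Fin n → squareIntegrable p P) :
    mean (fun i => toL2 p P (a i)) = toL2 p P (averageVec a) := by
  simp only [mean, averageVec, map_smul, map_sum]

theorem averageVec_apply (a : Fin n → squareIntegrable p P) (ω : Ω) :
    (averageVec a).1 ω = mean fun i => (a i).1 ω := by
  simp [averageVec, mean, Finset.sum_apply]

end

/-- What is assumed on a run of CEDAS with stepsize `η` and a compressor in `𝕌(κ)`. -/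
structure CedasSetting {n p : ℕ} {Ω S Z : Type*} [MeasurableSpace Ω] [MeasurableSpace S]
    [MeasurableSpace Z] (P : Measure Ω) (A : Cedas n p S Z) (f : Fin n → Vec p → ℝ)
    (fLow : Fin n → ℝ) (L σ κ η : ℝ) (ξ : ℕ → Fin n → Ω → S) (ζ : ℕ → Fin n → Ω → Z) :
    Prop where
  n_pos : 0 < n
  L_nonneg : 0 ≤ L
  prob : IsProbabilityMeasure P
  sum_col : ∀ j, ∑ i, A.W i j = 1
  smooth : IsSmoothBelow f L fLow
  unbiased : A.compressor.IsUnbiased κ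
  measurable_grad : ∀ i, Measurable (Function.uncurry (A.grad i))
  measurable_sample : ∀ t i, Measurable (ξ t i)
  measurable_draw : ∀ k i, Measurable (ζ k i)
  sampling : IsUnbiasedSampling P A f σ η ξ ζ
  fresh : IsFreshCompression P A ξ ζ

namespace CedasSetting

variable {n p : ℕ} {Ω S Z : Type*} [MeasurableSpace Ω] [MeasurableSpace S]
    [MeasurableSpace Z] {P : Measure Ω} {A : Cedas n p S Z} {f : Fin n → Vec p → ℝ}
    {fLow : Fin n → ℝ} {L σ κ η : ℝ} {ξ : ℕ → Fin n → Ω → S} {ζ : ℕ → Fin n → Ω → Z}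
    (H : CedasSetting P A f fLow L σ κ η ξ ζ)
include H

theorem history_le' (a b : ℕ) : history ξ ζ a b ≤ ‹MeasurableSpace Ω› :=
  history_le ξ ζ H.measurable_sample H.measurable_draw a b

theorem beforeSample_le' (t : ℕ) (i : Fin n) : beforeSample ξ ζ t i ≤ ‹MeasurableSpace Ω› :=
  beforeSample_le ξ ζ H.measurable_sample H.measurable_draw t i

theorem measurable_queryPoint (t : ℕ) (i : Fin n) :
    Measurable fun ω => A.queryPoint η (path ξ ω) (path ζ ω) t i :=
  (measurable_queryPoint_beforeSample A η ξ ζ H.measurable_grad t i i).mono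
    (H.beforeSample_le' t i) le_rfl

theorem measurable_gradAt (t : ℕ) (i : Fin n) :
    Measurable fun ω => A.gradAt η (path ξ ω) (path ζ ω) t i :=
  (H.measurable_grad i).comp ((H.measurable_queryPoint t i).prodMk (H.measurable_sample t i))

theorem continuous_gradient' (i : Fin n) : Continuous (gradient (f i)) :=
  continuous_gradient (H.smooth.lipschitz i)

theorem memLp_noise (t : ℕ) (i : Fin n) :
    MemLp (fun ω => A.gradAt η (path ξ ω) (path ζ ω) t i
      - gradient (f i) (A.queryPoint η (path ξ ω) (path ζ ω) t i)) 2 P := by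
  rw [memLp_two_iff_integrable_sq_norm]
  · exact H.sampling.integrable_sq t i
  · exact ((H.measurable_gradAt t i).sub ((H.continuous_gradient' i).measurable.comp
      (H.measurable_queryPoint t i))).aestronglyMeasurable

theorem memLp_gradAt {t : ℕ} {i : Fin n}
    (hq : MemLp (fun ω => A.queryPoint η (path ξ ω) (path ζ ω) t i) 2 P) :
    MemLp (fun ω => A.gradAt η (path ξ ω) (path ζ ω) t i) 2 P := by
  have := H.prob
  have h := (H.memLp_noise t i).add (memLp_gradient (H.smooth.lipschitz i) hq)
  refine h.ae_eq (ae_of_all _ fun ω => ?_)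
  simp

theorem measurable_target (k : ℕ) (i : Fin n) : Measurable[history ξ ζ (k + 2) k]
    fun ω => A.yAt η (path ξ ω) (path ζ ω) k i - (A.state η (path ξ ω) (path ζ ω) k).h i :=
  (measurable_yAt_history A η ξ ζ H.measurable_grad k i).sub
    ((measurable_state_history A η ξ ζ H.measurable_grad k (by omega) le_rfl).2.2 i)

theorem memLp_state (k : ℕ) :
    (∀ i, MemLp (fun ω => A.queryPoint η (path ξ ω) (path ζ ω) (k + 1) i) 2 P) ∧
    (∀ i, MemLp (fun ω => (A.state η (path ξ ω) (path ζ ω) k).d i) 2 P) ∧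
    (∀ i, MemLp (fun ω => (A.state η (path ξ ω) (path ζ ω) k).h i) 2 P) := by
  have := H.prob
  induction k with
  | zero =>
    have h0 : ∀ i, MemLp (fun ω => A.queryPoint η (path ξ ω) (path ζ ω) 0 i) 2 P :=
      fun i => memLp_const _
    exact ⟨fun i => (h0 i).sub ((H.memLp_gradAt (h0 i)).const_smul η),
      fun i => memLp_const _, fun i => memLp_const _⟩
  | succ k ih =>
    obtain ⟨hq, hd, hh⟩ := ih
    have hy : ∀ i, MemLp (fun ω => A.yAt η (path ξ ω) (path ζ ω) k i) 2 P := fun i =>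
      ((hq i).sub ((H.memLp_gradAt (hq i)).const_smul η)).sub (hd i)
    have he : ∀ i, MemLp (fun ω => A.errAt η (path ξ ω) (path ζ ω) k i) 2 P := fun i =>
      memLp_compression_error H.unbiased (H.history_le' (k + 2) k) (H.measurable_draw k i)
        (H.fresh.law k i) (H.fresh.indep k i) (H.measurable_target k i) ((hy i).sub (hh i))
    have hye := fun i => (hy i).add (he i)
    have hd' : ∀ i, MemLp (fun ω => (A.state η (path ξ ω) (path ζ ω) (k + 1)).d i) 2 P := by
      intro i
      simp only [A.d_succ]
      exact (hd i).add (((hye i).sub (memLp_finsetSum Finset.univ fun j _ =>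
        (hye j).const_smul (A.W i j))).const_smul (A.γ / 2))
    refine ⟨fun i => ?_, hd', fun i => ?_⟩
    · simp only [A.queryPoint_succ]
      exact ((hq i).sub ((H.memLp_gradAt (hq i)).const_smul η)).sub (hd' i)
    · simp only [A.h_succ]
      exact (hh i).add ((((hy i).sub (hh i)).add (he i)).const_smul A.α)

theorem memLp_queryPoint (t : ℕ) (i : Fin n) :
    MemLp (fun ω => A.queryPoint η (path ξ ω) (path ζ ω) t i) 2 P := by
  have := H.prob
  cases t with
  | zero => exact memLp_const _
  | succ k => exact (H.memLp_state k).1 i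

theorem memLp_mean_queryPoint (t : ℕ) :
    MemLp (fun ω => mean (A.queryPoint η (path ξ ω) (path ζ ω) t)) 2 P :=
  (memLp_finsetSum Finset.univ fun i _ => H.memLp_queryPoint t i).const_smul (n : ℝ)⁻¹

theorem memLp_yAt (k : ℕ) (i : Fin n) :
    MemLp (fun ω => A.yAt η (path ξ ω) (path ζ ω) k i) 2 P :=
  ((H.memLp_queryPoint (k + 1) i).sub
    ((H.memLp_gradAt (H.memLp_queryPoint (k + 1) i)).const_smul η)).sub ((H.memLp_state k).2.1 i)

theorem memLp_target (k : ℕ) (i : Fin n) :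
    MemLp (fun ω => A.yAt η (path ξ ω) (path ζ ω) k i
      - (A.state η (path ξ ω) (path ζ ω) k).h i) 2 P :=
  (H.memLp_yAt k i).sub ((H.memLp_state k).2.2 i)

theorem memLp_errAt (k : ℕ) (i : Fin n) :
    MemLp (fun ω => A.errAt η (path ξ ω) (path ζ ω) k i) 2 P :=
  have := H.prob
  memLp_compression_error H.unbiased (H.history_le' (k + 2) k) (H.measurable_draw k i)
    (H.fresh.law k i) (H.fresh.indep k i) (H.measurable_target k i) (H.memLp_target k i)

/-- The query points. -/
noncomputable def qv (t : ℕ) (i : Fin n) : squareIntegrable p P :=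
  ⟨fun ω => A.queryPoint η (path ξ ω) (path ζ ω) t i, H.memLp_queryPoint t i⟩

/-- The gradients at the query points. -/
noncomputable def Mv (t : ℕ) (i : Fin n) : squareIntegrable p P :=
  ⟨fun ω => gradient (f i) (A.queryPoint η (path ξ ω) (path ζ ω) t i),
    have := H.prob
    memLp_gradient (H.smooth.lipschitz i) (H.memLp_queryPoint t i)⟩

/-- The gradients at the average query point. -/
noncomputable def Φv (t : ℕ) (i : Fin n) : squareIntegrable p P :=
  ⟨fun ω => gradient (f i) (mean (A.queryPoint η (path ξ ω) (path ζ ω) t)),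
    have := H.prob
    memLp_gradient (H.smooth.lipschitz i) (H.memLp_mean_queryPoint t)⟩

/-- The gradient noise. -/
noncomputable def Sv (t : ℕ) (i : Fin n) : squareIntegrable p P := ⟨_, H.memLp_noise t i⟩

/-- The dual variables. -/
noncomputable def dv (k : ℕ) (i : Fin n) : squareIntegrable p P := ⟨_, (H.memLp_state k).2.1 i⟩

/-- The compression references. -/
noncomputable def hv (k : ℕ) (i : Fin n) : squareIntegrable p P := ⟨_, (H.memLp_state k).2.2 i⟩

/-- The compression targets. -/
noncomputable def yv (k : ℕ) (i : Fin n) : squareIntegrable p P := ⟨_, H.memLp_yAt k i⟩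

/-- The compression errors. -/
noncomputable def ev (k : ℕ) (i : Fin n) : squareIntegrable p P := ⟨_, H.memLp_errAt k i⟩

/-- This and the following identities are checked pathwise on functions; the linear map `toL2` then
carries them to `L²`. -/
theorem qv_one (i : Fin n) : H.qv 1 i = H.qv 0 i - η • (H.Mv 0 i + H.Sv 0 i) := by
  refine Subtype.ext (funext fun ω => ?_)
  change A.queryPoint η (path ξ ω) (path ζ ω) 1 i = A.queryPoint η (path ξ ω) (path ζ ω) 0 i
    - η • (gradient (f i) (A.queryPoint η (path ξ ω) (path ζ ω) 0 i)
      + (A.gradAt η (path ξ ω) (path ζ ω) 0 i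
        - gradient (f i) (A.queryPoint η (path ξ ω) (path ζ ω) 0 i)))
  rw [add_sub_cancel]; rfl

theorem yv_eq (k : ℕ) (i : Fin n) : H.yv k i
    = H.qv (k + 1) i - η • (H.Mv (k + 1) i + H.Sv (k + 1) i) - H.dv k i := by
  refine Subtype.ext (funext fun ω => ?_)
  change _ = A.queryPoint η (path ξ ω) (path ζ ω) (k + 1) i
    - η • (gradient (f i) (A.queryPoint η (path ξ ω) (path ζ ω) (k + 1) i)
      + (A.gradAt η (path ξ ω) (path ζ ω) (k + 1) i
        - gradient (f i) (A.queryPoint η (path ξ ω) (path ζ ω) (k + 1) i)))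
    - (A.state η (path ξ ω) (path ζ ω) k).d i
  rw [add_sub_cancel]; rfl

theorem qv_succ (k : ℕ) (i : Fin n) : H.qv (k + 2) i
    = H.qv (k + 1) i - η • (H.Mv (k + 1) i + H.Sv (k + 1) i) - H.dv (k + 1) i := by
  refine Subtype.ext (funext fun ω => ?_)
  change _ = A.queryPoint η (path ξ ω) (path ζ ω) (k + 1) i
    - η • (gradient (f i) (A.queryPoint η (path ξ ω) (path ζ ω) (k + 1) i)
      + (A.gradAt η (path ξ ω) (path ζ ω) (k + 1) i
        - gradient (f i) (A.queryPoint η (path ξ ω) (path ζ ω) (k + 1) i)))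
    - (A.state η (path ξ ω) (path ζ ω) (k + 1)).d i
  rw [add_sub_cancel]; rfl

theorem dv_succ (k : ℕ) (i : Fin n) : H.dv (k + 1) i = H.dv k i
    + (A.γ / 2) • ((H.yv k i + H.ev k i) - ∑ j, A.W i j • (H.yv k j + H.ev k j)) := by
  refine Subtype.ext (funext fun ω => ?_)
  simp only [Submodule.coe_add, Submodule.coe_smul, Submodule.coe_sub, Submodule.coe_sum,
    Pi.add_apply, Pi.smul_apply, Pi.sub_apply, Finset.sum_apply]
  exact A.d_succ η (path ξ ω) (path ζ ω) k i

theorem hv_succ (k : ℕ) (i : Fin n) : H.hv (k + 1) i = H.hv k i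
    + A.α • (H.yv k i - H.hv k i + H.ev k i) :=
  Subtype.ext (funext fun ω => A.h_succ η (path ξ ω) (path ζ ω) k i)

theorem inner_Sv (t : ℕ) (i : Fin n) (w : squareIntegrable p P)
    (hw : Measurable[beforeSample ξ ζ t i] w.1) :
    inner ℝ (toL2 p P (H.Sv t i)) (toL2 p P w) = 0 := by
  have := H.prob
  rw [inner_toL2]
  exact integral_inner_noise_eq_zero (H.beforeSample_le' t i) (H.sampling.integrable t i)
    (MemLp.integrable one_le_two (H.Mv t i).2)
    ((H.continuous_gradient' i).measurable.comp
      (measurable_queryPoint_beforeSample A η ξ ζ H.measurable_grad t i i))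
    (H.sampling.mean t i) (H.memLp_noise t i) hw w.2

/-- The bound `k + 2` admits the gradient samples of iteration `k`, which carry index `k + 1`, while
only draws of earlier iterations are allowed. -/
theorem inner_ev (k : ℕ) (i : Fin n) (w : squareIntegrable p P)
    (hw : Measurable[history ξ ζ (k + 2) k] w.1) :
    inner ℝ (toL2 p P (H.ev k i)) (toL2 p P w) = 0 := by
  have := H.prob
  rw [inner_toL2]
  exact integral_inner_compression_error H.unbiased (H.history_le' (k + 2) k)
    (H.measurable_draw k i) (H.fresh.law k i) (H.fresh.indep k i) (H.measurable_target k i)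
    (H.memLp_target k i) hw w.2

omit H in
theorem measurable_mean_of {m : MeasurableSpace Ω} {a : Ω → Fin n → Vec p}
    (h : ∀ i, Measurable[m] fun ω => a ω i) : Measurable[m] fun ω => mean (a ω) :=
  @measurable_mean n p Ω m (fun i ω => a ω i) h

/-- By `mean_queryPoint_succ` the next mean iterate is known before the draws of iteration `k`. This
yields the field `e_Φ_succ`. -/
theorem measurable_mean_queryPoint_succ (k : ℕ) : Measurable[history ξ ζ (k + 2) k]
    fun ω => mean (A.queryPoint η (path ξ ω) (path ζ ω) (k + 2)) := by
  simp only [A.mean_queryPoint_succ _ _ _ H.sum_col]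
  have hq := (measurable_state_history A η ξ ζ H.measurable_grad k
    (a := k + 2) (b := k) (by omega) le_rfl).1
  refine Measurable.sub (measurable_mean_of hq) (Measurable.const_smul (measurable_mean_of
    fun i => ?_) η)
  exact (H.measurable_grad i).comp
    ((hq i).prodMk (measurable_sample_history ξ ζ (by omega) i))

theorem average_qv_apply (t : ℕ) (ω : Ω) :
    (averageVec (H.qv t)).1 ω = mean (A.queryPoint η (path ξ ω) (path ζ ω) t) :=
  averageVec_apply _ _

theorem average_Φv_apply (t : ℕ) (ω : Ω) : (averageVec (H.Φv t)).1 ω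
    = gradient (avgFun f) (mean (A.queryPoint η (path ξ ω) (path ζ ω) t)) := by
  rw [averageVec_apply, H.smooth.gradient_avgFun]; rfl

/-- The run of CEDAS as a compressed primal-dual recursion in `L²`. -/
noncomputable def run : CompressedRun (Lp (Vec p) 2 P) A.W L σ κ A.α A.γ η where
  q t i := toL2 p P (H.qv t i)
  M t i := toL2 p P (H.Mv t i)
  Φ t i := toL2 p P (H.Φv t i)
  S t i := toL2 p P (H.Sv t i)
  d k i := toL2 p P (H.dv k i)
  h k i := toL2 p P (H.hv k i)
  y k i := toL2 p P (H.yv k i)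
  e k i := toL2 p P (H.ev k i)
  F t := ∫ ω, avgFun f (mean (A.queryPoint η (path ξ ω) (path ζ ω) t)) ∂P
  d_zero := by
    funext i
    have : H.dv 0 i = 0 := rfl
    rw [this, map_zero]; rfl
  q_one := by
    funext i
    simp only [H.qv_one, map_sub, map_smul, map_add]; rfl
  y_eq k := by
    funext i
    simp only [H.yv_eq, map_sub, map_smul, map_add]; rfl
  d_succ k := by
    funext i
    simp only [H.dv_succ, map_sub, map_smul, map_add, map_sum]; rfl
  q_succ k := by
    funext i
    simp only [H.qv_succ, map_sub, map_smul, map_add]; rfl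
  h_succ k := by
    funext i
    simp only [H.hv_succ, map_sub, map_smul, map_add]; rfl
  M_lip t i := by
    rw [mean_toL2, ← map_sub, ← map_sub]
    refine norm_toL2_le_of_le H.L_nonneg fun ω => ?_
    have := H.smooth.lipschitz i (A.queryPoint η (path ξ ω) (path ζ ω) t i)
      (mean (A.queryPoint η (path ξ ω) (path ζ ω) t))
    have e : (H.qv t i - averageVec (H.qv t)).1 ω = A.queryPoint η (path ξ ω) (path ζ ω) t i
        - mean (A.queryPoint η (path ξ ω) (path ζ ω) t) := by
      rw [← H.average_qv_apply]; rfl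
    rw [e]
    exact this
  Φ_lip t i := by
    rw [mean_toL2, mean_toL2, ← map_sub, ← map_sub]
    refine norm_toL2_le_of_le H.L_nonneg fun ω => ?_
    have := H.smooth.lipschitz i (mean (A.queryPoint η (path ξ ω) (path ζ ω) (t + 1)))
      (mean (A.queryPoint η (path ξ ω) (path ζ ω) t))
    have e : (averageVec (H.qv (t + 1)) - averageVec (H.qv t)).1 ω
        = mean (A.queryPoint η (path ξ ω) (path ζ ω) (t + 1))
          - mean (A.queryPoint η (path ξ ω) (path ζ ω) t) := by
      rw [← H.average_qv_apply, ← H.average_qv_apply]; rfl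
    rw [e]
    exact this
  S_q t i j := H.inner_Sv t i _
    (measurable_queryPoint_beforeSample A η ξ ζ H.measurable_grad t i j)
  S_M t i j := H.inner_Sv t i _ ((H.continuous_gradient' j).measurable.comp
    (measurable_queryPoint_beforeSample A η ξ ζ H.measurable_grad t i j))
  S_Φ t i j := H.inner_Sv t i _ ((H.continuous_gradient' j).measurable.comp (measurable_mean_of
    fun j => measurable_queryPoint_beforeSample A η ξ ζ H.measurable_grad t i j))
  S_d k i j := H.inner_Sv (k + 1) i _ (((measurable_state_history A η ξ ζ H.measurable_grad k
    (a := k + 1) (b := k) (by omega) le_rfl).2.1 j).mono le_sup_left le_rfl)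
  S_S t i j hij := H.inner_Sv t i _
    ((measurable_gradAt_beforeSample A η ξ ζ H.measurable_grad t hij.symm).sub
      ((H.continuous_gradient' j).measurable.comp
        (measurable_queryPoint_beforeSample A η ξ ζ H.measurable_grad t i j)))
  norm_S t i := by
    have := H.prob
    rw [norm_toL2_sq]
    exact integral_sq_le_of_condExp_le (H.beforeSample_le' t i) (H.sampling.variance t i)
  e_y k i j := H.inner_ev k i _ (measurable_yAt_history A η ξ ζ H.measurable_grad k j)
  e_h k i j := H.inner_ev k i _
    ((measurable_state_history A η ξ ζ H.measurable_grad k (by omega) le_rfl).2.2 j)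
  e_d k i j := H.inner_ev k i _
    ((measurable_state_history A η ξ ζ H.measurable_grad k (by omega) le_rfl).2.1 j)
  e_Φ k i j := H.inner_ev k i _ ((H.continuous_gradient' j).measurable.comp (measurable_mean_of
    (measurable_state_history A η ξ ζ H.measurable_grad k (by omega) le_rfl).1))
  e_Φ_succ k i j := H.inner_ev k i _ ((H.continuous_gradient' j).measurable.comp
    (H.measurable_mean_queryPoint_succ k))
  norm_e k i := by
    have := H.prob
    rw [← map_sub, norm_toL2_sq, norm_toL2_sq]
    exact integral_compression_error_le H.unbiased (H.history_le' (k + 2) k)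
      (H.measurable_draw k i) (H.fresh.law k i) (H.fresh.indep k i) (H.measurable_target k i)
      (H.memLp_target k i)
  F_step t := by
    have := H.prob
    have h := integral_le_add_inner H.L_nonneg H.smooth.differentiable_avgFun
      (H.smooth.lipschitz_avgFun H.n_pos) (H.memLp_mean_queryPoint t)
      (H.memLp_mean_queryPoint (t + 1))
    rw [mean_toL2, mean_toL2, mean_toL2, ← map_sub, inner_toL2, norm_toL2_sq]
    have e : ∀ ω, (averageVec (H.qv (t + 1)) - averageVec (H.qv t)).1 ω
        = mean (A.queryPoint η (path ξ ω) (path ζ ω) (t + 1))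
          - mean (A.queryPoint η (path ξ ω) (path ζ ω) t) := fun ω => by
      rw [← H.average_qv_apply, ← H.average_qv_apply]; rfl
    simp only [e, H.average_Φv_apply]
    exact h

theorem F_ge (t : ℕ) : (n : ℝ)⁻¹ * ∑ i, fLow i ≤ H.run.F t := by
  have := H.prob
  have h := integral_mono (μ := P) (integrable_const ((n : ℝ)⁻¹ * ∑ i, fLow i))
    (integrable_comp_of_memLp H.L_nonneg H.smooth.differentiable_avgFun
      (H.smooth.lipschitz_avgFun H.n_pos) (H.memLp_mean_queryPoint t))
    fun ω => H.smooth.le_avgFun _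
  simp only [integral_const, probReal_univ, one_smul] at h
  exact h

theorem F_zero : H.run.F 0 = avgFun f (avgVec A.xStart) := by
  have := H.prob
  change ∫ _ω, avgFun f (avgVec A.xStart) ∂P = _
  simp

theorem normSq_q_zero : normSq (H.run.q 0) = ∑ i, ‖A.xStart i‖ ^ 2 := by
  have := H.prob
  refine Finset.sum_congr rfl fun i _ => ?_
  change ‖toL2 p P (H.qv 0 i)‖ ^ 2 = _
  rw [norm_toL2_sq]
  change ∫ _ω, ‖A.xStart i‖ ^ 2 ∂P = _
  simp

theorem normSq_M_zero : normSq (H.run.M 0) = ∑ i, ‖gradient (f i) (A.xStart i)‖ ^ 2 := by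
  have := H.prob
  refine Finset.sum_congr rfl fun i _ => ?_
  change ‖toL2 p P (H.Mv 0 i)‖ ^ 2 = _
  rw [norm_toL2_sq]
  change ∫ _ω, ‖gradient (f i) (A.xStart i)‖ ^ 2 ∂P = _
  simp

theorem normSq_h_zero : normSq (H.run.h 0) = ∑ i, ‖A.hStart i‖ ^ 2 := by
  have := H.prob
  refine Finset.sum_congr rfl fun i _ => ?_
  change ‖toL2 p P (H.hv 0 i)‖ ^ 2 = _
  rw [norm_toL2_sq]
  change ∫ _ω, ‖A.hStart i‖ ^ 2 ∂P = _
  simp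

theorem lintegral_gradient_eq (t : ℕ) :
    ∫⁻ ω, ‖gradient (avgFun f) (avgVec (A.state η (path ξ ω) (path ζ ω) t).x)‖ₑ ^ 2 ∂P
      = ENNReal.ofReal (‖mean (H.run.Φ (t + 1))‖ ^ 2) := by
  change _ = ENNReal.ofReal (‖mean (fun i => toL2 p P (H.Φv (t + 1) i))‖ ^ 2)
  rw [mean_toL2, ← lintegral_enorm_sq_eq]
  refine lintegral_congr fun ω => ?_
  rw [H.average_Φv_apply]; rfl

end CedasSetting

/-! ### The rate for the stepsize `√(n/K)` -/

/-- For large horizons `K`, the averaged squared gradient decays like `1/√(nK)`. -/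
theorem CompressedRun.average_norm_mean_Φ_le {n : ℕ} {E : Type*} [NormedAddCommGroup E]
    [InnerProductSpace ℝ E] {W : Matrix (Fin n) (Fin n) ℝ} {L σ κ α γ g η : ℝ} {K : ℕ}
    (R : CompressedRun E W L σ κ α γ η) (hηd : η = √((n : ℝ) / K)) (G : GapBasis W g)
    (hp : TunedParameters L κ α γ g η) (hW : ∀ j, ∑ i, W i j = 1) (hn : 0 < n)
    (hK : 0 < K) (hKb : (n : ℝ) ^ 3 ≤ (γ * g / 2) ^ 2 * K) {Flow D₀ c I : ℝ}
    (hF : ∀ t, Flow ≤ R.F t) (hF0 : R.F 0 - Flow ≤ D₀) (hc : normSq (R.q 0) ≤ c * (n : ℝ) ^ 2)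
    (hI : normSq (R.q 0) + normSq (R.M 0) + normSq (R.h 0) + n * σ ^ 2 ≤ I * (n : ℝ) ^ 2) :
    (K : ℝ)⁻¹ * ∑ t ∈ Finset.range K, ‖mean (R.Φ (t + 1))‖ ^ 2
      ≤ (4 * (D₀ + L ^ 2 * c + L * σ ^ 2) + 320 * L ^ 2 * (1 + L ^ 2) * I + 48 * L ^ 2 * σ ^ 2
        + 4 * L * σ ^ 2) / √((n : ℝ) * K) := by
  have hn1 : (1 : ℝ) ≤ n := by exact_mod_cast hn
  have hn0 : (0 : ℝ) < n := by linarith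
  have hK0 : (0 : ℝ) < K := by exact_mod_cast hK
  have hb0 := hp.rate_pos
  have hb1 : γ * g / 2 ≤ 1 := by have := hp.rate_le; have := hp.γ_le; linarith
  have hL := hp.L_nonneg
  have hη := hp.η_pos
  obtain ⟨s, hs⟩ : ∃ s, s = √((n : ℝ) * K) := ⟨_, rfl⟩
  have hs0 : 0 < s := by rw [hs]; positivity
  have hs2 : s ^ 2 = n * K := by rw [hs, Real.sq_sqrt (by positivity)]
  have hη2 : η ^ 2 = n / K := by rw [hηd, Real.sq_sqrt (by positivity)]
  have hηL : η * L ≤ 1 / 2 := by have := hp.η_le; linarith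
  have hηs : η = s / K := by
    have h1 : (s / K) ^ 2 = η ^ 2 := by rw [hη2, div_pow, hs2]; field_simp
    exact ((pow_left_inj₀ (by positivity) hη.le two_ne_zero).1 h1).symm
  have h1 := R.sum_norm_mean_Φ_le G hp hW hn hF (K - 1)
  have hΘ := R.lyapunov_zero_le G hp hW hn
  have hd := R.F_descent hW hn hL hη.le hηL 0
  obtain ⟨b, hb⟩ : ∃ b, b = γ * g / 2 := ⟨_, rfl⟩
  rw [← hb] at h1 hΘ hKb hb0 hb1
  -- After squaring this is `n³ ≤ b²K`. It returns below as `n/(bK) ≤ 1/√(nK)`, which brings the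
  -- Lyapunov and consensus terms down to the target order.
  have hns : n * s ≤ b * K := by
    refine le_of_sq_le_sq ?_ (by positivity)
    calc (n * s) ^ 2 = (n : ℝ) ^ 3 * K := by rw [mul_pow, hs2]; ring
      _ ≤ b ^ 2 * K * K := by gcongr
      _ = _ := by ring
  have hsb : s ≤ b * K := (le_mul_of_one_le_left hs0.le hn1).trans hns
  have hbK : b * K ≤ K := mul_le_of_le_one_left hK0.le hb1
  have hnη : n * η ≤ 1 := by
    rw [hηs, mul_div_assoc', div_le_one hK0]; exact hns.trans hbK
  have hη1 : η ≤ 1 := by rw [hηs, div_le_one hK0]; exact hsb.trans hbK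
  have hη2b : η ^ 2 ≤ b := by
    have : η ≤ b := by rw [hηs, div_le_iff₀ hK0]; exact hsb
    calc η ^ 2 = η * η := sq η
      _ ≤ b * 1 := by gcongr
      _ = b := mul_one b
  have hΘ' : R.lyapunov G 0 ≤ 20 * (1 + L ^ 2) * (I * (n : ℝ) ^ 2) :=
    (hΘ hη2b).trans (mul_le_mul_of_nonneg_left hI (by positivity))
  -- The data concern index `0`, that is `x_{-1}`, while the sum starts at index `1`; one descent
  -- step bridges the two. An initial spread as large as `c n²` is harmless since `nη ≤ 1`.
  have hF1 : R.F 1 - Flow ≤ D₀ + L ^ 2 * c + L * σ ^ 2 := by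
    have hX : η * (L ^ 2 / n * spread (R.q 0)) / 2 ≤ L ^ 2 * c := by
      have k0 : 0 ≤ c := by
        have := (normSq_nonneg (R.q 0)).trans hc
        exact nonneg_of_mul_nonneg_left this (by positivity)
      have k1 := (spread_le_normSq hn (R.q 0)).trans hc
      calc η * (L ^ 2 / n * spread (R.q 0)) / 2 ≤ η * (L ^ 2 / n * (c * (n : ℝ) ^ 2)) / 2 := by
            gcongr
        _ = (n * η) * (L ^ 2 * c) / 2 := by field_simp
        _ ≤ 1 * (L ^ 2 * c) / 2 := by gcongr
        _ ≤ _ := by have : 0 ≤ L ^ 2 * c := by positivity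
                    linarith
    have hY : L * η ^ 2 * (σ ^ 2 / n) ≤ L * σ ^ 2 := by
      calc L * η ^ 2 * (σ ^ 2 / n) ≤ L * 1 * (σ ^ 2 / 1) := by
            gcongr
            exact pow_le_one₀ hη.le hη1
        _ = _ := by ring
    have : 0 ≤ η / 2 * ‖mean (R.Φ 0)‖ ^ 2 := by positivity
    simp only [zero_add] at hd
    linarith
  have hcast : ((K - 1 : ℕ) : ℝ) + 1 = K := by
    rw [Nat.cast_sub hK, Nat.cast_one, sub_add_cancel]
  rw [Nat.sub_add_cancel hK, hcast] at h1
  have hD : 0 ≤ R.F 1 - Flow := sub_nonneg.2 (hF 1)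
  have hI0 : 0 ≤ I := by
    have h2 : 0 ≤ I * (n : ℝ) ^ 2 := by
      refine le_trans ?_ hI
      have := normSq_nonneg (R.q 0)
      have := normSq_nonneg (R.M 0)
      have := normSq_nonneg (R.h 0)
      positivity
    exact nonneg_of_mul_nonneg_left h2 (by positivity)
  have hnb : n / (b * K) ≤ 1 / s := by
    rw [div_le_div_iff₀ (by positivity) hs0]; linarith
  have t1 : (K : ℝ)⁻¹ * (4 / η * (R.F 1 - Flow)) ≤ 4 * (D₀ + L ^ 2 * c + L * σ ^ 2) * (1 / s) := by
    have e : (K : ℝ)⁻¹ * (4 / η * (R.F 1 - Flow)) = 4 * (R.F 1 - Flow) * (1 / s) := by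
      have e₀ : (K : ℝ)⁻¹ * (4 / η) = 4 * (1 / s) := by rw [hηs]; field_simp
      rw [← mul_assoc, e₀]; ring
    rw [e]; gcongr
  have t2 : (K : ℝ)⁻¹ * (16 * L ^ 2 / (n * b) * R.lyapunov G 0)
      ≤ 320 * L ^ 2 * (1 + L ^ 2) * I * (1 / s) := by
    calc _ ≤ (K : ℝ)⁻¹ * (16 * L ^ 2 / (n * b) * (20 * (1 + L ^ 2) * (I * (n : ℝ) ^ 2))) := by
          gcongr
      _ = 320 * L ^ 2 * (1 + L ^ 2) * I * (n / (b * K)) := by field_simp; ring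
      _ ≤ _ := by gcongr
  have t3 : (K : ℝ)⁻¹ * (48 * (L ^ 2 * η ^ 2 * σ ^ 2 * K) / b) ≤ 48 * L ^ 2 * σ ^ 2 * (1 / s) := by
    calc _ = 48 * L ^ 2 * σ ^ 2 * (n / (b * K)) := by rw [hη2]; field_simp
      _ ≤ _ := by gcongr
  have t4 : (K : ℝ)⁻¹ * (4 * K * L * η * (σ ^ 2 / n)) = 4 * L * σ ^ 2 * (1 / s) := by
    have e : s / (K * n) = 1 / s := by
      rw [div_eq_div_iff (by positivity) hs0.ne']; linarith
    rw [hηs, ← e]; field_simp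
  have h2 := mul_le_mul_of_nonneg_left h1 (by positivity : 0 ≤ (K : ℝ)⁻¹)
  rw [← hs, div_eq_mul_one_div]
  linarith

/-- The parameters prescribed for CEDAS are tuned. -/
theorem gamma_eq_of_prescribed {C δ g α γ : ℝ} (hC : 1 ≤ 12 * C * (1 - δ))
    (hg2 : g ≤ 2) (hα : α = 1 / (12 * C * (1 - δ)))
    (hγ : γ = min (min (√α / (2 * √(C * (1 - δ)))) (1 / 2)) (α ^ 2 * g / (1728 * C * (1 - δ)))) :
    γ = α ^ 3 * g / 144 := by
  obtain ⟨κ, hκ⟩ : ∃ κ, κ = C * (1 - δ) := ⟨_, rfl⟩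
  rw [show 12 * C * (1 - δ) = 12 * κ by rw [hκ]; ring] at hC hα
  rw [← hκ, show 1728 * C * (1 - δ) = 1728 * κ by rw [hκ]; ring] at hγ
  have hκ0 : 0 < κ := by linarith
  have hα0 : 0 < α := by rw [hα]; positivity
  have hα1 : α ≤ 1 := by rw [hα, div_le_one (by positivity)]; exact hC
  have hακ : α * κ = 1 / 12 := by rw [hα]; field_simp
  have e : α ^ 2 * g / (1728 * κ) = α ^ 3 * g / 144 := by
    rw [div_eq_div_iff (by positivity) (by norm_num)]
    have : α ^ 3 * g * (1728 * κ) = 1728 * (α ^ 2 * g) * (α * κ) := by ring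
    rw [this, hακ]; ring
  rw [hγ, e]
  have hα3 : α ^ 3 * g ≤ α ^ 3 * 2 := by gcongr
  have hα2 : α ^ 3 ≤ α := by
    calc α ^ 3 = α * α ^ 2 := by ring
      _ ≤ α * 1 := by gcongr; exact pow_le_one₀ hα0.le hα1
      _ = α := mul_one _
  -- The last entry is always the smallest: it is at most `α³/72`, while `ακ = 1/12` makes the first
  -- entry equal to `√3 α`.
  refine min_eq_right (le_min ?_ ?_)
  · have hr0 : 0 < √κ := Real.sqrt_pos.2 hκ0
    have hr2 : √κ ^ 2 = κ := Real.sq_sqrt hκ0.le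
    have ha : α ≤ √α := by
      rw [Real.le_sqrt' hα0]; nlinarith
    have har : α * √κ ≤ 1 := by
      refine le_of_sq_le_sq ?_ zero_le_one
      rw [mul_pow, hr2, one_pow]
      have : α ^ 2 * κ = α * (α * κ) := by ring
      rw [this, hακ]; linarith
    rw [le_div_iff₀ (by positivity)]
    have h1 : α ^ 3 * g / 144 * (2 * √κ) ≤ α ^ 3 * 2 / 144 * (2 * √κ) := by gcongr
    have h2 : α ^ 3 * 2 / 144 * (2 * √κ) = α ^ 2 * (α * √κ) / 36 := by ring
    have h3 : α ^ 2 * (α * √κ) ≤ α ^ 2 * 1 := by gcongr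
    nlinarith
  · linarith

/-! ### From the rate to the transient time. -/

theorem CedasSetting.avgGradSq_eq {n p : ℕ} {Ω S Z : Type*} [MeasurableSpace Ω]
    [MeasurableSpace S] [MeasurableSpace Z] {P : Measure Ω} {A : Cedas n p S Z}
    {f : Fin n → Vec p → ℝ} {fLow : Fin n → ℝ} {L σ κ : ℝ} {ξ : ℕ → Fin n → Ω → S}
    {ζ : ℕ → Fin n → Ω → Z} {K : ℕ} (hK : 0 < K)
    (H : CedasSetting P A f fLow L σ κ (√((n : ℝ) / K)) ξ ζ) :
    avgGradSq P A f ξ ζ K = ENNReal.ofReal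
      ((K : ℝ)⁻¹ * ∑ t ∈ Finset.range K, ‖mean (H.run.Φ (t + 1))‖ ^ 2) := by
  have hK0 : (0 : ℝ) < K := by exact_mod_cast hK
  rw [avgGradSq, ENNReal.ofReal_mul (by positivity), ENNReal.ofReal_inv_of_pos hK0,
    ENNReal.ofReal_natCast, ENNReal.ofReal_sum_of_nonneg fun _ _ => sq_nonneg _]
  congr 1
  exact Finset.sum_congr rfl fun t _ => H.lintegral_gradient_eq t

/-- The horizon `⌈K₀⌉` is admissible, and `⌈K₀⌉ ≤ K₀ + 1 ≤ 2 K₀`. -/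
theorem transientTime_le {n p : ℕ} {Ω S Z : Type*} [MeasurableSpace Ω]
    [MeasurableSpace Z] {P : Measure Ω} {A : Cedas n p S Z}
    {f : Fin n → Vec p → ℝ} {ξ : ℕ → Fin n → Ω → S} {ζ : ℕ → Fin n → Ω → Z} {Kmin a K₀ : ℝ}
    (hK₀ : 1 ≤ K₀) (hmin : Kmin ≤ K₀)
    (h : ∀ k : ℕ, K₀ ≤ k → avgGradSq P A f ξ ζ k ≤ ENNReal.ofReal (a / √((n : ℝ) * k))) :
    (transientTime P A f ξ ζ Kmin a : ℝ≥0∞) ≤ ENNReal.ofReal (2 * K₀) := by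
  have h1 : transientTime P A f ξ ζ Kmin a ≤ (⌈K₀⌉₊ : ℕ∞) := by
    refine sInf_le ⟨⌈K₀⌉₊, rfl, hmin.trans (Nat.le_ceil _), fun k hk => h k ?_⟩
    exact (Nat.le_ceil _).trans (by exact_mod_cast hk)
  have h2 : (transientTime P A f ξ ζ Kmin a : ℝ≥0∞) ≤ ((⌈K₀⌉₊ : ℕ∞) : ℝ≥0∞) :=
    ENat.toENNReal_le.2 h1
  refine h2.trans ?_
  rw [ENat.toENNReal_coe, ← ENNReal.ofReal_natCast]
  refine ENNReal.ofReal_le_ofReal ?_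
  have := (Nat.ceil_lt_add_one (by linarith : 0 ≤ K₀)).le
  linarith

theorem corollary5
    -- smoothness and noise levels, initial gap, constants of the growth conditions
    (L σ Δ c₁ c₂ c₃ c₄ r : ℝ) (hL : 0 < L) (hσ : 0 < σ) (hr : 0 < r) :
    ∃ a b : ℝ, 0 < a ∧ 0 < b ∧
      ∀ (n p : ℕ) (hn : 2 ≤ n)
        (Ω S Z₁ Z₂ : Type*) [MeasurableSpace Ω] [MeasurableSpace S]
        [MeasurableSpace Z₁] [MeasurableSpace Z₂]
        (P : Measure Ω) [IsProbabilityMeasure P]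
        -- the network
        (G : SimpleGraph (Fin n)) (W : Matrix (Fin n) (Fin n) ℝ) (hW : IsMixingMatrix G W)
        (lam₂ : ℝ) (_ : lam₂ = secondEigenvalue W hW.isHermitian hn)
        -- the objective functions
        (f : Fin n → Vec p → ℝ) (fLow : Fin n → ℝ) (_ : IsSmoothBelow f L fLow)
        -- the compressors
        (𝒞₁ : RandomMap p Z₁) (𝒞₂ : RandomMap p Z₂) (C δ : ℝ)
        (_ : 𝒞₁.IsBiased δ) (_ : 𝒞₂.IsUnbiased C)
        -- the algorithm
        (A : Cedas n p S (Z₁ × Z₂)) (_ : A.W = W) (_ : A.compressor = 𝒞₁.corrected 𝒞₂)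
        (_ : ∀ i, Measurable (Function.uncurry (A.grad i)))
        (_ : A.α = 1 / (12 * C * (1 - δ))) (_ : 1 ≤ 12 * C * (1 - δ))
        (_ : A.γ = min (min (√A.α / (2 * √(C * (1 - δ)))) (1 / 2))
          (A.α ^ 2 * (1 - lam₂) / (1728 * C * (1 - δ))))
        -- the randomness
        (ξ : ℕ → Fin n → Ω → S) (ζ : ℕ → Fin n → Ω → Z₁ × Z₂)
        (_ : ∀ t i, Measurable (ξ t i)) (_ : ∀ k i, Measurable (ζ k i))
        (_ : ∀ K : ℕ, 0 < K → IsUnbiasedSampling P A f σ (√((n : ℝ) / K)) ξ ζ)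
        (_ : IsFreshCompression P A ξ ζ)
        -- the initial values and the growth conditions
        (_ : avgFun f (avgVec A.xStart) - (n : ℝ)⁻¹ * ∑ i, fLow i ≤ Δ)
        (_ : ∑ i, ‖A.xStart i‖ ^ 2 ≤ c₁ * (n : ℝ) ^ 2)
        (_ : ∑ i, ‖A.hStart i‖ ^ 2 ≤ c₂ * (n : ℝ) ^ 2)
        (_ : ∑ i, ‖gradient (f i) (A.xStart i)‖ ^ 2 ≤ c₃ * (n : ℝ) ^ 2)
        (_ : 1 / (1 - lam₂) ≤ c₄ * (n : ℝ) ^ r),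
        (transientTime P A f ξ ζ
            (max (12 * L ^ 2 * n / A.α) (256 * n * L ^ 2 / (A.γ ^ 2 * (1 - lam₂) ^ 2))) a : ℝ≥0∞)
          ≤ ENNReal.ofReal (b * (n ^ 3 * C ^ 6 * (1 - δ) / (1 - lam₂) ^ 4)) := by
  -- The first witness is the constant of `average_norm_mean_Φ_le`, with absolute values to ensure
  -- positivity. In the second, `2` comes from rounding up the horizon and `497664 = 2 · 144 · 12³`
  -- from `γg/2 = g²/(497664 κ³)`.
  refine ⟨4 * (|Δ| + L ^ 2 * |c₁| + L * σ ^ 2) + 320 * L ^ 2 * (1 + L ^ 2) *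
      (|c₁| + |c₃| + |c₂| + σ ^ 2) + 48 * L ^ 2 * σ ^ 2 + 4 * L * σ ^ 2,
    2 * ((1 + 256 * L ^ 2) * 497664 ^ 2), by positivity, by positivity, ?_⟩
  intro n p hn Ω S Z₁ Z₂ _ _ _ _ P hP G W hW lam₂ hlam f fLow hf 𝒞₁ 𝒞₂ C δ h𝒞₁ h𝒞₂ A hAW hAC
    hgrad hα hC hγ ξ ζ hξ hζ hsamp hfresh hΔ hc₁ hc₂ hc₃ _
  have hn0 : 0 < n := by omega
  have hn1 : (1 : ℝ) ≤ n := by exact_mod_cast hn0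
  have hnpos : (0 : ℝ) < n := by linarith
  obtain ⟨GB⟩ := hW.nonempty_gapBasis hn
  have hg1 := hW.secondEigenvalue_lt_one hn
  have hg2 := hW.neg_one_le_secondEigenvalue hn
  rw [← hlam] at GB hg1 hg2
  obtain ⟨g, hgd⟩ : ∃ g, g = 1 - lam₂ := ⟨_, rfl⟩
  rw [← hgd] at GB hγ ⊢
  have hg0 : 0 < g := by linarith
  have hgle : g ≤ 2 := by linarith
  have hγ' := gamma_eq_of_prescribed hC hgle hα hγ
  subst hAW
  obtain ⟨κ, hκ⟩ : ∃ κ, κ = C * (1 - δ) := ⟨_, rfl⟩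
  have hC' : 1 ≤ 12 * κ := by rw [hκ]; linarith
  have hκ0 : 0 < κ := by linarith
  have hαe : A.α = 1 / (12 * κ) := by rw [hα, hκ]; ring
  have hα0 : 0 < A.α := by rw [hαe]; positivity
  have hα1 : A.α ≤ 1 := by rw [hαe, div_le_one (by positivity)]; exact hC'
  have hκe : κ = 1 / (12 * A.α) := by rw [hαe]; field_simp
  have hu : A.compressor.IsUnbiased κ := by
    rw [hAC, hκ]
    exact RandomMap.corrected_isUnbiased h𝒞₁ h𝒞₂ (by rw [← hκ]; exact hκ0)
  -- the rate `b` and the horizon `K₀`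
  obtain ⟨b, hb⟩ : ∃ b, b = A.γ * g / 2 := ⟨_, rfl⟩
  have hγ0 : 0 < A.γ := by rw [hγ']; positivity
  have hb0 : 0 < b := by rw [hb]; positivity
  have hα3 : A.α ^ 3 ≤ A.α := by
    calc A.α ^ 3 = A.α * A.α ^ 2 := by ring
      _ ≤ A.α * 1 := by gcongr; exact pow_le_one₀ hα0.le hα1
      _ = A.α := mul_one _
  have hbα : b ≤ A.α / 72 := by
    have h1 : A.α ^ 3 * g ≤ A.α * 2 := by gcongr
    have h2 : A.γ * g ≤ A.γ * 2 := by gcongr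
    rw [hb]; linarith
  -- The summand `n³/b²` is what the rate needs. The summand with `256 L²` gives `ηL ≤ b/16` and
  -- dominates both entries of the prescribed minimal horizon.
  obtain ⟨K₀, hK₀⟩ : ∃ K₀, K₀ = (1 + 256 * L ^ 2) * (n : ℝ) ^ 3 / b ^ 2 := ⟨_, rfl⟩
  have hb1 : b ≤ 1 := by linarith
  have hn3 : (n : ℝ) ≤ (n : ℝ) ^ 3 := le_self_pow₀ hn1 (by norm_num)
  have hK₀1 : 1 ≤ K₀ := by
    rw [hK₀, one_le_div (by positivity)]
    have h1 : b ^ 2 ≤ 1 := pow_le_one₀ hb0.le hb1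
    have h2 : 0 ≤ L ^ 2 * (n : ℝ) ^ 3 := by positivity
    linarith
  have hmin : max (12 * L ^ 2 * n / A.α) (256 * n * L ^ 2 / (A.γ ^ 2 * g ^ 2)) ≤ K₀ := by
    have hLn : L ^ 2 * n ≤ L ^ 2 * (n : ℝ) ^ 3 := by gcongr
    have hLn0 : 0 ≤ L ^ 2 * (n : ℝ) ^ 3 := by positivity
    refine max_le ?_ ?_
    · rw [hK₀]
      refine div_le_div₀ (by positivity) (by linarith) (by positivity) ?_
      calc b ^ 2 = b * b := sq b
        _ ≤ 1 * A.α := by gcongr; linarith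
        _ = A.α := one_mul _
    · have e : A.γ ^ 2 * g ^ 2 = 4 * b ^ 2 := by rw [hb]; ring
      rw [hK₀, e]
      refine div_le_div₀ (by positivity) (by linarith) (by positivity) ?_
      linarith [sq_nonneg b]
  have hbound : ENNReal.ofReal (2 * K₀) ≤ ENNReal.ofReal
      (2 * ((1 + 256 * L ^ 2) * 497664 ^ 2) * (n ^ 3 * C ^ 6 * (1 - δ) / g ^ 4)) := by
    refine ENNReal.ofReal_le_ofReal ?_
    have hδ0 : 0 ≤ 1 - δ := by linarith [h𝒞₁.le_one]
    have hδ1 : 1 - δ ≤ 1 := by linarith [h𝒞₁.pos]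
    have e : b = g ^ 2 / (497664 * κ ^ 3) := by
      rw [hb, hγ', hαe]; field_simp; norm_num
    -- Five of the six factors `1 - δ ≤ 1` are given away.
    have hκ6 : κ ^ 6 ≤ C ^ 6 * (1 - δ) := by
      rw [hκ, mul_pow]
      have hC0 := h𝒞₂.pos
      gcongr
      exact pow_le_of_le_one hδ0 hδ1 (by norm_num)
    calc 2 * K₀ = 2 * ((1 + 256 * L ^ 2) * 497664 ^ 2) * (n ^ 3 * κ ^ 6 / g ^ 4) := by
          rw [hK₀, e]; field_simp
      _ ≤ 2 * ((1 + 256 * L ^ 2) * 497664 ^ 2) * (n ^ 3 * (C ^ 6 * (1 - δ)) / g ^ 4) := by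
          gcongr
      _ = _ := by ring
  refine (transientTime_le hK₀1 hmin fun K hK => ?_).trans hbound
  have hKr : (0 : ℝ) < K := by linarith
  have hKpos : 0 < K := by exact_mod_cast hKr
  have hKb : (1 + 256 * L ^ 2) * (n : ℝ) ^ 3 ≤ b ^ 2 * K := by
    rw [hK₀, div_le_iff₀ (by positivity)] at hK
    linarith
  have hp : TunedParameters L κ A.α A.γ g (√((n : ℝ) / K)) := by
    refine ⟨hL.le, hα0, hα1, hκe, hg0, hgle, hγ', Real.sqrt_pos.2 (by positivity), ?_⟩
    rw [← hb]
    refine le_of_sq_le_sq ?_ (by positivity)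
    rw [mul_pow, Real.sq_sqrt (by positivity), div_pow, div_mul_eq_mul_div,
      div_le_div_iff₀ hKr (by norm_num)]
    have h1 : L ^ 2 * n ≤ L ^ 2 * (n : ℝ) ^ 3 := by gcongr
    have h2 : 0 ≤ (n : ℝ) ^ 3 := by positivity
    have h3 : (n : ℝ) * L ^ 2 * 16 ^ 2 ≤ b ^ 2 * K := by linarith
    exact h3
  have H : CedasSetting P A f fLow L σ κ (√((n : ℝ) / K)) ξ ζ :=
    ⟨hn0, hL.le, hP, hW.sum_col, hf, hu, hgrad, hξ, hζ, hsamp K hKpos, hfresh⟩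
  rw [CedasSetting.avgGradSq_eq hKpos H]
  refine ENNReal.ofReal_le_ofReal ?_
  have hnn : (0 : ℝ) ≤ (n : ℝ) ^ 2 := sq_nonneg _
  have hq := hc₁.trans (mul_le_mul_of_nonneg_right (le_abs_self c₁) hnn)
  have hh := hc₂.trans (mul_le_mul_of_nonneg_right (le_abs_self c₂) hnn)
  have hM := hc₃.trans (mul_le_mul_of_nonneg_right (le_abs_self c₃) hnn)
  have hσn : n * σ ^ 2 ≤ σ ^ 2 * (n : ℝ) ^ 2 := by
    have : (n : ℝ) ≤ (n : ℝ) ^ 2 := le_self_pow₀ hn1 (by norm_num)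
    nlinarith [sq_nonneg σ]
  refine H.run.average_norm_mean_Φ_le rfl GB hp hW.sum_col hn0 hKpos ?_ H.F_ge ?_ ?_ ?_
  · rw [← hb]
    have : 0 ≤ 256 * L ^ 2 * (n : ℝ) ^ 3 := by positivity
    linarith
  · rw [H.F_zero]; exact hΔ.trans (le_abs_self Δ)
  · rw [H.normSq_q_zero]; exact hq
  · rw [H.normSq_q_zero, H.normSq_M_zero, H.normSq_h_zero]
    linarith
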